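/- For $\theta_0\in(0,\pi)$ put $z_0=e^{i\theta_0}$, $x_c=x_c(\theta_0)=-2\ln\tan\frac{\theta_0}{4}$ and $\ell=\ell(\theta_0)=-2\ln\sin\frac{\theta_0}{2}$. For $0\le s\le 1$ let $f$ be the symbol on the unit circle $S_1$ given by $f(e^{i\theta})=1$ for $-\theta_0\le\theta\le\theta_0$ and $f(e^{i\theta})=s$ for $\theta_0<\theta<2\pi-\theta_0$. For $n\in\mathbb N$ consider the following Riemann–Hilbert problem for $Y:\mathbb C\setminus S_1\to\mathbb C^{2\times 2}$: (a) $Y$ is analytic in $\mathbb C\setminus S_1$; (b) for $z\in S_1\setminus\{z_0,\overline{z_0}\}$ the limits $Y_+(z)$ from inside and $Y_-(z)$ from outside the unit circle exist and $Y_+(z)=Y_-(z)\begin{pmatrix}1& z^{-n}f(z)\\0&1\end{pmatrix}$; (c) $Y(z)=(I+O(z^{-1}))\begin{pmatrix}z^n&0\\0&z^{-n}\end{pmatrix}$ as $z\to\infty$; (d) as $z\to p$, with $p=z_0$ or $p=\overline{z_0}$, the first column of $Y(z)$ is $O(1)$ and the second column is $O(\ln|z-p|)$. Let $\epsilon>0$.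 Then there are constants $C$ and $N$, depending only on $\epsilon$, such that for all $n\ge N$, all $\theta_0\in[\epsilon,\pi-\epsilon]$ and all $0\le s<e^{-nx_c}$ (that is, $s=e^{-nx}$ with $x_c<x\le+\infty$) this problem has a unique solution $Y=Y(z;n,s,\theta_0)$, and: $$\left|Y_{12}(0)-e^{-n\ell}\sin\tfrac{\theta_0}{2}\right|\le e^{-n\ell}\,C n^{-1/2};$$ $\ln Y_{12}(0)$ is differentiable in $s\in[0,e^{-nx_c})$ (one-sidedly at $s=0$), with $$\left|\partial_s\ln Y_{12}(0)\right|\le C n^{-1/2}e^{nx_c};$$ and the limit $Y_{11}(z_0)=\lim_{z\to z_0,\ z\notin S_1}Y_{11}(z)$ exists, with $$\left|Y_{11}(z_0)\right|\le e^{-n\ell/2}\,C n^{1/2}.$$ In short, $Y_{12}(0)=e^{-n\ell}[\sin\frac{\theta_0}{2}+O(n^{-1/2})]$, $\partial_s\ln Y_{12}(0)=O(n^{-1/2}e^{nx_c})$ and $Y_{11}(e^{i\theta_0})=e^{-n\ell/2}O(n^{1/2})$ as $n\to\infty$ with $x>x_c$. -/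

import Mathlib

open Filter Topology Asymptotics

noncomputable section

/-- The symbol with `W = 0`: at `e^{iθ}` it equals `1` for `-θ₀ ≤ θ ≤ θ₀` and `s` for
`θ₀ < θ < 2π - θ₀`. It is only used on the unit circle. -/
def arcSymbol (θ₀ s : ℝ) (z : ℂ) : ℂ :=
  if |z.arg| ≤ θ₀ then 1 else (s : ℂ)

/-- The endpoint `z₀ = e^{iθ₀}` of the arc; the other endpoint is its complex conjugate. -/
def arcEnd (θ₀ : ℝ) : ℂ := Complex.exp ((θ₀ : ℂ) * Complex.I)

/-- The critical value `x_c = -2 ln tan (θ₀ / 4)`. -/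
def xCrit (θ₀ : ℝ) : ℝ := -2 * Real.log (Real.tan (θ₀ / 4))

/-- The Euler-Lagrange constant `ℓ = -2 ln sin (θ₀ / 2)` of the equilibrium measure on the arc. -/
def ellConst (θ₀ : ℝ) : ℝ := -2 * Real.log (Real.sin (θ₀ / 2))

/-- The complement of the unit circle. -/
def offCircle : Set ℂ := {z | ‖z‖ ≠ 1}

/-- `Y` solves the Riemann-Hilbert problem of degree `n` for the symbol `arcSymbol θ₀ s`.
The values of `Y` on the unit circle itself are irrelevant. -/
structure IsRHSolution (n : ℕ) (θ₀ s : ℝ) (Y : ℂ → Matrix (Fin 2) (Fin 2) ℂ) : Prop where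
  /-- Every entry is analytic off the unit circle. -/
  analytic : ∀ i j, DifferentiableOn ℂ (fun z => Y z i j) offCircle
  /-- Away from the two endpoints, the limits `Yp` from inside and `Ym` from outside exist, and
  they satisfy the jump relation. -/
  jump : ∀ z : ℂ, ‖z‖ = 1 → z ≠ arcEnd θ₀ → z ≠ star (arcEnd θ₀) →
    ∃ Yp Ym : Matrix (Fin 2) (Fin 2) ℂ,
      Tendsto Y (𝓝[{w | ‖w‖ < 1}] z) (𝓝 Yp) ∧
      Tendsto Y (𝓝[{w | 1 < ‖w‖}] z) (𝓝 Ym) ∧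
      Yp = Ym * !![1, z ^ (-(n : ℤ)) * arcSymbol θ₀ s z; 0, 1]
  /-- `Y(z) = (I + O(1/z)) diag(z^n, z^{-n})` as `z → ∞`. -/
  infinity : ∀ i j,
    (fun z : ℂ => (Y z * !![z ^ (-(n : ℤ)), 0; 0, z ^ (n : ℤ)] - 1) i j)
      =O[Bornology.cobounded ℂ] (fun z : ℂ => z⁻¹)
  /-- At both endpoints the first column is bounded. -/
  endpoint_fst : ∀ p : ℂ, p = arcEnd θ₀ ∨ p = star (arcEnd θ₀) → ∀ i,
    (fun z : ℂ => Y z i 0) =O[𝓝[offCircle] p] (fun _ => (1 : ℝ))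
  /-- At both endpoints the second column grows at most logarithmically. -/
  endpoint_snd : ∀ p : ℂ, p = arcEnd θ₀ ∨ p = star (arcEnd θ₀) → ∀ i,
    (fun z : ℂ => Y z i 1) =O[𝓝[offCircle] p] (fun z => Real.log ‖z - p‖)

end

/-!
The Riemann–Hilbert problem is that of Fokas–Its–Kitaev type for the polynomials orthogonal on the
unit circle with respect to the weight `f`, and every quantity in the theorem is read off from
the monic orthogonal polynomial `Φ` of degree `n`. If `Φ` is orthogonal to `1, z, …, z ^ (n - 1)`
and `Q` solves the moment problem of lower degree, then `Φ`, `Q` and their Cauchy transforms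
against `z ^ (-n) f` are the entries of a solution (`isRHSolution_of_moments`); the jumps and the
logarithmic singularities of the Cauchy transforms come from the closed form of the Cauchy integral
of an arc. For two solutions `Y`, `Z` the matrix `Z · adj Y` has no jump, hence is the identity by a
Liouville argument (`IsRHSolution.eqOn`). Therefore `Y₁₁ = Φ`, and `Y₁₂(0)` is the square of the
norm of `Φ` in `L²(f dθ / 2π)`, called `energy`. It is the minimum of the energy over all monic
polynomials of degree `n` (`IsMonicOrthogonal.energy_le`), so the asymptotics follow from bounds on
both sides, and no steepest descent analysis is needed.

Let `ρ = sin (θ₀ / 2)`. The arc is parametrized by `θ = 2ψ` with `sin ψ = ρ cos φ`. With the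
automorphism `B(b) = (b + iρ) / (1 - iρb)` of the disc one has `B(b) / b = e^{iθ}` for a point `b`
of the unit circle, so the unit circle covers the arc twice and a polynomial `P` of degree `n` turns
into the function `b ^ n P(B(b) / b)`, analytic in the disc, with value `(iρ) ^ n` times the leading
coefficient of `P` at the origin. Three estimates are made in this variable.

* Cauchy's formula bounds a polynomial off the arc by its energy on the arc, and integrating these
  bounds over the gap gives `gapEnergy P ≤ C n^{-1/2} cot (θ₀ / 4) ^ (2n) · energy P`
  (`gapEnergy_le`). The factor `n^{-1/2}` is that of a Gaussian integral around `θ = π`, where the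
  bound is largest. As `exp (-n x_c) = tan (θ₀ / 4) ^ (2n)`, the gap contributes a relative error
  `O(n^{-1/2})` for all `s` below the critical value.
* The mean value property of `b ^ n P(B(b) / b) g(b)`, for a suitable `g` with `g(0) = 1`, expresses
  the leading coefficient of `P` as an integral over the arc, and the Cauchy–Schwarz inequality
  gives `energy P ≥ ρ ^ (2n + 1) (1 - O(1 / n))` for monic `P` (`le_energy_zero_of_monic`).
* For the upper bound, a polynomial approximation of `1 / g` is combined with the Chebyshev
  polynomials of the arc to a trial polynomial whose energy on the arc is at most
  `ρ ^ (2n + 1) (1 + O(n^{-1/2}))` (`exists_monic_energy_le`). The square root singularities of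
  `1 / g` at the endpoints of the arc are responsible for the exponent `-1/2`.

Since the minimal energy is stationary in `Φ`, its derivative in `s` is the energy of `Φ` in the gap
(`IsMonicOrthogonal.hasDerivWithinAt_energy`), and `gapEnergy_le` bounds the logarithmic derivative.
Finally, integrating the derivative of `sin θ |Φ(e^{iθ})|²` against the weight leaves the value at
the endpoints on one side, and on the other side an expression which orthogonality bounds by
`O(n)` times the energy (`IsMonicOrthogonal.sq_norm_eval_arcEnd_le`).
-/

/-! ### Functions without jump across the unit circle -/

theorem isOpen_offCircle : IsOpen offCircle :=
  isOpen_ne_fun continuous_norm continuous_const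

theorem dense_offCircle : Dense offCircle := by
  have h : (offCircle)ᶜ = Metric.sphere (0 : ℂ) 1 := by
    ext z; simp [offCircle]
  rw [← compl_compl offCircle, ← interior_eq_empty_iff_dense_compl, h, interior_sphere']

/-- A continuous function that is holomorphic off the unit circle and grows at most linearly is
affine in the disc. -/
theorem affine_inside_of_continuous_of_linear_growth {g : ℂ → ℂ} (hc : Continuous g)
    (hd : DifferentiableOn ℂ g offCircle) {K R₀ : ℝ} (hg : ∀ z, R₀ ≤ ‖z‖ → ‖g z‖ ≤ K * ‖z‖) :
    ∃ a b : ℂ, ∀ z : ℂ, ‖z‖ < 1 → g z = a + b * z := by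
  have hda : ∀ z : ℂ, ‖z‖ ≠ 1 → DifferentiableAt ℂ g z := fun z hz =>
    hd.differentiableAt (isOpen_offCircle.mem_nhds hz)
  have hball : DiffContOnCl ℂ g (Metric.ball 0 1) :=
    ⟨fun z hz => (hda z (by simp at hz; exact hz.ne)).differentiableWithinAt, hc.continuousOn⟩
  refine ⟨(2 * Real.pi * Complex.I : ℂ)⁻¹ • ∮ w in C(0, 1), g w / w,
    (2 * Real.pi * Complex.I : ℂ)⁻¹ • ∮ w in C(0, 1), g w / w ^ 2, fun z hz => ?_⟩
  have h1 := hball.two_pi_i_inv_smul_circleIntegral_sub_inv_smul (w := z) (by simpa using hz)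
  have hw0 : ∀ w ∈ Metric.sphere (0 : ℂ) 1, w ≠ 0 := by
    intro w hw h; simp [h] at hw
  have hwz : ∀ w ∈ Metric.sphere (0 : ℂ) 1, w - z ≠ 0 := by
    intro w hw h
    rw [sub_eq_zero] at h; subst h; simp at hw; linarith
  -- the remainder of the two-term expansion of the Cauchy kernel
  set f : ℂ → ℂ := fun w => g w * z ^ 2 / (w ^ 2 * (w - z)) with hf
  have hzero : (∮ w in C(0, 1), f w) = 0 := by
    have hRind : ∀ R : ℝ, 1 ≤ R → (∮ w in C(0, R), f w) = ∮ w in C(0, 1), f w := by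
      intro R hR
      refine Complex.circleIntegral_eq_of_differentiable_on_annulus_off_countable one_pos hR
        Set.countable_empty ?_ ?_
      · refine ContinuousOn.div (by fun_prop) (by fun_prop) ?_
        rintro w ⟨-, hw⟩ h
        simp at hw
        have : w ≠ 0 := by rintro rfl; simp at hw; linarith
        have : w - z ≠ 0 := by
          intro h; rw [sub_eq_zero] at h; subst h; linarith
        simp_all
      · rintro w ⟨⟨-, hw⟩, -⟩
        simp at hw
        have h0 : w ≠ 0 := by rintro rfl; simp at hw; linarith
        have h1 : w - z ≠ 0 := by
          intro h; rw [sub_eq_zero] at h; subst h; linarith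
        have := hda w hw.ne'
        simp only [hf]
        refine DifferentiableAt.div (by fun_prop) (by fun_prop) (mul_ne_zero (pow_ne_zero 2 h0) h1)
    have hb : ∀ R : ℝ, max 2 R₀ ≤ R → ‖∮ w in C(0, 1), f w‖ ≤ 4 * Real.pi * |K| * R⁻¹ := by
      intro R hR
      have h2 : 2 ≤ R := le_trans (le_max_left _ _) hR
      have hR0 : R₀ ≤ R := le_trans (le_max_right _ _) hR
      rw [← hRind R (by linarith)]
      have hRpos : 0 < R := by linarith
      refine (circleIntegral.norm_integral_le_of_norm_le_const hRpos.le
        (C := |K| * R / (R ^ 2 * (R / 2))) fun w hw => ?_).trans (le_of_eq ?_)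
      · have hw' : ‖w‖ = R := by simpa using hw
        simp only [hf, norm_div, norm_mul, norm_pow]
        have hgw : ‖g w‖ ≤ |K| * R := by
          have := hg w (by rw [hw']; exact hR0)
          rw [hw'] at this
          exact this.trans (mul_le_mul_of_nonneg_right (le_abs_self K) hRpos.le)
        have hzz : ‖z‖ ^ 2 ≤ 1 := by nlinarith [norm_nonneg z]
        have hwz' : R / 2 ≤ ‖w - z‖ := by
          have := norm_sub_norm_le w z
          rw [hw'] at this; linarith
        rw [hw']
        refine div_le_div₀ (by positivity) ?_ (by positivity) (by gcongr)
        calc ‖g w‖ * ‖z‖ ^ 2 ≤ |K| * R * 1 := by gcongr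
          _ = |K| * R := mul_one _
      · field_simp
        ring
    have ht : Tendsto (fun R : ℝ => 4 * Real.pi * |K| * R⁻¹) atTop (𝓝 0) := by
      simpa using tendsto_inv_atTop_zero.const_mul (4 * Real.pi * |K|)
    have := ge_of_tendsto ht (Filter.eventually_atTop.2 ⟨max 2 R₀, hb⟩)
    simpa using this
  have hsplit : (∮ w in C(0, 1), (w - z)⁻¹ • g w) =
      (∮ w in C(0, 1), g w / w) + (∮ w in C(0, 1), g w / w ^ 2) * z := by
    have hi1 : CircleIntegrable (fun w => g w / w) 0 1 :=
      ContinuousOn.circleIntegrable zero_le_one (hc.continuousOn.div continuousOn_id hw0)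
    have hi2 : CircleIntegrable (fun w => z * (g w / w ^ 2)) 0 1 :=
      ContinuousOn.circleIntegrable zero_le_one (continuousOn_const.mul
        (hc.continuousOn.div (by fun_prop) fun w hw => pow_ne_zero 2 (hw0 w hw)))
    have hi3 : CircleIntegrable f 0 1 :=
      ContinuousOn.circleIntegrable zero_le_one (ContinuousOn.div (by fun_prop) (by fun_prop)
        fun w hw => mul_ne_zero (pow_ne_zero 2 (hw0 w hw)) (hwz w hw))
    have hi12 : CircleIntegrable (fun w => g w / w + z * (g w / w ^ 2)) 0 1 := hi1.add hi2
    calc (∮ w in C(0, 1), (w - z)⁻¹ • g w)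
        = ∮ w in C(0, 1), ((g w / w + z * (g w / w ^ 2)) + f w) := by
          refine circleIntegral.integral_congr zero_le_one fun w hw => ?_
          have := hw0 w hw
          have := hwz w hw
          simp only [hf, smul_eq_mul]
          field_simp
          ring
      _ = (∮ w in C(0, 1), g w / w) + (∮ w in C(0, 1), g w / w ^ 2) * z := by
          rw [circleIntegral.integral_add hi12 hi3, hzero, add_zero,
            circleIntegral.integral_add hi1 hi2, circleIntegral.integral_const_mul, mul_comm z]
  rw [← h1, hsplit]
  simp only [smul_eq_mul]
  ring

/-- A continuous function that is holomorphic off the unit circle and grows at most linearly is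
affine. -/
theorem affine_of_continuous_of_linear_growth {g : ℂ → ℂ} (hc : Continuous g)
    (hd : DifferentiableOn ℂ g offCircle) {K R₀ : ℝ} (hg : ∀ z, R₀ ≤ ‖z‖ → ‖g z‖ ≤ K * ‖z‖) :
    ∃ a b : ℂ, ∀ z : ℂ, g z = a + b * z := by
  obtain ⟨a, b, hab⟩ := affine_inside_of_continuous_of_linear_growth hc hd hg
  refine ⟨a, b, ?_⟩
  have hin : ∀ z : ℂ, ‖z‖ ≤ 1 → g z = a + b * z := by
    have hcl : Set.EqOn g (fun z => a + b * z) (closure (Metric.ball 0 1)) :=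
      Set.EqOn.closure (fun z hz => hab z (by simpa using hz)) hc (by fun_prop)
    intro z hz
    refine hcl ?_
    rw [closure_ball _ one_ne_zero]
    simpa using hz
  -- the difference, read at `1 / u`, is holomorphic in the disc and vanishes on its boundary
  set k : ℂ → ℂ := fun u => u ^ 2 * (g u⁻¹ - (a + b * u⁻¹)) with hk
  have hk0 : k 0 = 0 := by simp [hk]
  have hkd : ∀ u : ℂ, u ≠ 0 → ‖u‖ < 1 → DifferentiableAt ℂ k u := by
    intro u hu hu1
    have h1 : DifferentiableAt ℂ g u⁻¹ :=
      hd.differentiableAt (isOpen_offCircle.mem_nhds (by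
        simp only [offCircle, Set.mem_ofPred_eq, norm_inv]
        intro h
        rw [inv_eq_one] at h
        linarith))
    have h2 : DifferentiableAt ℂ (fun u : ℂ => u⁻¹) u := differentiableAt_inv hu
    have h3 : DifferentiableAt ℂ (fun u : ℂ => g u⁻¹) u := h1.comp u h2
    simp only [hk]
    fun_prop
  have hkc : ∀ u : ℂ, u ≠ 0 → ContinuousAt k u := by
    intro u hu
    have h2 : ContinuousAt (fun u : ℂ => u⁻¹) u := continuousAt_inv₀ hu
    have h3 : ContinuousAt (fun u : ℂ => g u⁻¹) u := hc.continuousAt.comp h2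
    simp only [hk]
    fun_prop
  have hkc0 : ContinuousAt k 0 := by
    rw [ContinuousAt, hk0]
    have hR : 0 < max 1 R₀ := lt_of_lt_of_le one_pos (le_max_left _ _)
    have hev : ∀ᶠ u : ℂ in 𝓝 0, ‖k u‖ ≤ ‖u‖ * (|K| + ‖a‖ + ‖b‖) := by
      have : ∀ᶠ u : ℂ in 𝓝 0, ‖u‖ < (max 1 R₀)⁻¹ := by
        have := Metric.ball_mem_nhds (0 : ℂ) (inv_pos.2 hR)
        filter_upwards [this] with u hu
        simpa using hu
      filter_upwards [this] with u hu
      by_cases h0 : u = 0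
      · simp [h0, hk0]
      have hn : 0 < ‖u‖ := norm_pos_iff.2 h0
      have hinv : max 1 R₀ ≤ ‖u‖⁻¹ := by
        rw [le_inv_comm₀ hR hn]; exact hu.le
      have hg1 : ‖g u⁻¹‖ ≤ |K| * ‖u‖⁻¹ := by
        have := hg u⁻¹ (by rw [norm_inv]; exact (le_max_right _ _).trans hinv)
        rw [norm_inv] at this
        exact this.trans (mul_le_mul_of_nonneg_right (le_abs_self K) (by positivity))
      have h1 : 1 ≤ ‖u‖⁻¹ := (le_max_left _ _).trans hinv
      have h3 : ‖g u⁻¹ - (a + b * u⁻¹)‖ ≤ (|K| + ‖a‖ + ‖b‖) * ‖u‖⁻¹ := by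
        calc ‖g u⁻¹ - (a + b * u⁻¹)‖ ≤ ‖g u⁻¹‖ + (‖a‖ + ‖b * u⁻¹‖) :=
              (norm_sub_le _ _).trans (by gcongr; exact norm_add_le _ _)
          _ ≤ |K| * ‖u‖⁻¹ + (‖a‖ * ‖u‖⁻¹ + ‖b‖ * ‖u‖⁻¹) := by
              rw [norm_mul, norm_inv]
              gcongr
              exact le_mul_of_one_le_right (norm_nonneg a) h1
          _ = _ := by ring
      simp only [hk, norm_mul, norm_pow]
      calc ‖u‖ ^ 2 * ‖g u⁻¹ - (a + b * u⁻¹)‖ ≤ ‖u‖ ^ 2 * ((|K| + ‖a‖ + ‖b‖) * ‖u‖⁻¹) := by gcongr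
        _ = ‖u‖ * (|K| + ‖a‖ + ‖b‖) := by field_simp
    refine squeeze_zero_norm' hev ?_
    have : Tendsto (fun u : ℂ => ‖u‖ * (|K| + ‖a‖ + ‖b‖)) (𝓝 0)
        (𝓝 (‖(0 : ℂ)‖ * (|K| + ‖a‖ + ‖b‖))) := (by fun_prop : Continuous _).tendsto 0
    simpa using this
  have hkcont : Continuous k := continuous_iff_continuousAt.2 fun u => by
    by_cases hu : u = 0
    · rw [hu]; exact hkc0
    · exact hkc u hu
  have hkdiff : DifferentiableOn ℂ k (Metric.ball 0 1) := by
    rw [← Complex.differentiableOn_compl_singleton_and_continuousAt_iff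
      (Metric.ball_mem_nhds (0 : ℂ) one_pos)]
    exact ⟨fun u hu => (hkd u hu.2 (by simpa using hu.1)).differentiableWithinAt, hkc0⟩
  have hk1 : Set.EqOn k 0 (Metric.ball 0 1) := by
    refine Complex.eqOn_of_eqOn_frontier Metric.isBounded_ball ⟨hkdiff, hkcont.continuousOn⟩
      diffContOnCl_const fun u hu => ?_
    rw [frontier_ball _ one_ne_zero] at hu
    have hu1 : ‖u‖ = 1 := by simpa using hu
    simp only [hk, Pi.zero_apply]
    rw [hin u⁻¹ (by rw [norm_inv, hu1, inv_one])]
    ring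
  intro z
  rcases le_or_gt ‖z‖ 1 with hz | hz
  · exact hin z hz
  · have hz0 : z ≠ 0 := by rintro rfl; simp at hz; linarith
    have := hk1 (x := z⁻¹) (by simpa using inv_lt_one_of_one_lt₀ hz)
    simp only [hk, Pi.zero_apply, inv_inv, mul_eq_zero, pow_eq_zero_iff, ne_eq,
      OfNat.ofNat_ne_zero, not_false_eq_true, inv_eq_zero, hz0, false_or] at this
    exact sub_eq_zero.1 this

/-- A function holomorphic off the unit circle, without jump across the circle minus two points,
with at most logarithmic singularities at these points, and decaying at infinity, vanishes. -/
theorem eq_zero_of_no_jump {G : ℂ → ℂ} {p q : ℂ} (hpq : p ≠ q) (hp : ‖p‖ = 1) (hq : ‖q‖ = 1)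
    (hd : DifferentiableOn ℂ G offCircle)
    (hj : ∀ z : ℂ, ‖z‖ = 1 → z ≠ p → z ≠ q → ∃ y, Tendsto G (𝓝[offCircle] z) (𝓝 y))
    (hinf : G =O[Bornology.cobounded ℂ] fun z : ℂ => z⁻¹)
    (hGp : G =O[𝓝[offCircle] p] fun z => Real.log ‖z - p‖)
    (hGq : G =O[𝓝[offCircle] q] fun z => Real.log ‖z - q‖) :
    ∀ z ∈ offCircle, G z = 0 := by
  have hlog : ∀ p : ℂ, ‖p‖ = 1 → G =O[𝓝[offCircle] p] (fun z => Real.log ‖z - p‖) →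
      Tendsto (fun z => (z - p) * G z) (𝓝[offCircle] p) (𝓝 0) := by
    intro p hp hG
    have h1 : (fun z => (z - p) * G z) =O[𝓝[offCircle] p]
        fun z => ‖z - p‖ * Real.log ‖z - p‖ :=
      (Asymptotics.isBigO_refl (fun z => z - p) _).norm_right.mul hG
    refine h1.trans_tendsto ?_
    have h2 : Tendsto (fun z : ℂ => ‖z - p‖) (𝓝[offCircle] p) (𝓝[>] 0) := by
      refine tendsto_nhdsWithin_iff.2 ⟨?_, ?_⟩
      · have : Tendsto (fun z : ℂ => ‖z - p‖) (𝓝 p) (𝓝 ‖p - p‖) :=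
          (by fun_prop : Continuous fun z : ℂ => ‖z - p‖).tendsto p
        simp only [sub_self, norm_zero] at this
        exact this.mono_left nhdsWithin_le_nhds
      · filter_upwards [self_mem_nhdsWithin] with z hz
        simp only [Set.mem_Ioi, norm_pos_iff, sub_ne_zero]
        rintro rfl
        exact hz hp
    have h3 := (tendsto_log_mul_rpow_nhdsGT_zero one_pos).comp h2
    refine h3.congr fun z => ?_
    simp [mul_comm]
  set g₀ : ℂ → ℂ := fun z => (z - p) * (z - q) * G z with hg₀
  have hd₀ : DifferentiableOn ℂ g₀ offCircle := by
    simp only [hg₀]; fun_prop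
  have hlim : ∀ z : ℂ, ∃ y, Tendsto g₀ (𝓝[offCircle] z) (𝓝 y) := by
    intro z
    have hfac : ∀ c : ℂ, Tendsto (fun z => z - c) (𝓝[offCircle] z) (𝓝 (z - c)) := fun c =>
      ((by fun_prop : Continuous fun z : ℂ => z - c).tendsto z).mono_left nhdsWithin_le_nhds
    by_cases hz : ‖z‖ = 1
    · by_cases h1 : z = p
      · subst h1
        refine ⟨(z - q) * 0, ((hfac q).mul (hlog z hp hGp)).congr fun w => ?_⟩
        simp only [hg₀]; ring
      by_cases h2 : z = q
      · subst h2
        refine ⟨(z - p) * 0, ((hfac p).mul (hlog z hq hGq)).congr fun w => ?_⟩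
        simp only [hg₀]; ring
      obtain ⟨y, hy⟩ := hj z hz h1 h2
      exact ⟨_, ((hfac p).mul (hfac q)).mul hy⟩
    · exact ⟨g₀ z, (hd₀.continuousOn z hz)⟩
  set g := extendFrom offCircle g₀ with hg
  have hgc : Continuous g := continuous_extendFrom dense_offCircle hlim
  have hgeq : Set.EqOn g g₀ offCircle := fun z hz =>
    extendFrom_eq (subset_closure hz) (hd₀.continuousOn z hz)
  have hgd : DifferentiableOn ℂ g offCircle := hd₀.congr hgeq
  have hgrow : ∃ K R₀ : ℝ, ∀ z, R₀ ≤ ‖z‖ → ‖g z‖ ≤ K * ‖z‖ := by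
    obtain ⟨c, hc⟩ := hinf.bound
    rw [← comap_norm_atTop, Filter.eventually_comap] at hc
    obtain ⟨R, hR⟩ := Filter.eventually_atTop.1 hc
    refine ⟨4 * |c|, max R 2, fun z hz => ?_⟩
    have h2 : 2 ≤ ‖z‖ := (le_max_right _ _).trans hz
    have hzR := hR ‖z‖ ((le_max_left _ _).trans hz) z rfl
    have hz1 : z ∈ offCircle := by
      simp only [offCircle, Set.mem_ofPred_eq]; linarith
    rw [hgeq hz1]
    simp only [hg₀, norm_mul]
    rw [norm_inv] at hzR
    have hf : ∀ c : ℂ, ‖c‖ = 1 → ‖z - c‖ ≤ 2 * ‖z‖ := fun c hc => by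
      have := norm_sub_le z c
      rw [hc] at this; linarith
    have hpos : 0 < ‖z‖ := by linarith
    calc ‖z - p‖ * ‖z - q‖ * ‖G z‖ ≤ (2 * ‖z‖) * (2 * ‖z‖) * (|c| * ‖z‖⁻¹) := by
          gcongr
          · exact hf p hp
          · exact hf q hq
          · exact hzR.trans (mul_le_mul_of_nonneg_right (le_abs_self c) (by positivity))
      _ = 4 * |c| * ‖z‖ := by field_simp; ring
  obtain ⟨K, R₀, hK⟩ := hgrow
  obtain ⟨a, b, hab⟩ := affine_of_continuous_of_linear_growth hgc hgd hK
  -- the affine function vanishes at both points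
  have hval : ∀ z : ℂ, Tendsto g₀ (𝓝[offCircle] z) (𝓝 (g z)) := fun z => tendsto_extendFrom (hlim z)
  have hne : ∀ z : ℂ, (𝓝[offCircle] z).NeBot := fun z =>
    mem_closure_iff_nhdsWithin_neBot.1 (dense_offCircle z)
  have hfac : ∀ z c : ℂ, Tendsto (fun z => z - c) (𝓝[offCircle] z) (𝓝 (z - c)) := fun z c =>
      ((by fun_prop : Continuous fun z : ℂ => z - c).tendsto z).mono_left nhdsWithin_le_nhds
  have hgp : g p = 0 := by
    have h := hne p
    refine tendsto_nhds_unique (hval p) ?_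
    have := (hfac p q).mul (hlog p hp hGp)
    rw [mul_zero] at this
    refine this.congr fun w => ?_
    simp only [hg₀]; ring
  have hgq : g q = 0 := by
    have h := hne q
    refine tendsto_nhds_unique (hval q) ?_
    have := (hfac q p).mul (hlog q hq hGq)
    rw [mul_zero] at this
    refine this.congr fun w => ?_
    simp only [hg₀]; ring
  have hb : b = 0 := by
    rw [hab] at hgp hgq
    have : b * (p - q) = 0 := by linear_combination hgp - hgq
    exact (mul_eq_zero.1 this).resolve_right (sub_ne_zero.2 hpq)
  have ha : a = 0 := by rw [hab, hb] at hgp; simpa using hgp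
  intro z hz
  have h1 : g₀ z = 0 := by rw [← hgeq hz, hab, ha, hb]; simp
  simp only [hg₀, mul_eq_zero, sub_eq_zero] at h1
  rcases h1 with (h1 | h1) | h1
  · exact absurd hp (h1 ▸ hz)
  · exact absurd hq (h1 ▸ hz)
  · exact h1

/-! ### Uniqueness of the solution -/

theorem norm_arcEnd (θ₀ : ℝ) : ‖arcEnd θ₀‖ = 1 := Complex.norm_exp_ofReal_mul_I θ₀

theorem arcEnd_ne_star {θ₀ : ℝ} (h0 : 0 < θ₀) (h1 : θ₀ < Real.pi) :
    arcEnd θ₀ ≠ star (arcEnd θ₀) := by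
  intro h
  have h2 := (Complex.conj_eq_iff_im.1 h.symm)
  rw [arcEnd, Complex.exp_ofReal_mul_I_im] at h2
  exact (Real.sin_pos_of_pos_of_lt_pi h0 h1).ne' h2

theorem nhdsWithin_offCircle (z : ℂ) :
    𝓝[offCircle] z = 𝓝[{w | ‖w‖ < 1}] z ⊔ 𝓝[{w | 1 < ‖w‖}] z := by
  rw [← nhdsWithin_union]
  congr 1
  ext w
  simp [offCircle, lt_or_lt_iff_ne]

theorem one_isBigO_log_norm_sub {p : ℂ} {l : Filter ℂ} (hl : l ≤ 𝓝 p) (hp : ∀ᶠ z in l, z ≠ p) :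
    (fun _ => (1 : ℝ)) =O[l] fun z : ℂ => Real.log ‖z - p‖ := by
  refine IsBigO.of_bound 1 ?_
  have h : ∀ᶠ z in l, ‖z - p‖ < Real.exp (-1) := by
    refine hl ?_
    filter_upwards [Metric.ball_mem_nhds p (Real.exp_pos (-1))] with z hz
    simpa [dist_eq_norm] using hz
  filter_upwards [h, hp] with z h1 h2
  have h3 : 0 < ‖z - p‖ := norm_pos_iff.2 (sub_ne_zero.2 h2)
  have h4 : Real.log ‖z - p‖ < -1 := (Real.log_lt_iff_lt_exp h3).2 h1
  rw [norm_one, one_mul, Real.norm_eq_abs, abs_of_neg (by linarith)]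
  linarith

/-- For two solutions `Z`, `Y` the matrix `Z · adj Y` has no jump, so it is the identity. -/
theorem IsRHSolution.mul_adjugate_eq_one {n : ℕ} {θ₀ s : ℝ} (h0 : 0 < θ₀) (h1 : θ₀ < Real.pi)
    {Y Z : ℂ → Matrix (Fin 2) (Fin 2) ℂ} (hY : IsRHSolution n θ₀ s Y)
    (hZ : IsRHSolution n θ₀ s Z) : ∀ z ∈ offCircle, Z z * (Y z).adjugate = 1 := by
  set W : ℂ → Matrix (Fin 2) (Fin 2) ℂ := fun z => Z z * (Y z).adjugate - 1 with hW
  have hadj : ∀ (j : Fin 2), ∃ (i₀ : Fin 2) (c₀ : ℂ) (i₁ : Fin 2) (c₁ : ℂ),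
      ∀ A : Matrix (Fin 2) (Fin 2) ℂ, A.adjugate 0 j = c₀ * A i₀ 1 ∧
        A.adjugate 1 j = c₁ * A i₁ 0 := by
    intro j
    fin_cases j
    · exact ⟨1, 1, 1, -1, fun A => by simp [Matrix.adjugate_fin_two]⟩
    · exact ⟨0, -1, 0, 1, fun A => by simp [Matrix.adjugate_fin_two]⟩
  suffices H : ∀ i j, ∀ z ∈ offCircle, W z i j = 0 by
    intro z hz
    have : W z = 0 := by ext i j; exact H i j z hz
    exact sub_eq_zero.1 this
  intro i j
  obtain ⟨i₀, c₀, i₁, c₁, hA⟩ := hadj j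
  have hWij : ∀ z, W z i j = Z z i 0 * (c₀ * Y z i₀ 1) + Z z i 1 * (c₁ * Y z i₁ 0)
      - (1 : Matrix (Fin 2) (Fin 2) ℂ) i j := by
    intro z
    simp only [hW, Matrix.sub_apply, Matrix.mul_apply, Fin.sum_univ_two, (hA (Y z)).1,
      (hA (Y z)).2]
  have hend : ∀ p : ℂ, p = arcEnd θ₀ ∨ p = star (arcEnd θ₀) →
      (fun z => W z i j) =O[𝓝[offCircle] p] fun z => Real.log ‖z - p‖ := by
    intro p hp
    have hp1 : ‖p‖ = 1 := by
      rcases hp with rfl | rfl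
      · exact norm_arcEnd θ₀
      · rw [norm_star, norm_arcEnd]
    have hone := one_isBigO_log_norm_sub (p := p) (l := 𝓝[offCircle] p) nhdsWithin_le_nhds
      (by filter_upwards [self_mem_nhdsWithin] with z hz
          rintro rfl
          exact hz hp1)
    simp only [hWij]
    refine IsBigO.sub (IsBigO.add ?_ ?_) ?_
    · simpa using (hZ.endpoint_fst p hp i).mul ((hY.endpoint_snd p hp i₀).const_mul_left c₀)
    · simpa using (hZ.endpoint_snd p hp i).mul ((hY.endpoint_fst p hp i₁).const_mul_left c₁)
    · exact (isBigO_const_const _ one_ne_zero _).trans hone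
  refine eq_zero_of_no_jump (arcEnd_ne_star h0 h1) (norm_arcEnd θ₀)
    (by rw [norm_star, norm_arcEnd]) ?_ ?_ ?_ (hend _ (Or.inl rfl)) (hend _ (Or.inr rfl))
  · simp only [hWij]
    have a1 := hZ.analytic i 0
    have a2 := hZ.analytic i 1
    have a3 := hY.analytic i₀ 1
    have a4 := hY.analytic i₁ 0
    fun_prop
  · intro z hz hzp hzq
    obtain ⟨Yp, Ym, hYp, hYm, hYj⟩ := hY.jump z hz hzp hzq
    obtain ⟨Zp, Zm, hZp, hZm, hZj⟩ := hZ.jump z hz hzp hzq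
    set J : Matrix (Fin 2) (Fin 2) ℂ := !![1, z ^ (-(n : ℤ)) * arcSymbol θ₀ s z; 0, 1] with hJ
    have hJdet : J.det = 1 := by simp [hJ, Matrix.det_fin_two]
    have hcont : Continuous fun M : Matrix (Fin 2) (Fin 2) ℂ × Matrix (Fin 2) (Fin 2) ℂ =>
        (M.1 * M.2.adjugate - 1) i j := by
      have : Continuous fun M : Matrix (Fin 2) (Fin 2) ℂ × Matrix (Fin 2) (Fin 2) ℂ =>
        (M.1 * M.2.adjugate - 1) :=
        (continuous_fst.matrix_mul continuous_snd.matrix_adjugate).sub continuous_const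
      exact this.matrix_elem i j
    have hp := (hcont.tendsto (Zp, Yp)).comp (hZp.prodMk_nhds hYp)
    have hm := (hcont.tendsto (Zm, Ym)).comp (hZm.prodMk_nhds hYm)
    have heq : Zp * Yp.adjugate = Zm * Ym.adjugate := by
      rw [hZj, hYj, Matrix.adjugate_mul_distrib, Matrix.mul_assoc, ← Matrix.mul_assoc J,
        Matrix.mul_adjugate, hJdet, one_smul, Matrix.one_mul]
    refine ⟨(Zm * Ym.adjugate - 1) i j, ?_⟩
    rw [nhdsWithin_offCircle]
    rw [heq] at hp
    exact hp.sup hm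
  · -- both factors are `I + O(1/z)` once the exponents are removed
    set D : ℂ → Matrix (Fin 2) (Fin 2) ℂ := fun z => !![z ^ (-(n : ℤ)), 0; 0, z ^ (n : ℤ)] with hD
    have hA' := fun k l => hZ.infinity k l
    have hB' := fun k l => hY.infinity k l
    have hz0 : ∀ᶠ z : ℂ in Bornology.cobounded ℂ, z ≠ 0 :=
      Bornology.eventually_ne_cobounded 0
    have hinv : (fun z : ℂ => z⁻¹) =O[Bornology.cobounded ℂ] fun _ => (1 : ℝ) :=
      (tendsto_inv₀_cobounded (α := ℂ)).isBigO_one ℝ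
    have hBadj : ∀ k, (fun z => ((Y z * D z).adjugate - 1) k j) =O[Bornology.cobounded ℂ]
        fun z : ℂ => z⁻¹ := by
      intro k
      have e : ∀ M : Matrix (Fin 2) (Fin 2) ℂ, (M - 1).adjugate = M.adjugate - 1 := by
        intro M
        ext a b
        fin_cases a <;> fin_cases b <;> simp [Matrix.adjugate_fin_two]
      simp only [← e]
      fin_cases k
      · simp only [Fin.zero_eta, (hA _).1]
        exact (hB' _ _).const_mul_left _
      · simp only [Fin.mk_one, (hA _).2]
        exact (hB' _ _).const_mul_left _
    have hBone : ∀ k, (fun z => (Y z * D z).adjugate k j) =O[Bornology.cobounded ℂ]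
        fun _ => (1 : ℝ) := by
      intro k
      have := ((hBadj k).trans hinv).add
        (isBigO_const_const ((1 : Matrix (Fin 2) (Fin 2) ℂ) k j) (one_ne_zero (α := ℝ)) _)
      simpa using this
    have hrep : ∀ᶠ z : ℂ in Bornology.cobounded ℂ, W z i j =
        (∑ k, (Z z * D z - 1) i k * (Y z * D z).adjugate k j) +
          ((Y z * D z).adjugate - 1) i j := by
      filter_upwards [hz0] with z hz
      have hdet : (D z).det = 1 := by
        simp [hD, Matrix.det_fin_two, zpow_neg]
        field_simp
      have : Z z * (Y z).adjugate = Z z * D z * (Y z * D z).adjugate := by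
        rw [Matrix.adjugate_mul_distrib, Matrix.mul_assoc, ← Matrix.mul_assoc (D z),
          Matrix.mul_adjugate, hdet, one_smul, Matrix.one_mul]
      simp only [hW, this, ← Matrix.mul_apply, ← Matrix.add_apply]
      rw [Matrix.sub_mul, Matrix.one_mul, sub_add_sub_cancel]
    refine IsBigO.congr' ?_ (hrep.mono fun z hz => hz.symm) EventuallyEq.rfl
    refine IsBigO.add ?_ (hBadj i)
    have hsum := fun k => IsBigO.mul (hA' i k) ((hBone k).trans
      (isBigO_const_const (1 : ℝ) (one_ne_zero (α := ℂ)) _))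
    simp only [mul_one] at hsum
    simp only [Fin.sum_univ_two]
    exact (hsum 0).add (hsum 1)

theorem IsRHSolution.eqOn {n : ℕ} {θ₀ s : ℝ} (h0 : 0 < θ₀) (h1 : θ₀ < Real.pi)
    {Y Z : ℂ → Matrix (Fin 2) (Fin 2) ℂ} (hY : IsRHSolution n θ₀ s Y)
    (hZ : IsRHSolution n θ₀ s Z) : Set.EqOn Z Y offCircle := by
  intro z hz
  have e1 := hY.mul_adjugate_eq_one h0 h1 hZ z hz
  have e2 := mul_eq_one_comm.1 (hY.mul_adjugate_eq_one h0 h1 hY z hz)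
  calc Z z = Z z * ((Y z).adjugate * Y z) := by rw [e2, Matrix.mul_one]
    _ = Y z := by rw [← Matrix.mul_assoc, e1, Matrix.one_mul]

/-! ### Means against the symbol -/

/-- The point `e^{iθ}` of the unit circle. -/
noncomputable def circlePt (θ : ℝ) : ℂ := Complex.exp ((θ : ℂ) * Complex.I)

@[simp] theorem norm_circlePt (θ : ℝ) : ‖circlePt θ‖ = 1 := Complex.norm_exp_ofReal_mul_I θ

theorem circlePt_ne_zero (θ : ℝ) : circlePt θ ≠ 0 := Complex.exp_ne_zero _

@[fun_prop] theorem continuous_circlePt : Continuous circlePt := by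
  unfold circlePt; fun_prop

theorem circlePt_neg (θ : ℝ) : circlePt (-θ) = (circlePt θ)⁻¹ := by
  simp [circlePt, ← Complex.exp_neg]

theorem circlePt_add (a b : ℝ) : circlePt (a + b) = circlePt a * circlePt b := by
  simp [circlePt, ← Complex.exp_add, add_mul]

theorem star_circlePt (θ : ℝ) : (starRingEnd ℂ) (circlePt θ) = circlePt (-θ) := by
  simp [circlePt, ← Complex.exp_conj]

theorem circlePt_re (θ : ℝ) : (circlePt θ).re = Real.cos θ := Complex.exp_ofReal_mul_I_re θ

theorem circlePt_im (θ : ℝ) : (circlePt θ).im = Real.sin θ := Complex.exp_ofReal_mul_I_im θ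

theorem hasDerivAt_circlePt (θ : ℝ) : HasDerivAt circlePt (Complex.I * circlePt θ) θ := by
  have h : HasDerivAt (fun t : ℝ => (t : ℂ) * Complex.I) (1 * Complex.I) θ :=
    (Complex.ofRealCLM.hasDerivAt (x := θ)).mul_const Complex.I
  have := h.cexp
  rw [one_mul, mul_comm] at this
  exact this

theorem circlePt_sub_ne_zero {z : ℂ} (hz : z ∈ offCircle) (θ : ℝ) : circlePt θ - z ≠ 0 := by
  intro h
  rw [sub_eq_zero] at h
  exact hz (by rw [← h, norm_circlePt])

theorem continuous_circlePt_zpow (m : ℤ) : Continuous fun θ => circlePt θ ^ m :=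
  continuous_circlePt.zpow₀ m fun θ => Or.inl (circlePt_ne_zero θ)

/-- The mean of `F` against `f dθ / 2π`, where `f` is the symbol, equal to `1` on `[-θ₀, θ₀]` and
to `s` on the rest of `[-π, π]`. -/
noncomputable def symbolMean (θ₀ s : ℝ) (F : ℝ → ℂ) : ℂ :=
  (2 * Real.pi : ℂ)⁻¹ *
    (s * (∫ θ in (-Real.pi)..Real.pi, F θ) + (1 - s) * ∫ θ in (-θ₀)..θ₀, F θ)

section symbolMean
variable (θ₀ s : ℝ)

theorem symbolMean_add {F G : ℝ → ℂ} (hF : Continuous F) (hG : Continuous G) :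
    symbolMean θ₀ s (fun θ => F θ + G θ) = symbolMean θ₀ s F + symbolMean θ₀ s G := by
  simp only [symbolMean]
  rw [intervalIntegral.integral_add (hF.intervalIntegrable _ _) (hG.intervalIntegrable _ _),
    intervalIntegral.integral_add (hF.intervalIntegrable _ _) (hG.intervalIntegrable _ _)]
  ring

theorem symbolMean_const_mul (c : ℂ) (F : ℝ → ℂ) :
    symbolMean θ₀ s (fun θ => c * F θ) = c * symbolMean θ₀ s F := by
  simp only [symbolMean]
  rw [intervalIntegral.integral_const_mul, intervalIntegral.integral_const_mul]
  ring

theorem symbolMean_sub {F G : ℝ → ℂ} (hF : Continuous F) (hG : Continuous G) :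
    symbolMean θ₀ s (fun θ => F θ - G θ) = symbolMean θ₀ s F - symbolMean θ₀ s G := by
  simp only [symbolMean]
  rw [intervalIntegral.integral_sub (hF.intervalIntegrable _ _) (hG.intervalIntegrable _ _),
    intervalIntegral.integral_sub (hF.intervalIntegrable _ _) (hG.intervalIntegrable _ _)]
  ring

theorem symbolMean_sum {ι : Type*} (S : Finset ι) {F : ι → ℝ → ℂ} (hF : ∀ i, Continuous (F i)) :
    symbolMean θ₀ s (fun θ => ∑ i ∈ S, F i θ) = ∑ i ∈ S, symbolMean θ₀ s (F i) := by
  classical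
  induction S using Finset.induction_on with
  | empty => simp [symbolMean]
  | insert i S hi ih =>
    simp only [Finset.sum_insert hi]
    rw [symbolMean_add θ₀ s (hF i) (continuous_finsetSum _ fun j _ => hF j), ih]

theorem norm_symbolMean_le {F : ℝ → ℂ} {M : ℝ} (h0 : 0 ≤ θ₀) (h1 : θ₀ ≤ Real.pi)
    (hF : ∀ θ, ‖F θ‖ ≤ M) : ‖symbolMean θ₀ s F‖ ≤ (|s| + |1 - s|) * M := by
  have hM : 0 ≤ M := (norm_nonneg _).trans (hF 0)
  have hpi := Real.pi_pos
  have e1 : ‖∫ θ in (-Real.pi)..Real.pi, F θ‖ ≤ M * (2 * Real.pi) := by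
    have := intervalIntegral.norm_integral_le_of_norm_le_const (a := -Real.pi) (b := Real.pi)
      (f := F) (C := M) fun θ _ => hF θ
    rwa [sub_neg_eq_add, abs_of_pos (by linarith), ← two_mul] at this
  have e2 : ‖∫ θ in (-θ₀)..θ₀, F θ‖ ≤ M * (2 * Real.pi) := by
    have := intervalIntegral.norm_integral_le_of_norm_le_const (a := -θ₀) (b := θ₀)
      (f := F) (C := M) fun θ _ => hF θ
    rw [sub_neg_eq_add, abs_of_nonneg (by linarith)] at this
    exact this.trans (by gcongr; linarith)
  have hs : ‖(1 - s : ℂ)‖ = |1 - s| := by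
    rw [← Complex.ofReal_one, ← Complex.ofReal_sub, Complex.norm_real, Real.norm_eq_abs]
  have hpin : ‖(2 * Real.pi : ℂ)⁻¹‖ = (2 * Real.pi)⁻¹ := by
    rw [norm_inv, norm_mul, Complex.norm_ofNat, Complex.norm_real, Real.norm_eq_abs,
      abs_of_pos hpi]
  calc ‖symbolMean θ₀ s F‖ ≤ (2 * Real.pi)⁻¹ * (|s| * (M * (2 * Real.pi))
        + |1 - s| * (M * (2 * Real.pi))) := by
        rw [symbolMean, norm_mul, hpin]
        gcongr
        refine (norm_add_le _ _).trans ?_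
        rw [norm_mul, norm_mul, hs, Complex.norm_real, Real.norm_eq_abs]
        gcongr
    _ = (|s| + |1 - s|) * M := by field_simp

end symbolMean

/-! ### Cauchy transforms of the symbol -/

theorem differentiableOn_integral_cauchy_kernel {u : ℝ → ℂ} (hu : Continuous u) (a b : ℝ) :
    DifferentiableOn ℂ (fun z => ∫ θ in a..b, u θ / (circlePt θ - z)) offCircle := by
  intro z hz
  have hz' : ‖z‖ ≠ 1 := hz
  set δ := |1 - ‖z‖| with hδ
  have hδ0 : 0 < δ := abs_pos.2 (sub_ne_zero.2 hz'.symm)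
  have hlow : ∀ x ∈ Metric.ball z (δ / 2), ∀ θ, δ / 2 ≤ ‖circlePt θ - x‖ := by
    intro x hx θ
    have h1 : δ ≤ ‖circlePt θ - z‖ := by
      have := abs_norm_sub_norm_le (circlePt θ) z
      rwa [norm_circlePt] at this
    have h2 : ‖x - z‖ < δ / 2 := by simpa [dist_eq_norm] using hx
    have h3 : ‖circlePt θ - z‖ ≤ ‖circlePt θ - x‖ + ‖x - z‖ := by
      simpa using norm_sub_le_norm_sub_add_norm_sub (circlePt θ) x z
    linarith
  have hne : ∀ x ∈ Metric.ball z (δ / 2), ∀ θ, circlePt θ - x ≠ 0 := fun x hx θ h => by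
    have := hlow x hx θ
    rw [h, norm_zero] at this
    linarith
  have hball : Metric.ball z (δ / 2) ∈ 𝓝 z := Metric.ball_mem_nhds _ (by positivity)
  have hcont : ∀ x ∈ Metric.ball z (δ / 2), Continuous fun θ => u θ / (circlePt θ - x) :=
    fun x hx => hu.div (by fun_prop) (hne x hx)
  have hzb := mem_of_mem_nhds hball
  have hcont2 : Continuous fun θ => u θ / (circlePt θ - z) ^ 2 :=
    hu.div (by fun_prop) fun θ => pow_ne_zero 2 (hne z hzb θ)
  have := (intervalIntegral.hasDerivAt_integral_of_dominated_loc_of_deriv_le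
    (μ := MeasureTheory.volume) (a := a) (b := b)
    (F := fun x θ => u θ / (circlePt θ - x)) (F' := fun x θ => u θ / (circlePt θ - x) ^ 2)
    (bound := fun θ => ‖u θ‖ / (δ / 2) ^ 2) hball
    (by filter_upwards [hball] with x hx using (hcont x hx).aestronglyMeasurable)
    ((hcont z hzb).intervalIntegrable _ _) hcont2.aestronglyMeasurable
    (by
      refine Eventually.of_forall fun θ _ x hx => ?_
      rw [norm_div, norm_pow]
      have := hlow x hx θ
      gcongr)
    ((by fun_prop : Continuous fun θ => ‖u θ‖ / (δ / 2) ^ 2).intervalIntegrable _ _)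
    (by
      refine Eventually.of_forall fun θ _ x hx => ?_
      have h1 : HasDerivAt (fun x : ℂ => circlePt θ - x) (-1) x :=
        (hasDerivAt_id x).const_sub _
      have h2 := (h1.inv (hne x hx θ)).const_mul (u θ)
      simp only [div_eq_mul_inv]
      simpa using h2)).2
  exact this.differentiableAt.differentiableWithinAt

/-- The Möbius transformation `e^{-iθ₀} (z₀ - z) / (conj z₀ - z)`, which maps the arc to the negative
half-line and the disc to the upper half-plane. -/
noncomputable def arcMoebius (θ₀ : ℝ) (z : ℂ) : ℂ :=
  (1 - z * circlePt (-θ₀)) / (circlePt (-θ₀) - z)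

theorem arcMoebius_re_im (θ₀ : ℝ) (z : ℂ) :
    (arcMoebius θ₀ z).re = ((1 + ‖z‖ ^ 2) * Real.cos θ₀ - 2 * z.re) / ‖circlePt (-θ₀) - z‖ ^ 2 ∧
    (arcMoebius θ₀ z).im = Real.sin θ₀ * (1 - ‖z‖ ^ 2) / ‖circlePt (-θ₀) - z‖ ^ 2 := by
  have h1 : Real.cos θ₀ ^ 2 + Real.sin θ₀ ^ 2 = 1 := by
    rw [add_comm]; exact Real.sin_sq_add_cos_sq θ₀
  simp only [arcMoebius, Complex.div_re, Complex.div_im, Complex.sq_norm]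
  rw [← add_div, ← sub_div]
  simp only [Complex.sub_re, Complex.sub_im, Complex.mul_re, Complex.mul_im, circlePt_re,
    circlePt_im, Complex.one_re, Complex.one_im, Real.cos_neg, Real.sin_neg, Complex.normSq_apply]
  constructor
  · congr 1
    linear_combination (-z.re) * h1
  · congr 1
    linear_combination (-z.im) * h1

theorem arcMoebius_mem_slitPlane {θ₀ : ℝ} (h0 : 0 ≤ θ₀) (h1 : θ₀ < Real.pi) {z : ℂ}
    (hz : z ∈ offCircle) : arcMoebius θ₀ z ∈ Complex.slitPlane := by
  have hne := circlePt_sub_ne_zero hz (-θ₀)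
  rcases h0.eq_or_lt with rfl | h0
  · have : arcMoebius 0 z = 1 := by
      have h2 : circlePt (-0) - z ≠ 0 := hne
      have h3 : circlePt (-0) = 1 := by simp [circlePt]
      rw [h3] at h2
      rw [arcMoebius, h3, mul_one, div_self h2]
    rw [this]; exact Complex.one_mem_slitPlane
  · refine Complex.mem_slitPlane_iff.2 (Or.inr ?_)
    rw [(arcMoebius_re_im θ₀ z).2]
    have hs := Real.sin_pos_of_pos_of_lt_pi h0 h1
    have hz' : ‖z‖ ≠ 1 := hz
    have : (1 - ‖z‖ ^ 2) ≠ 0 := by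
      intro h
      have h3 : (1 - ‖z‖) * (1 + ‖z‖) = 0 := by linear_combination h
      rcases mul_eq_zero.1 h3 with h4 | h4
      · exact hz' (by linarith)
      · linarith [norm_nonneg z]
    have h5 : ‖circlePt (-θ₀) - z‖ ^ 2 ≠ 0 := pow_ne_zero 2 (norm_ne_zero_iff.2 hne)
    exact div_ne_zero (mul_ne_zero hs.ne' this) h5

/-- The Cauchy integral of the arc in closed form, obtained by differentiating in the endpoint. -/
theorem integral_arc_cauchy {θ₀ : ℝ} (h0 : 0 ≤ θ₀) (h1 : θ₀ < Real.pi) {z : ℂ}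
    (hz : z ∈ offCircle) : (∫ θ in (-θ₀)..θ₀, circlePt θ / (circlePt θ - z)) =
      -Complex.I * (Complex.log (arcMoebius θ₀ z) + θ₀ * Complex.I) := by
  set g : ℝ → ℂ := fun θ => circlePt θ / (circlePt θ - z) with hg
  have hgc : Continuous g := continuous_circlePt.div (by fun_prop) (circlePt_sub_ne_zero hz)
  have hgc' : Continuous fun θ => g (-θ) := hgc.comp continuous_neg
  have e1 : (∫ θ in (-θ₀)..θ₀, g θ) = ∫ θ in (0 : ℝ)..θ₀, (g θ + g (-θ)) := by
    rw [intervalIntegral.integral_add (hgc.intervalIntegrable _ _) (hgc'.intervalIntegrable _ _),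
      intervalIntegral.integral_comp_neg, neg_zero, add_comm,
      intervalIntegral.integral_add_adjacent_intervals (hgc.intervalIntegrable _ _)
        (hgc.intervalIntegrable _ _)]
  have hG : ∀ θ ∈ Set.uIcc 0 θ₀, HasDerivAt
      (fun θ : ℝ => -Complex.I * (Complex.log (arcMoebius θ z) + θ * Complex.I))
      (g θ + g (-θ)) θ := by
    intro θ hθ
    rw [Set.uIcc_of_le h0] at hθ
    have hsl := arcMoebius_mem_slitPlane hθ.1 (hθ.2.trans_lt h1) hz
    have hne := circlePt_sub_ne_zero hz (-θ)
    have hne' := circlePt_sub_ne_zero hz θ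
    have hp := circlePt_ne_zero θ
    have hd1 : HasDerivAt (fun θ : ℝ => circlePt (-θ)) (-(Complex.I * circlePt (-θ))) θ := by
      have := (hasDerivAt_circlePt (-θ)).scomp θ (hasDerivAt_neg θ)
      simpa [Function.comp_def] using this
    have hnum : HasDerivAt (fun θ : ℝ => 1 - z * circlePt (-θ))
        (-(z * -(Complex.I * circlePt (-θ)))) θ := (hd1.const_mul z).const_sub 1
    have hden : HasDerivAt (fun θ : ℝ => circlePt (-θ) - z) (-(Complex.I * circlePt (-θ))) θ :=
      hd1.sub_const z
    have hM := hnum.div hden hne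
    have hlog := hM.clog_real hsl
    have hid : HasDerivAt (fun θ : ℝ => (θ : ℂ) * Complex.I) (1 * Complex.I) θ :=
      (Complex.ofRealCLM.hasDerivAt (x := θ)).mul_const Complex.I
    refine ((hlog.add hid).const_mul (-Complex.I)).congr_deriv ?_
    have hnum0 : 1 - z * circlePt (-θ) ≠ 0 := by
      rw [circlePt_neg]
      intro h
      apply hne'
      field_simp at h
      rwa [mul_zero] at h
    simp only [hg, Pi.div_apply]
    have hI : Complex.I ^ 2 = -1 := Complex.I_sq
    rw [circlePt_neg] at hne hnum0 ⊢
    set c := circlePt θ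
    have hA : 1 - z * c⁻¹ = (c - z) / c := by field_simp
    have hB : c⁻¹ - z = (1 - z * c) / c := by field_simp
    have hB' : 1 - z * c ≠ 0 := by
      intro h; apply hne; rw [hB, h, zero_div]
    rw [hA, hB]
    field_simp
    ring_nf
    simp only [hI]
    ring
  rw [e1, intervalIntegral.integral_eq_sub_of_hasDerivAt hG
    ((hgc.add hgc').intervalIntegrable _ _)]
  have h3 : circlePt (-0) = 1 := by simp [circlePt]
  have : arcMoebius 0 z = 1 := by
    have hne := circlePt_sub_ne_zero hz (-0)
    rw [h3] at hne
    rw [arcMoebius, h3, mul_one, div_self hne]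
  simp [this]

/-- The Cauchy transform of `w^m f(w)` over the unit circle, `f` being the symbol. -/
noncomputable def cauchyPow (θ₀ s : ℝ) (m : ℤ) (z : ℂ) : ℂ :=
  symbolMean θ₀ s fun θ => circlePt θ ^ (m + 1) / (circlePt θ - z)

theorem continuous_cauchy_kernel {u : ℝ → ℂ} (hu : Continuous u) {z : ℂ} (hz : z ∈ offCircle) :
    Continuous fun θ => u θ / (circlePt θ - z) :=
  hu.div (by fun_prop) (circlePt_sub_ne_zero hz)

theorem differentiableOn_symbolMean_cauchy {u : ℝ → ℂ} (hu : Continuous u) (θ₀ s : ℝ) :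
    DifferentiableOn ℂ (fun z => symbolMean θ₀ s fun θ => u θ / (circlePt θ - z)) offCircle := by
  simp only [symbolMean]
  have h1 := differentiableOn_integral_cauchy_kernel hu (-Real.pi) Real.pi
  have h2 := differentiableOn_integral_cauchy_kernel hu (-θ₀) θ₀
  fun_prop

/-- Recursion in the exponent, from `1 / (w (w - z)) = z⁻¹ (1 / (w - z) - 1 / w)`. -/
theorem cauchyPow_pred (θ₀ s : ℝ) (m : ℤ) {z : ℂ} (hz : z ∈ offCircle) (hz0 : z ≠ 0) :
    cauchyPow θ₀ s (m - 1) z =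
      z⁻¹ * (cauchyPow θ₀ s m z - symbolMean θ₀ s fun θ => circlePt θ ^ m) := by
  have h : (fun θ => circlePt θ ^ (m - 1 + 1) / (circlePt θ - z)) = fun θ =>
      z⁻¹ * (circlePt θ ^ (m + 1) / (circlePt θ - z) - circlePt θ ^ m) := by
    funext θ
    have h1 := circlePt_sub_ne_zero hz θ
    rw [sub_add_cancel, zpow_add_one₀ (circlePt_ne_zero θ)]
    field_simp
    ring
  rw [cauchyPow, cauchyPow, h, symbolMean_const_mul, symbolMean_sub]
  · exact continuous_cauchy_kernel (continuous_circlePt_zpow _) hz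
  · exact continuous_circlePt_zpow _

theorem integral_circle_cauchy {z : ℂ} (hz : z ∈ offCircle) :
    (∫ θ in (-Real.pi)..Real.pi, circlePt θ / (circlePt θ - z)) =
      2 * Real.pi * (if ‖z‖ < 1 then 1 else 0) := by
  have hper : Function.Periodic (fun θ => circlePt θ / (circlePt θ - z)) (2 * Real.pi) := by
    intro θ
    have : circlePt (θ + 2 * Real.pi) = circlePt θ := by
      rw [circlePt_add]
      simp [circlePt, Complex.exp_two_pi_mul_I]
    simp only [this]
  have h1 : (∫ θ in (-Real.pi)..Real.pi, circlePt θ / (circlePt θ - z)) =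
      ∫ θ in (0 : ℝ)..(2 * Real.pi), circlePt θ / (circlePt θ - z) := by
    have := hper.intervalIntegral_add_eq (-Real.pi) 0
    rw [zero_add] at this
    rw [← this]
    congr 1
    ring
  have h2 : (∮ w in C(0, 1), (w - z)⁻¹) =
      Complex.I * ∫ θ in (0 : ℝ)..(2 * Real.pi), circlePt θ / (circlePt θ - z) := by
    rw [← intervalIntegral.integral_const_mul]
    simp only [circleIntegral, deriv_circleMap, smul_eq_mul]
    refine intervalIntegral.integral_congr fun θ _ => ?_
    simp only [circleMap, circlePt, Complex.ofReal_one, zero_add, one_mul]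
    ring
  rw [h1]
  have h3 : (∮ w in C(0, 1), (w - z)⁻¹) =
      2 * Real.pi * Complex.I * (if ‖z‖ < 1 then 1 else 0) := by
    split_ifs with h
    · rw [circleIntegral.integral_sub_inv_of_mem_ball (by simpa using h), mul_one]
    · rw [mul_zero]
      have hz1 : 1 < ‖z‖ := lt_of_le_of_ne (not_lt.1 h) (Ne.symm hz)
      have hne : ∀ w ∈ Metric.closedBall (0 : ℂ) 1, w - z ≠ 0 := by
        intro w hw h0
        rw [sub_eq_zero] at h0
        subst h0
        simp at hw
        linarith
      refine Complex.circleIntegral_eq_zero_of_differentiable_on_off_countable zero_le_one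
        Set.countable_empty (ContinuousOn.inv₀ (by fun_prop) hne) fun w hw => ?_
      exact DifferentiableAt.inv (by fun_prop) (hne w (Metric.ball_subset_closedBall hw.1))
  rw [h2] at h3
  have hI := Complex.I_ne_zero
  apply mul_left_cancel₀ hI
  rw [h3]
  ring

/-- The symbol is `s` times the constant `1` plus `1 - s` times the indicator function of the arc. -/
theorem cauchyPow_zero {θ₀ : ℝ} (s : ℝ) (h0 : 0 ≤ θ₀) (h1 : θ₀ < Real.pi) {z : ℂ}
    (hz : z ∈ offCircle) : cauchyPow θ₀ s 0 z = s * (if ‖z‖ < 1 then 1 else 0) +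
      (1 - s) * (2 * Real.pi * Complex.I)⁻¹ *
        (Complex.log (arcMoebius θ₀ z) + θ₀ * Complex.I) := by
  have hpi : (Real.pi : ℂ) ≠ 0 := by exact_mod_cast Real.pi_ne_zero
  simp only [cauchyPow, symbolMean, zero_add, zpow_one]
  rw [integral_circle_cauchy hz, integral_arc_cauchy h0 h1 hz]
  have hI := Complex.I_ne_zero
  have hI2 : Complex.I ^ 2 = -1 := Complex.I_sq
  field_simp
  linear_combination
    (-(1 - (s : ℂ)) * (Complex.log (arcMoebius θ₀ z) + Complex.I * θ₀)) * hI2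

/-! ### Jumps and endpoint singularities of Cauchy transforms -/

/-- `K` has boundary values at the point `z` of the unit circle from inside and from outside, and
the first minus the second is `v`. -/
def HasJumpAt (K : ℂ → ℂ) (z v : ℂ) : Prop :=
  ∃ kp km : ℂ, Tendsto K (𝓝[{w | ‖w‖ < 1}] z) (𝓝 kp) ∧
    Tendsto K (𝓝[{w | 1 < ‖w‖}] z) (𝓝 km) ∧ kp = km + v

theorem eventually_mem_inside (z : ℂ) : ∀ᶠ w in 𝓝[{w : ℂ | ‖w‖ < 1}] z, ‖w‖ < 1 :=
  self_mem_nhdsWithin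

theorem eventually_mem_outside (z : ℂ) : ∀ᶠ w in 𝓝[{w : ℂ | 1 < ‖w‖}] z, 1 < ‖w‖ :=
  self_mem_nhdsWithin

theorem eq_arcEnd_of_re {θ₀ : ℝ} {z : ℂ} (hz : ‖z‖ = 1) (h : z.re = Real.cos θ₀) :
    z = arcEnd θ₀ ∨ z = star (arcEnd θ₀) := by
  have h1 : z.re ^ 2 + z.im ^ 2 = 1 := by
    have := Complex.sq_norm z
    rw [hz, Complex.normSq_apply] at this
    linarith
  have h2 : (z.im - Real.sin θ₀) * (z.im + Real.sin θ₀) = 0 := by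
    rw [h] at h1
    linear_combination h1 - Real.sin_sq_add_cos_sq θ₀
  have e1 : (arcEnd θ₀).re = Real.cos θ₀ := Complex.exp_ofReal_mul_I_re θ₀
  have e2 : (arcEnd θ₀).im = Real.sin θ₀ := Complex.exp_ofReal_mul_I_im θ₀
  rcases mul_eq_zero.1 h2 with h3 | h3
  · left
    exact Complex.ext (by rw [h, e1]) (by rw [e2]; linarith)
  · right
    refine Complex.ext ?_ ?_
    · change z.re = ((starRingEnd ℂ) (arcEnd θ₀)).re
      rw [Complex.conj_re, h, e1]
    · change z.im = ((starRingEnd ℂ) (arcEnd θ₀)).im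
      rw [Complex.conj_im, e2]; linarith

theorem arcSymbol_eq {θ₀ : ℝ} (s : ℝ) (h0 : 0 ≤ θ₀) (h1 : θ₀ ≤ Real.pi) {z : ℂ} (hz : ‖z‖ = 1) :
    arcSymbol θ₀ s z = if Real.cos θ₀ ≤ z.re then 1 else (s : ℂ) := by
  have hre : z.re = Real.cos |z.arg| := by
    rw [Real.cos_abs, Complex.cos_arg (by rintro rfl; simp at hz), hz, div_one]
  have : |z.arg| ≤ θ₀ ↔ Real.cos θ₀ ≤ z.re := by
    rw [hre]
    exact (Real.strictAntiOn_cos.le_iff_ge ⟨h0, h1⟩ ⟨abs_nonneg _, Complex.abs_arg_le_pi z⟩).symm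
  simp only [arcSymbol, this]

theorem arcMoebius_continuousAt {θ₀ : ℝ} {z : ℂ} (hz : circlePt (-θ₀) - z ≠ 0) :
    ContinuousAt (arcMoebius θ₀) z := by
  unfold arcMoebius
  exact ContinuousAt.div (by fun_prop) (by fun_prop) hz

/-- On the arc the logarithm in the closed form of the Cauchy transform crosses its branch cut; in
the gap it is continuous, and the jump `s` comes from the Cauchy integral of the full circle. -/
theorem cauchyPow_zero_hasJumpAt {θ₀ : ℝ} (s : ℝ) (h0 : 0 < θ₀) (h1 : θ₀ < Real.pi) {z : ℂ}
    (hz : ‖z‖ = 1) (hp : z ≠ arcEnd θ₀) (hq : z ≠ star (arcEnd θ₀)) :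
    HasJumpAt (cauchyPow θ₀ s 0) z (arcSymbol θ₀ s z) := by
  have hstar : star (arcEnd θ₀) = circlePt (-θ₀) := star_circlePt θ₀
  have hne : circlePt (-θ₀) - z ≠ 0 := by
    intro h
    apply hq
    rw [hstar]
    exact (sub_eq_zero.1 h).symm
  have hcont := arcMoebius_continuousAt hne
  have hden : 0 < ‖circlePt (-θ₀) - z‖ ^ 2 := by positivity
  have him : (arcMoebius θ₀ z).im = 0 := by
    rw [(arcMoebius_re_im θ₀ z).2, hz]; simp
  have hre := (arcMoebius_re_im θ₀ z).1
  rw [hz] at hre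
  have hsin := Real.sin_pos_of_pos_of_lt_pi h0 h1
  have hrene : z.re ≠ Real.cos θ₀ := fun h => by
    rcases eq_arcEnd_of_re hz h with h | h
    · exact hp h
    · exact hq h
  have hMin : Tendsto (arcMoebius θ₀) (𝓝[{w | ‖w‖ < 1}] z) (𝓝[{w | 0 ≤ w.im}] arcMoebius θ₀ z) := by
    refine tendsto_nhdsWithin_iff.2 ⟨hcont.tendsto.mono_left nhdsWithin_le_nhds, ?_⟩
    filter_upwards [eventually_mem_inside z] with w hw
    rw [(arcMoebius_re_im θ₀ w).2]
    have : 0 ≤ 1 - ‖w‖ ^ 2 := by nlinarith [norm_nonneg w]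
    positivity
  have hMout : Tendsto (arcMoebius θ₀) (𝓝[{w | 1 < ‖w‖}] z)
      (𝓝[{w | w.im < 0}] arcMoebius θ₀ z) := by
    refine tendsto_nhdsWithin_iff.2 ⟨hcont.tendsto.mono_left nhdsWithin_le_nhds, ?_⟩
    filter_upwards [eventually_mem_outside z, nhdsWithin_le_nhds
      ((isOpen_ne.preimage (by fun_prop : Continuous fun w : ℂ => circlePt (-θ₀) - w)).mem_nhds
        hne)] with w hw hw2
    rw [(arcMoebius_re_im θ₀ w).2]
    have hw3 : 0 < ‖circlePt (-θ₀) - w‖ ^ 2 := by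
      have : circlePt (-θ₀) - w ≠ 0 := hw2
      positivity
    refine div_neg_of_neg_of_pos (mul_neg_of_pos_of_neg hsin ?_) hw3
    nlinarith
  have hchiin : ∀ᶠ w in 𝓝[{w | ‖w‖ < 1}] z, cauchyPow θ₀ s 0 w = s +
      (1 - s) * (2 * Real.pi * Complex.I)⁻¹ *
        (Complex.log (arcMoebius θ₀ w) + θ₀ * Complex.I) := by
    filter_upwards [eventually_mem_inside z] with w hw
    rw [cauchyPow_zero s h0.le h1 (ne_of_lt hw), if_pos hw, mul_one]
  have hchiout : ∀ᶠ w in 𝓝[{w | 1 < ‖w‖}] z, cauchyPow θ₀ s 0 w =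
      (1 - s) * (2 * Real.pi * Complex.I)⁻¹ *
        (Complex.log (arcMoebius θ₀ w) + θ₀ * Complex.I) := by
    filter_upwards [eventually_mem_outside z] with w hw
    rw [cauchyPow_zero s h0.le h1 (ne_of_gt hw), if_neg (not_lt.2 hw.le), mul_zero, zero_add]
  rw [arcSymbol_eq s h0.le h1.le hz]
  have hpi : (Real.pi : ℂ) ≠ 0 := by exact_mod_cast Real.pi_ne_zero
  have hI := Complex.I_ne_zero
  rcases hrene.lt_or_gt with hlt | hgt
  · -- off the arc the logarithm is continuous
    rw [if_neg (not_le.2 hlt)]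
    have hsl : arcMoebius θ₀ z ∈ Complex.slitPlane := by
      refine Complex.mem_slitPlane_iff.2 (Or.inl ?_)
      rw [hre]
      exact div_pos (by linarith) hden
    have hl : ContinuousAt (fun w => Complex.log (arcMoebius θ₀ w)) z :=
      hcont.clog hsl
    refine ⟨_, _, Tendsto.congr' (hchiin.mono fun w hw => hw.symm)
      (((hl.tendsto.mono_left nhdsWithin_le_nhds).add_const _).const_mul _ |>.const_add _),
      Tendsto.congr' (hchiout.mono fun w hw => hw.symm)
      (((hl.tendsto.mono_left nhdsWithin_le_nhds).add_const _).const_mul _), ?_⟩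
    ring
  · rw [if_pos hgt.le]
    have hneg : (arcMoebius θ₀ z).re < 0 := by
      rw [hre]
      exact div_neg_of_neg_of_pos (by linarith) hden
    have l1 := (Complex.tendsto_log_nhdsWithin_im_nonneg_of_re_neg_of_im_zero hneg him).comp hMin
    have l2 := (Complex.tendsto_log_nhdsWithin_im_neg_of_re_neg_of_im_zero hneg him).comp hMout
    refine ⟨_, _, Tendsto.congr' (hchiin.mono fun w hw => hw.symm)
      ((l1.add_const _).const_mul _ |>.const_add _),
      Tendsto.congr' (hchiout.mono fun w hw => hw.symm) ((l2.add_const _).const_mul _), ?_⟩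
    field_simp
    ring

theorem HasJumpAt.const_mul {K : ℂ → ℂ} {z v : ℂ} (h : HasJumpAt K z v) (c : ℂ) :
    HasJumpAt (fun w => c * K w) z (c * v) := by
  obtain ⟨a, b, ha, hb, hab⟩ := h
  exact ⟨c * a, c * b, ha.const_mul c, hb.const_mul c, by rw [hab]; ring⟩

theorem HasJumpAt.sum {ι : Type*} {K : ι → ℂ → ℂ} {z : ℂ} {v : ι → ℂ} (S : Finset ι)
    (h : ∀ i ∈ S, HasJumpAt (K i) z (v i)) :
    HasJumpAt (fun w => ∑ i ∈ S, K i w) z (∑ i ∈ S, v i) := by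
  choose! a b ha hb hab using h
  refine ⟨∑ i ∈ S, a i, ∑ i ∈ S, b i, tendsto_finsetSum _ ha, tendsto_finsetSum _ hb, ?_⟩
  rw [← Finset.sum_add_distrib]
  exact Finset.sum_congr rfl hab

theorem cauchyPow_hasJumpAt {θ₀ : ℝ} (s : ℝ) (h0 : 0 < θ₀) (h1 : θ₀ < Real.pi) {z : ℂ}
    (hz : ‖z‖ = 1) (hp : z ≠ arcEnd θ₀) (hq : z ≠ star (arcEnd θ₀)) (k : ℕ) :
    HasJumpAt (cauchyPow θ₀ s (-(k : ℤ))) z (z ^ (-(k : ℤ)) * arcSymbol θ₀ s z) := by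
  have hz0 : z ≠ 0 := by rintro rfl; simp at hz
  induction k with
  | zero => simpa using cauchyPow_zero_hasJumpAt s h0 h1 hz hp hq
  | succ k ih =>
    obtain ⟨a, b, ha, hb, hab⟩ := ih
    have e : (-((k + 1 : ℕ) : ℤ)) = -(k : ℤ) - 1 := by push_cast; ring
    rw [e]
    set M := symbolMean θ₀ s fun θ => circlePt θ ^ (-(k : ℤ))
    have hinv : Tendsto (fun w : ℂ => w⁻¹) (𝓝 z) (𝓝 z⁻¹) := tendsto_inv₀ hz0
    have hne : ∀ᶠ w : ℂ in 𝓝 z, w ≠ 0 := isOpen_ne.mem_nhds hz0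
    refine ⟨z⁻¹ * (a - M), z⁻¹ * (b - M), ?_, ?_, ?_⟩
    · refine Tendsto.congr' ?_ ((hinv.mono_left nhdsWithin_le_nhds).mul (ha.sub_const M))
      filter_upwards [eventually_mem_inside z, nhdsWithin_le_nhds hne] with w hw hw0
      exact (cauchyPow_pred θ₀ s _ (ne_of_lt hw) hw0).symm
    · refine Tendsto.congr' ?_ ((hinv.mono_left nhdsWithin_le_nhds).mul (hb.sub_const M))
      filter_upwards [eventually_mem_outside z, nhdsWithin_le_nhds hne] with w hw hw0
      exact (cauchyPow_pred θ₀ s _ (ne_of_gt hw) hw0).symm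
    · rw [hab, zpow_sub_one₀ hz0]
      ring

theorem cauchyPow_zero_isBigO {θ₀ : ℝ} (s : ℝ) (h0 : 0 < θ₀) (h1 : θ₀ < Real.pi) {p : ℂ}
    (hp : p = arcEnd θ₀ ∨ p = star (arcEnd θ₀)) :
    cauchyPow θ₀ s 0 =O[𝓝[offCircle] p] fun z => Real.log ‖z - p‖ := by
  have hp1 : ‖p‖ = 1 := by
    rcases hp with rfl | rfl
    · exact norm_arcEnd θ₀
    · rw [norm_star, norm_arcEnd]
  have hone := one_isBigO_log_norm_sub (p := p) (l := 𝓝[offCircle] p) nhdsWithin_le_nhds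
      (by filter_upwards [self_mem_nhdsWithin] with z hz
          rintro rfl
          exact hz hp1)
  have hpq : circlePt θ₀ ≠ circlePt (-θ₀) := by
    rw [← star_circlePt]
    exact arcEnd_ne_star h0 h1
  have hfar : ∀ q : ℂ, p ≠ q →
      (fun z => Real.log ‖z - q‖) =O[𝓝[offCircle] p] fun _ => (1 : ℝ) := by
    intro q hq
    have : ContinuousAt (fun z => Real.log ‖z - q‖) p :=
      ContinuousAt.log (by fun_prop) (norm_ne_zero_iff.2 (sub_ne_zero.2 hq))
    exact (this.tendsto.isBigO_one ℝ).mono nhdsWithin_le_nhds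
  have hlogc : ∀ c : ℝ, (fun z => Real.log ‖z - circlePt c‖) =O[𝓝[offCircle] p]
      fun z => Real.log ‖z - p‖ := by
    intro c
    by_cases h : p = circlePt c
    · rw [← h]
    · exact (hfar _ h).trans hone
  have hbound : (fun z => Complex.log (arcMoebius θ₀ z)) =O[𝓝[offCircle] p] fun z =>
      |Real.log ‖z - circlePt θ₀‖| + |Real.log ‖z - circlePt (-θ₀)‖| + Real.pi := by
    refine IsBigO.of_bound 1 ?_
    filter_upwards [self_mem_nhdsWithin] with z hz
    have e1 := circlePt_sub_ne_zero hz θ₀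
    have e2 := circlePt_sub_ne_zero hz (-θ₀)
    have hn : ‖arcMoebius θ₀ z‖ = ‖z - circlePt θ₀‖ / ‖z - circlePt (-θ₀)‖ := by
      rw [arcMoebius, norm_div, norm_sub_rev (circlePt (-θ₀)) z]
      congr 1
      have : 1 - z * circlePt (-θ₀) = circlePt (-θ₀) * (circlePt θ₀ - z) := by
        have h3 := circlePt_ne_zero θ₀
        rw [circlePt_neg]
        field_simp
      rw [this, norm_mul, norm_circlePt, one_mul, norm_sub_rev]
    have hl : (Complex.log (arcMoebius θ₀ z)).re =
        Real.log ‖z - circlePt θ₀‖ - Real.log ‖z - circlePt (-θ₀)‖ := by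
      rw [Complex.log_re, hn, Real.log_div]
      · rw [norm_sub_rev]; exact norm_ne_zero_iff.2 e1
      · rw [norm_sub_rev]; exact norm_ne_zero_iff.2 e2
    have hi : |(Complex.log (arcMoebius θ₀ z)).im| ≤ Real.pi := by
      rw [Complex.log_im]; exact Complex.abs_arg_le_pi _
    have h3 := Complex.norm_le_abs_re_add_abs_im (Complex.log (arcMoebius θ₀ z))
    rw [hl] at h3
    have h4 := abs_sub (Real.log ‖z - circlePt θ₀‖) (Real.log ‖z - circlePt (-θ₀)‖)
    rw [one_mul, Real.norm_eq_abs, abs_of_nonneg (by positivity)]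
    linarith
  have hlogM : (fun z => Complex.log (arcMoebius θ₀ z)) =O[𝓝[offCircle] p] fun z =>
      Real.log ‖z - p‖ := by
    refine hbound.trans (((hlogc θ₀).abs_left.add (hlogc (-θ₀)).abs_left).add ?_)
    exact (isBigO_const_const _ one_ne_zero _).trans hone
  have hrep : cauchyPow θ₀ s 0 =ᶠ[𝓝[offCircle] p] fun z => (s : ℂ) * (if ‖z‖ < 1 then 1 else 0) +
      (1 - s) * (2 * Real.pi * Complex.I)⁻¹ *
        (Complex.log (arcMoebius θ₀ z) + θ₀ * Complex.I) := by
    filter_upwards [self_mem_nhdsWithin] with z hz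
    exact cauchyPow_zero s h0.le h1 hz
  refine IsBigO.congr' ?_ hrep.symm EventuallyEq.rfl
  refine IsBigO.add (IsBigO.const_mul_left ?_ _) (IsBigO.const_mul_left (hlogM.add ?_) _)
  · refine IsBigO.trans (IsBigO.of_bound 1 (Eventually.of_forall fun z => ?_)) hone
    split_ifs <;> simp
  · exact (isBigO_const_const _ one_ne_zero _).trans hone

/-- The recursion in the exponent carries the logarithmic bound over to all nonpositive powers. -/
theorem cauchyPow_isBigO {θ₀ : ℝ} (s : ℝ) (h0 : 0 < θ₀) (h1 : θ₀ < Real.pi) {p : ℂ}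
    (hp : p = arcEnd θ₀ ∨ p = star (arcEnd θ₀)) (k : ℕ) :
    cauchyPow θ₀ s (-(k : ℤ)) =O[𝓝[offCircle] p] fun z => Real.log ‖z - p‖ := by
  have hp1 : ‖p‖ = 1 := by
    rcases hp with rfl | rfl
    · exact norm_arcEnd θ₀
    · rw [norm_star, norm_arcEnd]
  have hp0 : p ≠ 0 := by rintro rfl; simp at hp1
  have hone := one_isBigO_log_norm_sub (p := p) (l := 𝓝[offCircle] p) nhdsWithin_le_nhds
      (by filter_upwards [self_mem_nhdsWithin] with z hz
          rintro rfl
          exact hz hp1)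
  induction k with
  | zero => simpa using cauchyPow_zero_isBigO s h0 h1 hp
  | succ k ih =>
    have e : (-((k + 1 : ℕ) : ℤ)) = -(k : ℤ) - 1 := by push_cast; ring
    rw [e]
    have hne : ∀ᶠ w : ℂ in 𝓝 p, w ≠ 0 := isOpen_ne.mem_nhds hp0
    have hinv : (fun w : ℂ => w⁻¹) =O[𝓝[offCircle] p] fun _ => (1 : ℝ) :=
      ((tendsto_inv₀ hp0).isBigO_one ℝ).mono nhdsWithin_le_nhds
    have h2 := hinv.mul (ih.sub ((isBigO_const_const
      (symbolMean θ₀ s fun θ => circlePt θ ^ (-(k : ℤ))) (one_ne_zero (α := ℝ)) _).trans hone))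
    simp only [one_mul] at h2
    refine IsBigO.congr' h2 ?_ EventuallyEq.rfl
    filter_upwards [self_mem_nhdsWithin, nhdsWithin_le_nhds hne] with w hw hw0
    exact (cauchyPow_pred θ₀ s _ hw hw0).symm

/-! ### The solution of the Riemann–Hilbert problem -/

/-- The Cauchy transform of `q(w) w^{-n} f(w)` over the unit circle, `f` being the symbol. -/
noncomputable def cauchyTransform (θ₀ s : ℝ) (n : ℕ) (q : Polynomial ℂ) (z : ℂ) : ℂ :=
  symbolMean θ₀ s fun θ =>
    (q.eval (circlePt θ) * circlePt θ ^ (-(n : ℤ)) * circlePt θ) / (circlePt θ - z)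

theorem cauchyTransform_eq_sum (θ₀ s : ℝ) {n : ℕ} {q : Polynomial ℂ} (hq : q.natDegree ≤ n)
    {z : ℂ} (hz : z ∈ offCircle) : cauchyTransform θ₀ s n q z =
      ∑ k ∈ Finset.range (n + 1), q.coeff k * cauchyPow θ₀ s (-((n - k : ℕ) : ℤ)) z := by
  have h : (fun θ => (q.eval (circlePt θ) * circlePt θ ^ (-(n : ℤ)) * circlePt θ) /
      (circlePt θ - z)) = fun θ => ∑ k ∈ Finset.range (n + 1),
      q.coeff k * (circlePt θ ^ (-((n - k : ℕ) : ℤ) + 1) / (circlePt θ - z)) := by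
    funext θ
    rw [Polynomial.eval_eq_sum_range' (Nat.lt_succ_of_le hq), Finset.sum_mul, Finset.sum_mul,
      Finset.sum_div]
    refine Finset.sum_congr rfl fun k hk => ?_
    have hk' : k ≤ n := Nat.lt_succ_iff.1 (Finset.mem_range.1 hk)
    have h0 := circlePt_ne_zero θ
    have e : (-((n - k : ℕ) : ℤ) + 1) = (k : ℤ) + -(n : ℤ) + 1 := by
      push_cast [hk']; ring
    rw [e, zpow_add₀ h0, zpow_add₀ h0, zpow_natCast, zpow_one]
    ring
  rw [cauchyTransform, h, symbolMean_sum]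
  · refine Finset.sum_congr rfl fun k _ => ?_
    rw [symbolMean_const_mul, cauchyPow]
  · exact fun k => continuous_const.mul
      (continuous_cauchy_kernel (continuous_circlePt_zpow _) hz)

theorem continuous_eval_circlePt (q : Polynomial ℂ) : Continuous fun θ => q.eval (circlePt θ) :=
  q.continuous.comp continuous_circlePt

theorem exists_norm_eval_circlePt_le (q : Polynomial ℂ) :
    ∃ M : ℝ, 0 ≤ M ∧ ∀ θ, ‖q.eval (circlePt θ)‖ ≤ M := by
  refine ⟨∑ k ∈ Finset.range (q.natDegree + 1), ‖q.coeff k‖,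
    Finset.sum_nonneg fun _ _ => norm_nonneg _, fun θ => ?_⟩
  rw [Polynomial.eval_eq_sum_range]
  refine (norm_sum_le _ _).trans (Finset.sum_le_sum fun k _ => ?_)
  simp

theorem symbolMean_cauchy_isBigO {θ₀ : ℝ} (s : ℝ) (h0 : 0 ≤ θ₀) (h1 : θ₀ ≤ Real.pi)
    {u : ℝ → ℂ} {M : ℝ} (hu : ∀ θ, ‖u θ‖ ≤ M) :
    (fun z => symbolMean θ₀ s fun θ => u θ / (circlePt θ - z)) =O[Bornology.cobounded ℂ]
      fun z : ℂ => z⁻¹ := by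
  have hM : 0 ≤ M := (norm_nonneg _).trans (hu 0)
  refine IsBigO.of_bound ((|s| + |1 - s|) * (2 * M)) ?_
  rw [← comap_norm_atTop, Filter.eventually_comap]
  filter_upwards [eventually_ge_atTop 2] with r hr z hz
  subst hz
  have hpos : 0 < ‖z‖ := by linarith
  have := norm_symbolMean_le θ₀ s (F := fun θ => u θ / (circlePt θ - z)) (M := 2 * M * ‖z‖⁻¹)
    h0 h1 fun θ => by
      have h2 : ‖z‖ / 2 ≤ ‖circlePt θ - z‖ := by
        have := norm_sub_norm_le z (circlePt θ)
        rw [norm_circlePt, norm_sub_rev] at this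
        linarith
      rw [norm_div]
      calc ‖u θ‖ / ‖circlePt θ - z‖ ≤ M / (‖z‖ / 2) := by
            gcongr
            exact hu θ
        _ = _ := by field_simp
  rw [norm_inv]
  linarith

/-- Expansion of the Cauchy transform at infinity. -/
theorem cauchyTransform_mul_pow (θ₀ s : ℝ) (n : ℕ) (q : Polynomial ℂ) {z : ℂ}
    (hz : z ∈ offCircle) : cauchyTransform θ₀ s n q z * z ^ n =
      (symbolMean θ₀ s fun θ => q.eval (circlePt θ) * circlePt θ / (circlePt θ - z)) -
      ∑ k ∈ Finset.range n, z ^ k *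
        symbolMean θ₀ s fun θ => q.eval (circlePt θ) * circlePt θ ^ (-(k : ℤ)) := by
  have hq := continuous_eval_circlePt q
  have h : ∀ θ, z ^ n * ((q.eval (circlePt θ) * circlePt θ ^ (-(n : ℤ)) * circlePt θ) /
      (circlePt θ - z)) = q.eval (circlePt θ) * circlePt θ / (circlePt θ - z) -
      ∑ k ∈ Finset.range n, z ^ k * (q.eval (circlePt θ) * circlePt θ ^ (-(k : ℤ))) := by
    intro θ
    have h1 := circlePt_sub_ne_zero hz θ
    have h0 := circlePt_ne_zero θ
    set c := circlePt θ
    have hgeom : (∑ k ∈ Finset.range n, z ^ k * c ^ (n - 1 - k)) * (c - z) = c ^ n - z ^ n := by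
      have := (Commute.all z c).geom_sum₂_mul (n := n)
      linear_combination -this
    have hs : (∑ k ∈ Finset.range n, z ^ k * (q.eval c * c ^ (-(k : ℤ)))) * c ^ n =
        q.eval c * c * ∑ k ∈ Finset.range n, z ^ k * c ^ (n - 1 - k) := by
      rw [Finset.sum_mul, Finset.mul_sum]
      refine Finset.sum_congr rfl fun k hk => ?_
      have hk' := Finset.mem_range.1 hk
      have e : n = (n - 1 - k) + 1 + k := by omega
      rw [zpow_neg, zpow_natCast]
      conv_lhs => rw [e, pow_add, pow_succ]
      field_simp
    have hcn : c ^ n ≠ 0 := pow_ne_zero n h0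
    rw [zpow_neg, zpow_natCast, eq_sub_iff_add_eq]
    apply mul_right_cancel₀ hcn
    rw [add_mul, hs]
    apply mul_right_cancel₀ h1
    have h2 : z ^ n * (q.eval c * (c ^ n)⁻¹ * c / (c - z)) * c ^ n * (c - z) =
        z ^ n * q.eval c * c := by
      field_simp
    have h3 : q.eval c * c / (c - z) * c ^ n * (c - z) = q.eval c * c * c ^ n := by
      field_simp
    rw [add_mul, h2, h3, mul_assoc (q.eval c * c), hgeom]
    ring
  rw [mul_comm, cauchyTransform, ← symbolMean_const_mul]
  simp only [h]
  have hc : ∀ k : ℕ, Continuous fun θ => z ^ k *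
      (q.eval (circlePt θ) * circlePt θ ^ (-(k : ℤ))) := fun k =>
    continuous_const.mul (hq.mul (continuous_circlePt_zpow _))
  rw [symbolMean_sub, symbolMean_sum]
  · simp only [symbolMean_const_mul]
  · exact hc
  · exact continuous_cauchy_kernel (hq.mul continuous_circlePt) hz
  · exact continuous_finsetSum _ fun k _ => hc k

theorem eval_mul_zpow_isBigO {n : ℕ} {q : Polynomial ℂ} (hq : q.degree < n) :
    (fun z : ℂ => q.eval z * z ^ (-(n : ℤ))) =O[Bornology.cobounded ℂ] fun z : ℂ => z⁻¹ := by
  by_cases h0 : q = 0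
  · simp [h0, isBigO_zero]
  have hd : q.natDegree < n := (Polynomial.natDegree_lt_iff_degree_lt h0).2 hq
  refine IsBigO.of_bound (∑ k ∈ Finset.range n, ‖q.coeff k‖) ?_
  rw [← comap_norm_atTop, Filter.eventually_comap]
  filter_upwards [eventually_ge_atTop 1] with r hr z hz
  subst hz
  have hz0 : z ≠ 0 := by rintro rfl; simp at hr; linarith
  rw [Polynomial.eval_eq_sum_range' hd, Finset.sum_mul, Finset.sum_mul]
  refine (norm_sum_le _ _).trans (Finset.sum_le_sum fun k hk => ?_)
  have hk' := Finset.mem_range.1 hk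
  have e : n = (n - 1 - k) + k + 1 := by omega
  rw [norm_mul, norm_mul, norm_zpow, norm_pow, zpow_neg, zpow_natCast, norm_inv, mul_assoc]
  gcongr
  have hpos : 0 < ‖z‖ := by linarith
  conv_lhs => rw [e, pow_succ, pow_add]
  have : 1 ≤ ‖z‖ ^ (n - 1 - k) := one_le_pow₀ hr
  rw [mul_inv, mul_inv]
  have h3 : (‖z‖ ^ (n - 1 - k))⁻¹ ≤ 1 := inv_le_one_of_one_le₀ this
  calc ‖z‖ ^ k * ((‖z‖ ^ (n - 1 - k))⁻¹ * (‖z‖ ^ k)⁻¹ * ‖z‖⁻¹)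
      = (‖z‖ ^ (n - 1 - k))⁻¹ * ‖z‖⁻¹ := by field_simp
    _ ≤ 1 * ‖z‖⁻¹ := by gcongr
    _ = ‖z‖⁻¹ := one_mul _

theorem cauchyTransform_hasJumpAt {θ₀ : ℝ} (s : ℝ) (h0 : 0 < θ₀) (h1 : θ₀ < Real.pi) {z : ℂ}
    (hz : ‖z‖ = 1) (hp : z ≠ arcEnd θ₀) (hq : z ≠ star (arcEnd θ₀)) {n : ℕ} {q : Polynomial ℂ}
    (hn : q.natDegree ≤ n) : HasJumpAt (cauchyTransform θ₀ s n q) z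
      (q.eval z * (z ^ (-(n : ℤ)) * arcSymbol θ₀ s z)) := by
  have hz0 : z ≠ 0 := by rintro rfl; simp at hz
  obtain ⟨a, b, ha, hb, hab⟩ := HasJumpAt.sum (Finset.range (n + 1)) fun k _ =>
    (cauchyPow_hasJumpAt s h0 h1 hz hp hq (n - k)).const_mul (q.coeff k)
  refine ⟨a, b, ?_, ?_, ?_⟩
  · refine Tendsto.congr' ?_ ha
    filter_upwards [eventually_mem_inside z] with w hw
    exact (cauchyTransform_eq_sum θ₀ s hn (ne_of_lt hw)).symm
  · refine Tendsto.congr' ?_ hb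
    filter_upwards [eventually_mem_outside z] with w hw
    exact (cauchyTransform_eq_sum θ₀ s hn (ne_of_gt hw)).symm
  · rw [hab, Polynomial.eval_eq_sum_range' (Nat.lt_succ_of_le hn), Finset.sum_mul]
    congr 1
    refine Finset.sum_congr rfl fun k hk => ?_
    have hk' : k ≤ n := Nat.lt_succ_iff.1 (Finset.mem_range.1 hk)
    have e : (-((n - k : ℕ) : ℤ)) = (k : ℤ) + -(n : ℤ) := by
      push_cast [hk']; ring
    rw [e, zpow_add₀ hz0, zpow_natCast]
    ring

/-- Polynomials `Φ`, `Q` with the right moments solve the Riemann–Hilbert problem. -/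
theorem isRHSolution_of_moments {θ₀ : ℝ} (s : ℝ) (h0 : 0 < θ₀) (h1 : θ₀ < Real.pi) {n : ℕ}
    (hn : 0 < n) {Φ Q : Polynomial ℂ} (hΦ : (Φ - Polynomial.X ^ n).degree < (n : WithBot ℕ))
    (hQ : Q.degree < n)
    (hΦm : ∀ k < n, (symbolMean θ₀ s fun θ => Φ.eval (circlePt θ) * circlePt θ ^ (-(k : ℤ))) = 0)
    (hQm : ∀ k < n, (symbolMean θ₀ s fun θ => Q.eval (circlePt θ) * circlePt θ ^ (-(k : ℤ))) =
      if k = 0 then -1 else 0) :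
    IsRHSolution n θ₀ s fun z => !![Φ.eval z, cauchyTransform θ₀ s n Φ z;
      Q.eval z, cauchyTransform θ₀ s n Q z] := by
  have hΦn : Φ.natDegree ≤ n := by
    have : Φ = (Φ - Polynomial.X ^ n) + Polynomial.X ^ n := by ring
    rw [this, Polynomial.natDegree_le_iff_degree_le]
    refine (Polynomial.degree_add_le _ _).trans (max_le hΦ.le ?_)
    rw [Polynomial.degree_X_pow]
  have hQn : Q.natDegree ≤ n := Polynomial.natDegree_le_iff_degree_le.2 hQ.le
  have hoff : ∀ᶠ z : ℂ in Bornology.cobounded ℂ, z ∈ offCircle ∧ z ≠ 0 := by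
    rw [← comap_norm_atTop, Filter.eventually_comap]
    filter_upwards [eventually_ge_atTop 2] with r hr z hz
    subst hz
    refine ⟨?_, ?_⟩
    · simp only [offCircle, Set.mem_ofPred_eq]; linarith
    · rintro rfl; simp at hr; linarith
  have hrem : ∀ q : Polynomial ℂ, (fun z => symbolMean θ₀ s fun θ =>
      q.eval (circlePt θ) * circlePt θ / (circlePt θ - z)) =O[Bornology.cobounded ℂ]
      fun z : ℂ => z⁻¹ := by
    intro q
    obtain ⟨M, -, hM⟩ := exists_norm_eval_circlePt_le q
    refine symbolMean_cauchy_isBigO s h0.le h1.le (M := M) fun θ => ?_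
    rw [norm_mul, norm_circlePt, mul_one]
    exact hM θ
  have hcd : ∀ q : Polynomial ℂ, DifferentiableOn ℂ (cauchyTransform θ₀ s n q) offCircle :=
    fun q => differentiableOn_symbolMean_cauchy
      (((continuous_eval_circlePt q).mul (continuous_circlePt_zpow _)).mul continuous_circlePt) _ _
  have hcl : ∀ q : Polynomial ℂ, q.natDegree ≤ n → ∀ p : ℂ,
      (p = arcEnd θ₀ ∨ p = star (arcEnd θ₀)) →
      cauchyTransform θ₀ s n q =O[𝓝[offCircle] p] fun z => Real.log ‖z - p‖ := by
    intro q hq p hp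
    have h2 : (fun z => ∑ k ∈ Finset.range (n + 1),
        q.coeff k * cauchyPow θ₀ s (-((n - k : ℕ) : ℤ)) z) =O[𝓝[offCircle] p]
        fun z => Real.log ‖z - p‖ := by
      refine IsBigO.fun_sum fun k _ => ?_
      exact (cauchyPow_isBigO s h0 h1 hp (n - k)).const_mul_left _
    refine IsBigO.congr' h2 ?_ EventuallyEq.rfl
    filter_upwards [self_mem_nhdsWithin] with z hz
    exact (cauchyTransform_eq_sum θ₀ s hq hz).symm
  refine ⟨?_, ?_, ?_, ?_, ?_⟩
  · intro i j
    fin_cases i <;> fin_cases j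
    · simpa using Φ.differentiable.differentiableOn
    · simpa using hcd Φ
    · simpa using Q.differentiable.differentiableOn
    · simpa using hcd Q
  · intro z hz hp hq
    obtain ⟨a, b, ha, hb, hab⟩ := cauchyTransform_hasJumpAt s h0 h1 hz hp hq hΦn
    obtain ⟨c, d, hc, hd, hcd⟩ := cauchyTransform_hasJumpAt s h0 h1 hz hp hq hQn
    refine ⟨!![Φ.eval z, a; Q.eval z, c], !![Φ.eval z, b; Q.eval z, d], ?_, ?_, ?_⟩
    · refine tendsto_pi_nhds.2 fun i => tendsto_pi_nhds.2 fun j => ?_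
      fin_cases i <;> fin_cases j
      · simpa using (Φ.continuous.tendsto z).mono_left nhdsWithin_le_nhds
      · simpa using ha
      · simpa using (Q.continuous.tendsto z).mono_left nhdsWithin_le_nhds
      · simpa using hc
    · refine tendsto_pi_nhds.2 fun i => tendsto_pi_nhds.2 fun j => ?_
      fin_cases i <;> fin_cases j
      · simpa using (Φ.continuous.tendsto z).mono_left nhdsWithin_le_nhds
      · simpa using hb
      · simpa using (Q.continuous.tendsto z).mono_left nhdsWithin_le_nhds
      · simpa using hd
    · rw [Matrix.mul_fin_two, hab, hcd]
      ext i j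
      fin_cases i <;> fin_cases j <;> simp [add_comm]
  · intro i j
    simp only [Matrix.mul_fin_two]
    fin_cases i <;> fin_cases j
    · refine IsBigO.congr' (eval_mul_zpow_isBigO hΦ) ?_ EventuallyEq.rfl
      filter_upwards [hoff] with z hz
      have : z ^ n ≠ 0 := pow_ne_zero n hz.2
      simp
      field_simp
    · refine IsBigO.congr' (hrem Φ) ?_ EventuallyEq.rfl
      filter_upwards [hoff] with z hz
      simp only [Matrix.sub_apply, Fin.zero_eta, Fin.mk_one, Matrix.of_apply, Matrix.cons_val_zero,
        Matrix.cons_val_one, mul_zero, zero_add, ne_eq, zero_ne_one, not_false_eq_true,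
        Matrix.one_apply_ne, sub_zero, zpow_natCast]
      rw [cauchyTransform_mul_pow _ _ _ _ hz.1, Finset.sum_eq_zero, sub_zero]
      intro k hk
      rw [hΦm k (Finset.mem_range.1 hk), mul_zero]
    · refine IsBigO.congr' (eval_mul_zpow_isBigO hQ) ?_ EventuallyEq.rfl
      filter_upwards with z
      simp
    · refine IsBigO.congr' (hrem Q) ?_ EventuallyEq.rfl
      filter_upwards [hoff] with z hz
      simp only [Matrix.sub_apply, Fin.mk_one, Matrix.of_apply, Matrix.cons_val_zero,
        Matrix.cons_val_one, mul_zero, zero_add,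
        Matrix.one_apply_eq, zpow_natCast]
      rw [cauchyTransform_mul_pow _ _ _ _ hz.1, Finset.sum_eq_single_of_mem 0
        (Finset.mem_range.2 hn), hQm 0 hn]
      · simp
      · intro k hk hk0
        rw [hQm k (Finset.mem_range.1 hk), if_neg hk0, mul_zero]
  · intro p hp i
    have hb : ∀ q : Polynomial ℂ, (fun z : ℂ => q.eval z) =O[𝓝[offCircle] p] fun _ => (1 : ℝ) :=
      fun q => ((q.continuous.tendsto p).isBigO_one ℝ).mono nhdsWithin_le_nhds
    fin_cases i
    · simpa using hb Φ
    · simpa using hb Q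
  · intro p hp i
    fin_cases i
    · simpa using hcl Φ hΦn p hp
    · simpa using hcl Q hQn p hp

/-! ### Orthogonal polynomials for the symbol -/

/-- The square of the norm of the polynomial `P` in `L²(f dθ / 2π)`, `f` being the symbol. -/
noncomputable def energy (θ₀ s : ℝ) (P : Polynomial ℂ) : ℝ :=
  (2 * Real.pi)⁻¹ * (s * (∫ θ in (-Real.pi)..Real.pi, ‖P.eval (circlePt θ)‖ ^ 2) +
    (1 - s) * ∫ θ in (-θ₀)..θ₀, ‖P.eval (circlePt θ)‖ ^ 2)

/-- The inner product of two polynomials in `L²(f dθ / 2π)`, linear in the first argument. -/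
noncomputable def symbolInner (θ₀ s : ℝ) (P R : Polynomial ℂ) : ℂ :=
  symbolMean θ₀ s fun θ => P.eval (circlePt θ) * (starRingEnd ℂ) (R.eval (circlePt θ))

/-- The square of the norm of `P` over the gap, the complement of the arc. -/
noncomputable def gapEnergy (θ₀ : ℝ) (P : Polynomial ℂ) : ℝ := energy θ₀ 1 P - energy θ₀ 0 P

/-- The inner product of two polynomials over the gap. -/
noncomputable def gapInner (θ₀ : ℝ) (P R : Polynomial ℂ) : ℂ :=
  symbolInner θ₀ 1 P R - symbolInner θ₀ 0 P R

/-- `Φ` is the monic polynomial of degree `n` orthogonal to all polynomials of lower degree. Being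
monic of degree `n` is expressed by the degree of `Φ - X ^ n`. -/
structure IsMonicOrthogonal (θ₀ s : ℝ) (n : ℕ) (Φ : Polynomial ℂ) : Prop where
  degree_sub : (Φ - Polynomial.X ^ n).degree < (n : WithBot ℕ)
  moments : ∀ k < n,
    (symbolMean θ₀ s fun θ => Φ.eval (circlePt θ) * circlePt θ ^ (-(k : ℤ))) = 0

section
variable {θ₀ s : ℝ}

theorem continuous_conj_eval (P : Polynomial ℂ) :
    Continuous fun θ => (starRingEnd ℂ) (P.eval (circlePt θ)) :=
  Complex.continuous_conj.comp (continuous_eval_circlePt P)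

theorem continuous_mul_conj_eval (P R : Polynomial ℂ) :
    Continuous fun θ => P.eval (circlePt θ) * (starRingEnd ℂ) (R.eval (circlePt θ)) :=
  (continuous_eval_circlePt P).mul (continuous_conj_eval R)

theorem continuous_norm_sq_eval (P : Polynomial ℂ) :
    Continuous fun θ => ‖P.eval (circlePt θ)‖ ^ 2 :=
  (continuous_eval_circlePt P).norm.pow 2

theorem symbolMean_ofReal (F : ℝ → ℝ) : symbolMean θ₀ s (fun θ => (F θ : ℂ)) =
    (((2 * Real.pi)⁻¹ * (s * (∫ θ in (-Real.pi)..Real.pi, F θ) +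
      (1 - s) * ∫ θ in (-θ₀)..θ₀, F θ) : ℝ) : ℂ) := by
  simp only [symbolMean, intervalIntegral.integral_ofReal]
  push_cast
  ring

theorem symbolInner_self (P : Polynomial ℂ) : symbolInner θ₀ s P P = (energy θ₀ s P : ℂ) := by
  rw [energy, ← symbolMean_ofReal, symbolInner]
  congr 1
  funext θ
  rw [Complex.mul_conj, Complex.normSq_eq_norm_sq]

theorem symbolInner_add_left (P Q R : Polynomial ℂ) :
    symbolInner θ₀ s (P + Q) R = symbolInner θ₀ s P R + symbolInner θ₀ s Q R := by
  simp only [symbolInner, Polynomial.eval_add, add_mul]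
  exact symbolMean_add _ _ (continuous_mul_conj_eval _ _) (continuous_mul_conj_eval _ _)

theorem symbolInner_sub_left (P Q R : Polynomial ℂ) :
    symbolInner θ₀ s (P - Q) R = symbolInner θ₀ s P R - symbolInner θ₀ s Q R := by
  simp only [symbolInner, Polynomial.eval_sub, sub_mul]
  exact symbolMean_sub _ _ (continuous_mul_conj_eval _ _) (continuous_mul_conj_eval _ _)

theorem symbolInner_sub_right (P Q R : Polynomial ℂ) :
    symbolInner θ₀ s P (Q - R) = symbolInner θ₀ s P Q - symbolInner θ₀ s P R := by
  simp only [symbolInner, Polynomial.eval_sub, map_sub, mul_sub]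
  exact symbolMean_sub _ _ (continuous_mul_conj_eval _ _) (continuous_mul_conj_eval _ _)

theorem symbolInner_conj (P R : Polynomial ℂ) :
    (starRingEnd ℂ) (symbolInner θ₀ s P R) = symbolInner θ₀ s R P := by
  have h : ∀ a b : ℝ, (starRingEnd ℂ) (∫ θ in a..b,
      P.eval (circlePt θ) * (starRingEnd ℂ) (R.eval (circlePt θ))) =
      ∫ θ in a..b, R.eval (circlePt θ) * (starRingEnd ℂ) (P.eval (circlePt θ)) := by
    intro a b
    simp only [intervalIntegral.intervalIntegral_eq_integral_uIoc, Complex.real_smul, map_mul,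
      Complex.conj_ofReal, ← integral_conj, Complex.conj_conj, mul_comm]
  simp only [symbolInner, symbolMean, map_mul, map_add, map_sub, map_one, map_inv₀, h,
    Complex.conj_ofReal, map_ofNat]

theorem symbolInner_C_mul_left (c : ℂ) (P R : Polynomial ℂ) :
    symbolInner θ₀ s (Polynomial.C c * P) R = c * symbolInner θ₀ s P R := by
  simp only [symbolInner, Polynomial.eval_mul, Polynomial.eval_C, mul_assoc]
  exact symbolMean_const_mul _ _ _ _

theorem symbolMean_affine (F : ℝ → ℂ) (t : ℝ) : symbolMean θ₀ t F - symbolMean θ₀ s F =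
    (t - s) * (symbolMean θ₀ 1 F - symbolMean θ₀ 0 F) := by
  simp only [symbolMean]; push_cast; ring

theorem symbolInner_affine (P R : Polynomial ℂ) (t : ℝ) :
    symbolInner θ₀ t P R - symbolInner θ₀ s P R = (t - s) * gapInner θ₀ P R :=
  symbolMean_affine _ _

/-- The energy is affine in the parameter, with slope the energy in the gap. -/
theorem energy_affine (P : Polynomial ℂ) (t : ℝ) :
    energy θ₀ t P - energy θ₀ s P = (t - s) * gapEnergy θ₀ P := by
  simp only [energy, gapEnergy]; ring

theorem energy_zero (P : Polynomial ℂ) : energy θ₀ 0 P =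
    (2 * Real.pi)⁻¹ * ∫ θ in (-θ₀)..θ₀, ‖P.eval (circlePt θ)‖ ^ 2 := by
  simp [energy]

theorem energy_eq (P : Polynomial ℂ) : energy θ₀ s P = energy θ₀ 0 P + s * gapEnergy θ₀ P := by
  simp only [energy, gapEnergy]; ring

theorem gapMean_eq {E : Type*} [NormedAddCommGroup E] [NormedSpace ℝ E] (θ₀ : ℝ) {F : ℝ → E}
    (hF : Continuous F) (hper : Function.Periodic F (2 * Real.pi)) :
    (∫ θ in (-Real.pi)..Real.pi, F θ) - (∫ θ in (-θ₀)..θ₀, F θ) =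
      ∫ θ in θ₀..(2 * Real.pi - θ₀), F θ := by
  have h1 := hper.intervalIntegral_add_eq (-Real.pi) (-θ₀)
  have e1 : -Real.pi + 2 * Real.pi = Real.pi := by ring
  have e2 : -θ₀ + 2 * Real.pi = 2 * Real.pi - θ₀ := by ring
  rw [e1, e2] at h1
  rw [h1, ← intervalIntegral.integral_add_adjacent_intervals (hF.intervalIntegrable (-θ₀) θ₀)
    (hF.intervalIntegrable θ₀ _)]
  abel

theorem circlePt_periodic : Function.Periodic circlePt (2 * Real.pi) := by
  intro θ
  rw [circlePt_add]
  simp [circlePt, Complex.exp_two_pi_mul_I]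

theorem gapEnergy_eq (P : Polynomial ℂ) : gapEnergy θ₀ P =
    (2 * Real.pi)⁻¹ * ∫ θ in θ₀..(2 * Real.pi - θ₀), ‖P.eval (circlePt θ)‖ ^ 2 := by
  rw [← gapMean_eq θ₀ (continuous_norm_sq_eval P)
    fun θ => by simp only [circlePt_periodic θ]]
  simp only [gapEnergy, energy]
  ring

theorem gapInner_eq (P R : Polynomial ℂ) : gapInner θ₀ P R = (2 * Real.pi : ℂ)⁻¹ *
    ∫ θ in θ₀..(2 * Real.pi - θ₀), P.eval (circlePt θ) * (starRingEnd ℂ) (R.eval (circlePt θ)) := by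
  rw [← gapMean_eq θ₀ (continuous_mul_conj_eval P R)
    fun θ => by simp only [circlePt_periodic θ]]
  simp only [gapInner, symbolInner, symbolMean]
  push_cast
  ring

theorem gapEnergy_nonneg (h1 : θ₀ ≤ Real.pi) (P : Polynomial ℂ) : 0 ≤ gapEnergy θ₀ P := by
  rw [gapEnergy_eq]
  have := Real.pi_pos
  have : 0 ≤ ∫ θ in θ₀..(2 * Real.pi - θ₀), ‖P.eval (circlePt θ)‖ ^ 2 :=
    intervalIntegral.integral_nonneg (by linarith) fun _ _ => by positivity
  positivity

theorem energy_zero_nonneg (h0 : 0 ≤ θ₀) (P : Polynomial ℂ) : 0 ≤ energy θ₀ 0 P := by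
  rw [energy_zero]
  have := Real.pi_pos
  have : 0 ≤ ∫ θ in (-θ₀)..θ₀, ‖P.eval (circlePt θ)‖ ^ 2 :=
    intervalIntegral.integral_nonneg (by linarith) fun _ _ => by positivity
  positivity

theorem energy_zero_le (h1 : θ₀ ≤ Real.pi) (hs : 0 ≤ s) (P : Polynomial ℂ) :
    energy θ₀ 0 P ≤ energy θ₀ s P := by
  rw [energy_eq (s := s)]
  have := gapEnergy_nonneg h1 P
  nlinarith

theorem energy_nonneg (h0 : 0 ≤ θ₀) (h1 : θ₀ ≤ Real.pi) (hs : 0 ≤ s) (P : Polynomial ℂ) :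
    0 ≤ energy θ₀ s P :=
  (energy_zero_nonneg h0 P).trans (energy_zero_le h1 hs P)

theorem energy_zero_pos (h0 : 0 < θ₀) (h1 : θ₀ ≤ Real.pi) {P : Polynomial ℂ} (hP : P ≠ 0) :
    0 < energy θ₀ 0 P := by
  rw [energy_zero]
  have hpi := Real.pi_pos
  refine mul_pos (by positivity) ?_
  refine intervalIntegral.integral_pos (by linarith) (continuous_norm_sq_eval P).continuousOn
    (fun _ _ => by positivity) ?_
  by_contra! hcon
  apply hP
  refine Polynomial.eq_zero_of_infinite_isRoot P ?_
  have hinj : Set.InjOn circlePt (Set.Icc 0 θ₀) := by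
    intro a ha b hb hab
    have := congrArg Complex.re hab
    rw [circlePt_re, circlePt_re] at this
    exact Real.injOn_cos ⟨ha.1, ha.2.trans h1⟩ ⟨hb.1, hb.2.trans h1⟩ this
  refine ((Set.Icc_infinite h0).image hinj).mono ?_
  rintro _ ⟨θ, hθ, rfl⟩
  have := hcon θ ⟨by linarith [hθ.1], hθ.2⟩
  have h2 : ‖P.eval (circlePt θ)‖ ^ 2 = 0 := le_antisymm this (by positivity)
  simpa using h2

/-- Cauchy–Schwarz inequality over the gap, in the form with a free weight `a`. -/
theorem norm_gapInner_le (h1 : θ₀ ≤ Real.pi) (P R : Polynomial ℂ) {a : ℝ} (ha : 0 < a) :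
    ‖gapInner θ₀ P R‖ ≤ (a * gapEnergy θ₀ P + a⁻¹ * gapEnergy θ₀ R) / 2 := by
  have hpi := Real.pi_pos
  rw [gapInner_eq, gapEnergy_eq, gapEnergy_eq, norm_mul]
  have e : ‖(2 * Real.pi : ℂ)⁻¹‖ = (2 * Real.pi)⁻¹ := by
    rw [norm_inv, norm_mul, Complex.norm_ofNat, Complex.norm_real, Real.norm_eq_abs,
      abs_of_pos hpi]
  have hb : ‖∫ θ in θ₀..(2 * Real.pi - θ₀),
      P.eval (circlePt θ) * (starRingEnd ℂ) (R.eval (circlePt θ))‖ ≤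
      ∫ θ in θ₀..(2 * Real.pi - θ₀), (a / 2 * ‖P.eval (circlePt θ)‖ ^ 2 +
        a⁻¹ / 2 * ‖R.eval (circlePt θ)‖ ^ 2) := by
    refine intervalIntegral.norm_integral_le_of_norm_le (by linarith)
      (MeasureTheory.ae_of_all _ fun θ _ => ?_)
      (Continuous.intervalIntegrable (((continuous_norm_sq_eval P).const_mul _).add
        ((continuous_norm_sq_eval R).const_mul _)) _ _)
    rw [norm_mul, RCLike.norm_conj]
    set x := ‖P.eval (circlePt θ)‖
    set y := ‖R.eval (circlePt θ)‖
    have : 0 ≤ a⁻¹ * (a * x - y) ^ 2 := by positivity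
    have h2 : a⁻¹ * (a * x - y) ^ 2 = a * x ^ 2 - 2 * (x * y) + a⁻¹ * y ^ 2 := by
      field_simp
      ring
    linarith
  rw [intervalIntegral.integral_add, intervalIntegral.integral_const_mul,
    intervalIntegral.integral_const_mul] at hb
  · rw [e]
    refine (mul_le_mul_of_nonneg_left hb (by positivity)).trans (le_of_eq ?_)
    ring
  · exact ((continuous_norm_sq_eval P).const_mul _).intervalIntegrable _ _
  · exact ((continuous_norm_sq_eval R).const_mul _).intervalIntegrable _ _

theorem symbolInner_eq_zero_of_moments {n : ℕ} {P R : Polynomial ℂ}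
    (hP : ∀ k < n, (symbolMean θ₀ s fun θ => P.eval (circlePt θ) * circlePt θ ^ (-(k : ℤ))) = 0)
    (hR : R.degree < (n : WithBot ℕ)) : symbolInner θ₀ s P R = 0 := by
  by_cases h0 : R = 0
  · simp [h0, symbolInner, symbolMean]
  have hd : R.natDegree < n := (Polynomial.natDegree_lt_iff_degree_lt h0).2 hR
  have h : (fun θ => P.eval (circlePt θ) * (starRingEnd ℂ) (R.eval (circlePt θ))) = fun θ =>
      ∑ k ∈ Finset.range n, (starRingEnd ℂ) (R.coeff k) *
        (P.eval (circlePt θ) * circlePt θ ^ (-(k : ℤ))) := by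
    funext θ
    rw [Polynomial.eval_eq_sum_range' hd, map_sum, Finset.mul_sum]
    refine Finset.sum_congr rfl fun k _ => ?_
    rw [map_mul, map_pow, star_circlePt, circlePt_neg, zpow_neg, zpow_natCast, inv_pow]
    ring
  rw [symbolInner, h, symbolMean_sum]
  · refine Finset.sum_eq_zero fun k hk => ?_
    rw [symbolMean_const_mul, hP k (Finset.mem_range.1 hk), mul_zero]
  · exact fun k => continuous_const.mul
      ((continuous_eval_circlePt P).mul (continuous_circlePt_zpow _))

/-- The moment problem for polynomials of degree less than `n` is solvable, because the symbol is
a positive weight. -/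
theorem exists_polynomial_moments (h0 : 0 < θ₀) (h1 : θ₀ ≤ Real.pi) (hs : 0 ≤ s) (n : ℕ)
    (y : ℕ → ℂ) : ∃ q : Polynomial ℂ, q.degree < (n : WithBot ℕ) ∧ ∀ k < n,
      (symbolMean θ₀ s fun θ => q.eval (circlePt θ) * circlePt θ ^ (-(k : ℤ))) = y k := by
  have hc : ∀ (q : Polynomial ℂ) (k : ℕ),
      Continuous fun θ => q.eval (circlePt θ) * circlePt θ ^ (-(k : ℤ)) := fun q k =>
    (continuous_eval_circlePt q).mul (continuous_circlePt_zpow _)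
  let T : Polynomial.degreeLT ℂ n →ₗ[ℂ] (Fin n → ℂ) :=
    { toFun := fun q k => symbolMean θ₀ s fun θ =>
        (q : Polynomial ℂ).eval (circlePt θ) * circlePt θ ^ (-((k : ℕ) : ℤ))
      map_add' := by
        intro p q
        funext k
        simp only [Submodule.coe_add, Polynomial.eval_add, add_mul, Pi.add_apply]
        exact symbolMean_add _ _ (hc _ _) (hc _ _)
      map_smul' := by
        intro c q
        funext k
        simp only [SetLike.val_smul, Polynomial.eval_smul, smul_eq_mul, mul_assoc,
          RingHom.id_apply, Pi.smul_apply]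
        exact symbolMean_const_mul _ _ _ _ }
  have hinj : Function.Injective T := by
    rw [← LinearMap.ker_eq_bot, LinearMap.ker_eq_bot']
    rintro ⟨q, hq⟩ hT
    have hq' := Polynomial.mem_degreeLT.1 hq
    have hm : ∀ k < n,
        (symbolMean θ₀ s fun θ => q.eval (circlePt θ) * circlePt θ ^ (-(k : ℤ))) = 0 :=
      fun k hk => congrFun hT ⟨k, hk⟩
    have h2 := symbolInner_eq_zero_of_moments hm hq'
    rw [symbolInner_self] at h2
    have h3 : energy θ₀ s q = 0 := by exact_mod_cast h2
    by_contra hne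
    have hq0 : q ≠ 0 := fun h => hne (by ext1; exact h)
    have := energy_zero_pos h0 h1 hq0
    have := energy_zero_le h1 hs q
    linarith
  have hsurj : Function.Surjective T := by
    refine (LinearMap.injective_iff_surjective_of_finrank_eq_finrank ?_).1 hinj
    rw [(Polynomial.degreeLTEquiv ℂ n).finrank_eq]
  have hfin := hsurj fun k => y k
  obtain ⟨⟨q, hq⟩, hqT⟩ := hfin
  exact ⟨q, Polynomial.mem_degreeLT.1 hq, fun k hk => congrFun hqT ⟨k, hk⟩⟩

theorem exists_isMonicOrthogonal (h0 : 0 < θ₀) (h1 : θ₀ ≤ Real.pi) (hs : 0 ≤ s) (n : ℕ) :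
    ∃ Φ, IsMonicOrthogonal θ₀ s n Φ := by
  obtain ⟨q, hq, hqm⟩ := exists_polynomial_moments h0 h1 hs n fun k =>
    -symbolMean θ₀ s fun θ => circlePt θ ^ (n : ℤ) * circlePt θ ^ (-(k : ℤ))
  refine ⟨Polynomial.X ^ n + q, by simpa using hq, fun k hk => ?_⟩
  have := hqm k hk
  simp only [Polynomial.eval_add, Polynomial.eval_pow, Polynomial.eval_X, add_mul]
  rw [symbolMean_add, this]
  · simp
  · exact (continuous_circlePt.pow n).mul (continuous_circlePt_zpow _)
  · exact (continuous_eval_circlePt q).mul (continuous_circlePt_zpow _)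

end

namespace IsMonicOrthogonal
variable {θ₀ s : ℝ} {n : ℕ} {Φ : Polynomial ℂ}

theorem inner_eq_zero (h : IsMonicOrthogonal θ₀ s n Φ) {R : Polynomial ℂ}
    (hR : R.degree < (n : WithBot ℕ)) : symbolInner θ₀ s Φ R = 0 :=
  symbolInner_eq_zero_of_moments h.moments hR

theorem inner_monic (h : IsMonicOrthogonal θ₀ s n Φ) {P : Polynomial ℂ}
    (hP : (P - Polynomial.X ^ n).degree < (n : WithBot ℕ)) :
    symbolInner θ₀ s Φ P = (energy θ₀ s Φ : ℂ) := by
  have h2 : (Φ - P).degree < (n : WithBot ℕ) := by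
    have : Φ - P = (Φ - Polynomial.X ^ n) - (P - Polynomial.X ^ n) := by ring
    rw [this]
    exact (Polynomial.degree_sub_le _ _).trans_lt (max_lt h.degree_sub hP)
  have := h.inner_eq_zero h2
  rw [symbolInner_sub_right, symbolInner_self, sub_eq_zero] at this
  exact this.symm

/-- Pythagoras: the monic orthogonal polynomial has the least norm. -/
theorem energy_sub (h : IsMonicOrthogonal θ₀ s n Φ) {P : Polynomial ℂ}
    (hP : (P - Polynomial.X ^ n).degree < (n : WithBot ℕ)) :
    energy θ₀ s (Φ - P) = energy θ₀ s P - energy θ₀ s Φ := by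
  have e1 := h.inner_monic hP
  have e2 : symbolInner θ₀ s P Φ = (energy θ₀ s Φ : ℂ) := by
    rw [← symbolInner_conj, e1, Complex.conj_ofReal]
  have : (energy θ₀ s (Φ - P) : ℂ) = (energy θ₀ s P - energy θ₀ s Φ : ℝ) := by
    rw [← symbolInner_self, symbolInner_sub_left, symbolInner_sub_right, symbolInner_sub_right,
      e1, e2, symbolInner_self, symbolInner_self]
    push_cast
    ring
  exact_mod_cast this

theorem energy_le (h : IsMonicOrthogonal θ₀ s n Φ) (h0 : 0 ≤ θ₀) (h1 : θ₀ ≤ Real.pi)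
    (hs : 0 ≤ s) {P : Polynomial ℂ} (hP : (P - Polynomial.X ^ n).degree < (n : WithBot ℕ)) :
    energy θ₀ s Φ ≤ energy θ₀ s P := by
  have := energy_nonneg h0 h1 hs (Φ - P)
  rw [h.energy_sub hP] at this
  linarith

theorem monic (h : IsMonicOrthogonal θ₀ s n Φ) : Φ.Monic := by
  have : Φ = Polynomial.X ^ n + (Φ - Polynomial.X ^ n) := by ring
  rw [this]
  exact Polynomial.monic_X_pow_add h.degree_sub

theorem natDegree_eq (h : IsMonicOrthogonal θ₀ s n Φ) : Φ.natDegree = n := by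
  have : Φ = Polynomial.X ^ n + (Φ - Polynomial.X ^ n) := by ring
  rw [this]
  refine Polynomial.natDegree_eq_of_degree_eq_some ?_
  rw [Polynomial.degree_add_eq_left_of_degree_lt] <;> rw [Polynomial.degree_X_pow]
  exact h.degree_sub

theorem cauchyTransform_zero (h : IsMonicOrthogonal θ₀ s n Φ) :
    cauchyTransform θ₀ s n Φ 0 = (energy θ₀ s Φ : ℂ) := by
  rw [← h.inner_monic (P := Polynomial.X ^ n) (by simp), cauchyTransform,
    symbolInner]
  congr 1
  funext θ
  have := circlePt_ne_zero θ
  rw [sub_zero, mul_div_assoc, div_self this, mul_one, Polynomial.eval_pow, Polynomial.eval_X,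
    map_pow, star_circlePt, circlePt_neg, zpow_neg, zpow_natCast, inv_pow]

/-- The exact difference of the norms of two monic orthogonal polynomials for different values of
the parameter. -/
theorem energy_sub_energy {t : ℝ} {Ψ : Polynomial ℂ} (h : IsMonicOrthogonal θ₀ s n Φ)
    (h' : IsMonicOrthogonal θ₀ t n Ψ) :
    (energy θ₀ t Ψ - energy θ₀ s Φ : ℂ) = (t - s) * gapInner θ₀ Ψ Φ := by
  rw [← symbolInner_affine (s := s) Ψ Φ t, h'.inner_monic h.degree_sub,
    ← symbolInner_conj Φ Ψ, h.inner_monic h'.degree_sub, Complex.conj_ofReal]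

end IsMonicOrthogonal

/-! ### Dependence on the parameter and the value at the endpoint -/

theorem gapInner_sub_left (θ₀ : ℝ) (P Q R : Polynomial ℂ) :
    gapInner θ₀ (P - Q) R = gapInner θ₀ P R - gapInner θ₀ Q R := by
  simp only [gapInner, symbolInner_sub_left]; ring

theorem gapInner_self (θ₀ : ℝ) (P : Polynomial ℂ) :
    gapInner θ₀ P P = (gapEnergy θ₀ P : ℂ) := by
  simp only [gapInner, symbolInner_self, gapEnergy]; push_cast; ring

/-- A bounded factor does not increase the mean of `|P|²`. -/
theorem norm_symbolMean_mul_le {θ₀ s : ℝ} (h0 : 0 ≤ θ₀) (hs : 0 ≤ s) (hs1 : s ≤ 1) {u : ℝ → ℂ}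
    (hu : ∀ θ, ‖u θ‖ ≤ 1) (P : Polynomial ℂ) :
    ‖symbolMean θ₀ s fun θ => u θ * (P.eval (circlePt θ) *
      (starRingEnd ℂ) (P.eval (circlePt θ)))‖ ≤ energy θ₀ s P := by
  have hpi := Real.pi_pos
  have e : ‖(2 * Real.pi : ℂ)⁻¹‖ = (2 * Real.pi)⁻¹ := by
    rw [norm_inv, norm_mul, Complex.norm_ofNat, Complex.norm_real, Real.norm_eq_abs,
      abs_of_pos hpi]
  have hb : ∀ a b : ℝ, a ≤ b → ‖∫ θ in a..b, u θ * (P.eval (circlePt θ) *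
      (starRingEnd ℂ) (P.eval (circlePt θ)))‖ ≤ ∫ θ in a..b, ‖P.eval (circlePt θ)‖ ^ 2 := by
    intro a b hab
    refine intervalIntegral.norm_integral_le_of_norm_le hab
      (MeasureTheory.ae_of_all _ fun θ _ => ?_)
      ((continuous_norm_sq_eval P).intervalIntegrable _ _)
    rw [norm_mul, norm_mul, RCLike.norm_conj, ← sq]
    exact mul_le_of_le_one_left (by positivity) (hu θ)
  have hs' : ‖(1 - s : ℂ)‖ = 1 - s := by
    rw [← Complex.ofReal_one, ← Complex.ofReal_sub, Complex.norm_real, Real.norm_eq_abs,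
      abs_of_nonneg (by linarith)]
  rw [symbolMean, energy, norm_mul, e]
  refine mul_le_mul_of_nonneg_left ((norm_add_le _ _).trans ?_) (by positivity)
  rw [norm_mul, norm_mul, hs', Complex.norm_real, Real.norm_eq_abs, abs_of_nonneg hs]
  have := sub_nonneg.2 hs1
  have b1 := hb (-Real.pi) Real.pi (by linarith)
  have b2 := hb (-θ₀) θ₀ (by linarith)
  gcongr

theorem norm_symbolInner_X_mul_le {θ₀ s : ℝ} (h0 : 0 ≤ θ₀) (hs : 0 ≤ s) (hs1 : s ≤ 1)
    (P : Polynomial ℂ) : ‖symbolInner θ₀ s (Polynomial.X * P) P‖ ≤ energy θ₀ s P := by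
  have := norm_symbolMean_mul_le h0 hs hs1 (u := circlePt) (fun θ => (norm_circlePt θ).le) P
  simpa only [symbolInner, Polynomial.eval_mul, Polynomial.eval_X, mul_assoc] using this

namespace IsMonicOrthogonal
variable {θ₀ s : ℝ} {n : ℕ} {Φ : Polynomial ℂ}

/-- The remainder of the first order expansion of the minimal norm in the parameter. The difference
`D` of the two polynomials satisfies `energy D ≤ |t - s| |⟨D, Φ⟩|` by Pythagoras, where the inner
product is over the gap; with `hgap` and the Cauchy–Schwarz inequality `D` is of order `t - s`. -/
theorem abs_energy_sub_energy_sub_le (h : IsMonicOrthogonal θ₀ s n Φ) (h1 : θ₀ ≤ Real.pi)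
    {K : ℝ} (hK : 0 ≤ K)
    (hgap : ∀ P : Polynomial ℂ, P.natDegree ≤ n → gapEnergy θ₀ P ≤ K * energy θ₀ 0 P)
    {t : ℝ} (ht : 0 ≤ t) {Ψ : Polynomial ℂ} (h' : IsMonicOrthogonal θ₀ t n Ψ) :
    |energy θ₀ t Ψ - energy θ₀ s Φ - (t - s) * gapEnergy θ₀ Φ| ≤
      (K + 1) * gapEnergy θ₀ Φ * (t - s) ^ 2 := by
  set g := gapEnergy θ₀ Φ with hg
  set D := Ψ - Φ with hD
  have hg0 : 0 ≤ g := gapEnergy_nonneg h1 Φ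
  have hd0 : 0 ≤ gapEnergy θ₀ D := gapEnergy_nonneg h1 D
  set x := ‖gapInner θ₀ D Φ‖ with hx
  -- the left-hand side in terms of the difference of the two polynomials
  have e1 : ((energy θ₀ t Ψ - energy θ₀ s Φ - (t - s) * g : ℝ) : ℂ) =
      (t - s) * gapInner θ₀ D Φ := by
    have := h.energy_sub_energy h'
    push_cast
    rw [this, hD, gapInner_sub_left, gapInner_self, hg]
    ring
  have e2 : |energy θ₀ t Ψ - energy θ₀ s Φ - (t - s) * g| = |t - s| * x := by
    rw [← Real.norm_eq_abs, ← Complex.norm_real, e1, norm_mul, ← Complex.ofReal_sub,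
      Complex.norm_real, Real.norm_eq_abs]
  have hDdeg : D.natDegree ≤ n :=
    (Polynomial.natDegree_sub_le _ _).trans (max_le h'.natDegree_eq.le h.natDegree_eq.le)
  have hdx : gapEnergy θ₀ D ≤ K * (|t - s| * x) := by
    refine (hgap D hDdeg).trans (mul_le_mul_of_nonneg_left ?_ hK)
    have h3 := energy_zero_le h1 ht D
    have h4 := h'.energy_sub h.degree_sub
    have h5 := energy_affine (θ₀ := θ₀) (s := s) Φ t
    have h6 := neg_abs_le (energy θ₀ t Ψ - energy θ₀ s Φ - (t - s) * g)
    rw [e2] at h6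
    rw [← hD] at h4
    linarith
  rw [e2]
  by_cases hts : t = s
  · simp [hts]
  have hτ : 0 < |t - s| := abs_pos.2 (sub_ne_zero.2 hts)
  -- this weight allows the term with `gapEnergy D` to be absorbed
  have ha : 0 < ((K + 1) * |t - s|)⁻¹ := by positivity
  have hcs := norm_gapInner_le h1 D Φ ha
  rw [inv_inv, ← hx, ← hg] at hcs
  have h7 : ((K + 1) * |t - s|)⁻¹ * gapEnergy θ₀ D ≤ x := by
    rw [inv_mul_le_iff₀ (by positivity)]
    have : 0 ≤ |t - s| * x := by positivity
    linarith
  have h8 : x ≤ (K + 1) * |t - s| * g := by linarith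
  calc |t - s| * x ≤ |t - s| * ((K + 1) * |t - s| * g) := by gcongr
    _ = (K + 1) * g * (t - s) ^ 2 := by rw [← sq_abs (t - s)]; ring

/-- The derivative of the minimal norm in the parameter is the norm over the gap. -/
theorem hasDerivWithinAt_energy {Φ : ℝ → Polynomial ℂ} {S : Set ℝ} (hS : ∀ t ∈ S, 0 ≤ t)
    (h : ∀ t ∈ S, IsMonicOrthogonal θ₀ t n (Φ t)) (h1 : θ₀ ≤ Real.pi) {K : ℝ} (hK : 0 ≤ K)
    (hgap : ∀ P : Polynomial ℂ, P.natDegree ≤ n → gapEnergy θ₀ P ≤ K * energy θ₀ 0 P)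
    (hs : s ∈ S) :
    HasDerivWithinAt (fun t => energy θ₀ t (Φ t)) (gapEnergy θ₀ (Φ s)) S s := by
  rw [hasDerivWithinAt_iff_isLittleO]
  have hO : (fun t => energy θ₀ t (Φ t) - energy θ₀ s (Φ s) - (t - s) • gapEnergy θ₀ (Φ s))
      =O[𝓝[S] s] fun t => (t - s) ^ 2 := by
    refine IsBigO.of_bound ((K + 1) * gapEnergy θ₀ (Φ s)) ?_
    filter_upwards [self_mem_nhdsWithin] with t ht
    have := (h s hs).abs_energy_sub_energy_sub_le h1 hK hgap (hS t ht) (h t ht)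
    rw [Real.norm_eq_abs, Real.norm_eq_abs, abs_of_nonneg (sq_nonneg (t - s)), smul_eq_mul]
    exact this
  refine hO.trans_isLittleO ?_
  have h2 : (fun t : ℝ => (t - s) ^ 2) =o[𝓝 s] fun t => t - s := by
    have h3 : Tendsto (fun t : ℝ => t - s) (𝓝 s) (𝓝 0) := by
      have := (by fun_prop : Continuous fun t : ℝ => t - s).tendsto s
      simpa using this
    have h4 := (isLittleO_one_iff ℝ).2 h3
    have := h4.mul_isBigO (isBigO_refl (fun t : ℝ => t - s) (𝓝 s))
    simpa [sq] using this
  exact h2.mono nhdsWithin_le_nhds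

/-- The roots of an orthogonal polynomial lie in the closed unit disc: if `Φ = (z - a) q`, then
orthogonality of `Φ` to `q` gives `a ⟨q, q⟩ = ⟨z q, q⟩`. -/
theorem norm_root_le_one (h : IsMonicOrthogonal θ₀ s n Φ) (h0 : 0 < θ₀) (h1 : θ₀ ≤ Real.pi)
    (hs : 0 ≤ s) (hs1 : s ≤ 1) {a : ℂ} (ha : Φ.IsRoot a) : ‖a‖ ≤ 1 := by
  obtain ⟨q, hq⟩ := Polynomial.dvd_iff_isRoot.2 ha
  have hΦ0 : Φ ≠ 0 := h.monic.ne_zero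
  have hq0 : q ≠ 0 := by rintro rfl; exact hΦ0 (by rw [hq, mul_zero])
  have hqd : q.degree < (n : WithBot ℕ) := by
    have := h.natDegree_eq
    rw [hq, Polynomial.natDegree_mul (Polynomial.X_sub_C_ne_zero a) hq0,
      Polynomial.natDegree_X_sub_C] at this
    exact (Polynomial.natDegree_lt_iff_degree_lt hq0).1 (by omega)
  have h2 := h.inner_eq_zero hqd
  have h3 : Φ = Polynomial.X * q - Polynomial.C a * q := by rw [hq]; ring
  rw [h3, symbolInner_sub_left, symbolInner_C_mul_left, symbolInner_self, sub_eq_zero] at h2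
  have hpos := (energy_zero_pos h0 h1 hq0).trans_le (energy_zero_le h1 hs q)
  have h4 : ‖symbolInner θ₀ s (Polynomial.X * q) q‖ ≤ energy θ₀ s q :=
    norm_symbolInner_X_mul_le h0.le hs hs1 q
  rw [h2, norm_mul, Complex.norm_real, Real.norm_eq_abs, abs_of_pos hpos] at h4
  exact le_of_mul_le_mul_right (by linarith) hpos

/-- The second coefficient is minus the sum of the roots. -/
theorem norm_coeff_pred_le (h : IsMonicOrthogonal θ₀ s n Φ) (h0 : 0 < θ₀) (h1 : θ₀ ≤ Real.pi)
    (hs : 0 ≤ s) (hs1 : s ≤ 1) (hn : 0 < n) : ‖Φ.coeff (n - 1)‖ ≤ n := by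
  have hsplit : Φ.Splits := IsAlgClosed.splits Φ
  have h2 := hsplit.nextCoeff_eq_neg_sum_roots_of_monic h.monic
  rw [Polynomial.nextCoeff_of_natDegree_pos (by rw [h.natDegree_eq]; exact hn),
    h.natDegree_eq] at h2
  rw [h2, norm_neg]
  refine (norm_multiset_sum_le _).trans ?_
  have h3 := Multiset.sum_le_card_nsmul (Φ.roots.map fun a => ‖a‖) 1 (by
    intro x hx
    obtain ⟨a, ha, rfl⟩ := Multiset.mem_map.1 hx
    exact h.norm_root_le_one h0 h1 hs hs1 (Polynomial.isRoot_of_mem_roots ha))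
  refine h3.trans ?_
  rw [nsmul_eq_mul, mul_one, Multiset.card_map]
  have := Polynomial.card_roots' Φ
  rw [h.natDegree_eq] at this
  exact_mod_cast this

/-- In `(z ^ 2 - 1) dΦ/dz` the two leading powers can be removed by multiples of `z Φ` and `Φ`. -/
theorem degree_derivative_comb_lt (h : IsMonicOrthogonal θ₀ s n Φ) (hn : 0 < n) :
    ((Polynomial.X ^ 2 - 1) * Polynomial.derivative Φ - Polynomial.C (n : ℂ) * (Polynomial.X * Φ) +
      Polynomial.C (Φ.coeff (n - 1)) * Φ).degree < (n : WithBot ℕ) := by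
  rw [Polynomial.degree_lt_iff_coeff_zero]
  intro m hm
  have hz : ∀ k, n < k → Φ.coeff k = 0 := fun k hk =>
    Polynomial.coeff_eq_zero_of_natDegree_lt (by rw [h.natDegree_eq]; exact hk)
  have h1 : Φ.coeff n = 1 := by
    have := h.monic.coeff_natDegree
    rwa [h.natDegree_eq] at this
  rw [Polynomial.coeff_add, Polynomial.coeff_sub, sub_mul, one_mul, Polynomial.coeff_sub,
    Polynomial.coeff_C_mul, Polynomial.coeff_C_mul, Polynomial.coeff_derivative, hz (m + 1) (by omega)]
  obtain ⟨k, rfl⟩ : ∃ k, m = k + 1 := ⟨m - 1, by omega⟩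
  rw [Polynomial.coeff_X_mul, sq, mul_assoc, Polynomial.coeff_X_mul]
  have h2 : (Polynomial.X * Polynomial.derivative Φ).coeff k = k * Φ.coeff k := by
    rcases k with _ | j
    · simp
    · rw [Polynomial.coeff_X_mul, Polynomial.coeff_derivative]
      push_cast; ring
  rw [h2]
  rcases Nat.lt_or_ge n (k + 1) with hk | hk
  · rcases Nat.lt_or_ge n k with hk' | hk'
    · rw [hz k hk', hz (k + 1) hk]; ring
    · have : k = n := by omega
      subst this
      rw [hz (k + 1) hk]; ring
  · have : n = k + 1 := by omega
    subst this
    rw [h1, Nat.add_sub_cancel]; push_cast; ring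

/-- Integrating the derivative of `sin θ |Φ|²` bounds the value at the endpoint of the arc. The
factor `sin θ` vanishes at `θ = ±π`, so only the jump of the weight at `±θ₀` contributes, and it
makes `sin θ ∂_θ` a polynomial operation on `Φ`, up to the degree `n + 1`. -/
theorem sq_norm_eval_arcEnd_le (h : IsMonicOrthogonal θ₀ s n Φ) (h0 : 0 < θ₀) (h1 : θ₀ ≤ Real.pi)
    (hs : 0 ≤ s) (hs1 : s ≤ 1) (hn : 0 < n) :
    (1 - s) * Real.sin θ₀ * ‖Φ.eval (circlePt θ₀)‖ ^ 2 ≤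
      2 * Real.pi * ((2 * n + 1) * energy θ₀ s Φ) := by
  have hpi := Real.pi_pos
  set A : Polynomial ℂ := (Polynomial.X ^ 2 - 1) * Polynomial.derivative Φ with hA
  set φ : ℝ → ℂ := fun θ => Φ.eval (circlePt θ) with hφ
  set ν : ℝ → ℂ := fun θ => (Real.sin θ : ℂ) * (φ θ * (starRingEnd ℂ) (φ θ)) with hν
  set ν' : ℝ → ℂ := fun θ => (Real.cos θ : ℂ) * (φ θ * (starRingEnd ℂ) (φ θ)) +
    2⁻¹ * (A.eval (circlePt θ) * (starRingEnd ℂ) (φ θ) +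
      φ θ * (starRingEnd ℂ) (A.eval (circlePt θ))) with hν'
  have hd : ∀ θ, HasDerivAt ν (ν' θ) θ := by
    intro θ
    have d1 : HasDerivAt φ ((Polynomial.derivative Φ).eval (circlePt θ) *
        (Complex.I * circlePt θ)) θ :=
      (Φ.hasDerivAt (circlePt θ)).comp θ (hasDerivAt_circlePt θ)
    have d2 := d1.star
    have d3 : HasDerivAt (fun θ : ℝ => (Real.sin θ : ℂ)) (Real.cos θ : ℂ) θ :=
      (Real.hasDerivAt_sin θ).ofReal_comp
    refine (d3.mul (d1.mul d2)).congr_deriv ?_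
    simp only [hν', hA, hφ, Polynomial.eval_mul, Polynomial.eval_sub, Polynomial.eval_pow,
      Polynomial.eval_X, Polynomial.eval_one]
    -- `i e^{iθ} sin θ = (e^{2iθ} - 1) / 2`
    have key : (Real.sin θ : ℂ) * (Complex.I * circlePt θ) = 2⁻¹ * (circlePt θ ^ 2 - 1) := by
      have e1 : circlePt θ = Real.cos θ + Real.sin θ * Complex.I := by
        simp [circlePt, Complex.exp_mul_I]
      have e2 : (Real.sin θ : ℂ) ^ 2 + (Real.cos θ : ℂ) ^ 2 = 1 := by
        exact_mod_cast Real.sin_sq_add_cos_sq θ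
      rw [e1]
      linear_combination (Real.sin θ : ℂ) ^ 2 / 2 * Complex.I_sq - 1 / 2 * e2
    have key2 := congrArg (starRingEnd ℂ) key
    simp only [map_mul, Complex.conj_ofReal] at key2
    change (Real.cos θ : ℂ) * (Φ.eval (circlePt θ) * (starRingEnd ℂ) (Φ.eval (circlePt θ))) +
      (Real.sin θ : ℂ) * (_ * (starRingEnd ℂ) _ + _ * (starRingEnd ℂ) _) = _
    simp only [map_mul]
    simp only [map_inv₀, map_ofNat] at key2
    linear_combination ((Polynomial.derivative Φ).eval (circlePt θ) *
      (starRingEnd ℂ) (Φ.eval (circlePt θ))) * key + (Φ.eval (circlePt θ) *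
      (starRingEnd ℂ) ((Polynomial.derivative Φ).eval (circlePt θ))) * key2
  have hφc : Continuous φ := continuous_eval_circlePt Φ
  have hc1 : Continuous fun θ : ℝ => (Real.cos θ : ℂ) * (φ θ * (starRingEnd ℂ) (φ θ)) :=
    (Complex.continuous_ofReal.comp Real.continuous_cos).mul (continuous_mul_conj_eval Φ Φ)
  have hc2 := continuous_mul_conj_eval A Φ
  have hc3 := continuous_mul_conj_eval Φ A
  have hc23 : Continuous fun θ => A.eval (circlePt θ) * (starRingEnd ℂ) (φ θ) +
      φ θ * (starRingEnd ℂ) (A.eval (circlePt θ)) := hc2.add hc3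
  have hν'c : Continuous ν' := hc1.add (hc23.const_mul _)
  have hint : ∀ a b : ℝ, (∫ θ in a..b, ν' θ) = ν b - ν a := fun a b =>
    intervalIntegral.integral_eq_sub_of_hasDerivAt (fun θ _ => hd θ)
      (hν'c.intervalIntegrable _ _)
  have hmean : symbolMean θ₀ s ν' = (((2 * Real.pi)⁻¹ * ((1 - s) * (Real.sin θ₀ *
      (‖φ θ₀‖ ^ 2 + ‖φ (-θ₀)‖ ^ 2))) : ℝ) : ℂ) := by
    rw [symbolMean, hint, hint]
    simp only [hν, Complex.mul_conj, Complex.normSq_eq_norm_sq, Real.sin_neg, Real.sin_pi]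
    push_cast
    ring
  have hmean2 : symbolMean θ₀ s ν' = (symbolMean θ₀ s fun θ => (Real.cos θ : ℂ) *
      (φ θ * (starRingEnd ℂ) (φ θ))) +
      2⁻¹ * (symbolInner θ₀ s A Φ + symbolInner θ₀ s Φ A) := by
    simp only [hν']
    rw [symbolMean_add _ _ hc1 (hc23.const_mul _), symbolMean_const_mul,
      symbolMean_add _ _ hc2 hc3]
    rfl
  set E := energy θ₀ s Φ with hE
  have hE0 : 0 ≤ E := energy_nonneg h0.le h1 hs Φ
  have b1 : ‖symbolMean θ₀ s fun θ => (Real.cos θ : ℂ) * (φ θ * (starRingEnd ℂ) (φ θ))‖ ≤ E :=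
    norm_symbolMean_mul_le h0.le hs hs1 (fun θ => by
      rw [Complex.norm_real, Real.norm_eq_abs]; exact Real.abs_cos_le_one θ) Φ
  have b2 : ‖symbolInner θ₀ s A Φ‖ ≤ 2 * n * E := by
    have h2 := h.inner_eq_zero (h.degree_derivative_comb_lt hn)
    have h3 : symbolInner θ₀ s A Φ = n * symbolInner θ₀ s (Polynomial.X * Φ) Φ -
        Φ.coeff (n - 1) * E := by
      have h4 := congrArg (starRingEnd ℂ) h2
      rw [symbolInner_conj, map_zero, symbolInner_add_left, symbolInner_sub_left,
        symbolInner_C_mul_left, symbolInner_C_mul_left, symbolInner_self] at h4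
      linear_combination h4
    rw [h3]
    refine (norm_sub_le _ _).trans ?_
    rw [norm_mul, norm_mul, Complex.norm_natCast, Complex.norm_real, Real.norm_eq_abs,
      abs_of_nonneg hE0]
    have h5 := norm_symbolInner_X_mul_le h0.le hs hs1 Φ
    have h6 := h.norm_coeff_pred_le h0 h1 hs hs1 hn
    calc _ ≤ (n : ℝ) * E + n * E := by gcongr
      _ = _ := by ring
  have b3 : ‖symbolInner θ₀ s Φ A‖ ≤ 2 * n * E := by
    rw [← symbolInner_conj, RCLike.norm_conj]; exact b2
  have hfin : ‖symbolMean θ₀ s ν'‖ ≤ (2 * n + 1) * E := by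
    rw [hmean2]
    refine (norm_add_le _ _).trans ?_
    rw [norm_mul]
    have b4 := norm_add_le (symbolInner θ₀ s A Φ) (symbolInner θ₀ s Φ A)
    have e : ‖(2⁻¹ : ℂ)‖ = 2⁻¹ := by simp
    rw [e]
    linarith
  rw [hmean, Complex.norm_real, Real.norm_eq_abs] at hfin
  have h7 := (le_abs_self _).trans hfin
  rw [inv_mul_le_iff₀ (by positivity)] at h7
  have hsin : 0 ≤ Real.sin θ₀ := Real.sin_nonneg_of_nonneg_of_le_pi h0.le h1
  have h8 : 0 ≤ (1 - s) * (Real.sin θ₀ * ‖φ (-θ₀)‖ ^ 2) :=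
    mul_nonneg (by linarith) (by positivity)
  simp only [hφ] at h7 h8 ⊢
  linarith

end IsMonicOrthogonal

/-! ### The parametrization of the arc by the unit circle -/

/-- Half the argument of a point of the arc: `2 * arcAngle ρ φ` runs through the arc of
half-opening `2 arcsin ρ` from its upper to its lower end as `φ` runs from `0` to `π`. -/
noncomputable def arcAngle (ρ φ : ℝ) : ℝ := Real.arcsin (ρ * Real.cos φ)

/-- The point `b` of the unit circle with `b * discAut ρ b = e^{-2iφ}` and
`discAut ρ b / b = e^{iθ}`, where `θ = 2 * arcAngle ρ φ`. -/
noncomputable def discPt (ρ φ : ℝ) : ℂ := circlePt (-(arcAngle ρ φ + φ))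

/-- The automorphism `b ↦ (b + iρ) / (1 - iρb)` of the unit disc. -/
noncomputable def discAut (ρ : ℝ) (b : ℂ) : ℂ := (b + Complex.I * ρ) / (1 - Complex.I * ρ * b)

/-- The density of arc length on the arc with respect to `dφ`, for `0 ≤ φ ≤ π`. -/
noncomputable def arcWeight (ρ φ : ℝ) : ℝ := 2 * ρ * Real.sin φ / Real.cos (arcAngle ρ φ)

section
variable {ρ : ℝ}

theorem abs_mul_cos_lt_one (h0 : 0 < ρ) (h1 : ρ < 1) (φ : ℝ) : |ρ * Real.cos φ| < 1 := by
  rw [abs_mul, abs_of_pos h0]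
  nlinarith [Real.abs_cos_le_one φ, abs_nonneg (Real.cos φ)]

theorem sin_arcAngle (h0 : 0 < ρ) (h1 : ρ < 1) (φ : ℝ) :
    Real.sin (arcAngle ρ φ) = ρ * Real.cos φ := by
  have h := abs_lt.mp (abs_mul_cos_lt_one h0 h1 φ)
  exact Real.sin_arcsin h.1.le h.2.le

theorem cos_sq_arcAngle (h0 : 0 < ρ) (h1 : ρ < 1) (φ : ℝ) :
    Real.cos (arcAngle ρ φ) ^ 2 = 1 - ρ ^ 2 * Real.cos φ ^ 2 := by
  have := Real.sin_sq_add_cos_sq (arcAngle ρ φ)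
  rw [sin_arcAngle h0 h1] at this
  linarith

theorem cos_arcAngle_pos (h0 : 0 < ρ) (h1 : ρ < 1) (φ : ℝ) : 0 < Real.cos (arcAngle ρ φ) := by
  have h := abs_lt.mp (abs_mul_cos_lt_one h0 h1 φ)
  rw [arcAngle, Real.cos_arcsin]
  exact Real.sqrt_pos.mpr (by nlinarith)

theorem arcAngle_neg (ρ φ : ℝ) : arcAngle ρ (-φ) = arcAngle ρ φ := by simp [arcAngle]

theorem continuous_arcAngle (ρ : ℝ) : Continuous (arcAngle ρ) :=
  Real.continuous_arcsin.comp (by fun_prop)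

theorem continuous_arcWeight (h0 : 0 < ρ) (h1 : ρ < 1) : Continuous (arcWeight ρ) :=
  (by fun_prop : Continuous fun φ => 2 * ρ * Real.sin φ).div
    (Real.continuous_cos.comp (continuous_arcAngle ρ)) fun φ => (cos_arcAngle_pos h0 h1 φ).ne'

theorem arcWeight_nonneg (h0 : 0 < ρ) (h1 : ρ < 1) {φ : ℝ} (hφ : 0 ≤ Real.sin φ) :
    0 ≤ arcWeight ρ φ := by
  have := cos_arcAngle_pos h0 h1 φ
  unfold arcWeight; positivity

theorem arcWeight_neg (ρ φ : ℝ) : arcWeight ρ (-φ) = -arcWeight ρ φ := by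
  simp [arcWeight, arcAngle_neg, neg_div]

theorem hasDerivAt_arcAngle (h0 : 0 < ρ) (h1 : ρ < 1) (φ : ℝ) :
    HasDerivAt (arcAngle ρ) (-(arcWeight ρ φ / 2)) φ := by
  have h := abs_lt.mp (abs_mul_cos_lt_one h0 h1 φ)
  have h2 := (Real.hasDerivAt_arcsin h.1.ne' h.2.ne).comp φ
    ((Real.hasDerivAt_cos φ).const_mul ρ)
  refine h2.congr_deriv ?_
  rw [arcWeight, arcAngle, Real.cos_arcsin]
  ring

theorem abs_arcWeight_le (h0 : 0 < ρ) (h1 : ρ < 1) (φ : ℝ) : |arcWeight ρ φ| ≤ 2 := by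
  have hk := cos_arcAngle_pos h0 h1 φ
  rw [arcWeight, abs_div, abs_of_pos hk, div_le_iff₀ hk]
  refine abs_le_of_sq_le_sq ?_ (by positivity)
  have := Real.sin_sq_add_cos_sq φ
  have h2 := cos_sq_arcAngle h0 h1 φ
  nlinarith [h2]

theorem continuous_discPt (ρ : ℝ) : Continuous (discPt ρ) :=
  continuous_circlePt.comp ((continuous_arcAngle ρ).add continuous_id).neg

theorem one_sub_mul_ne_zero (h0 : 0 < ρ) (h1 : ρ < 1) {b : ℂ} (hb : ‖b‖ ≤ 1) :
    1 - Complex.I * ρ * b ≠ 0 := by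
  intro h
  have h2 : ‖Complex.I * ρ * b‖ = 1 := by rw [← sub_eq_zero.mp h]; simp
  rw [norm_mul, norm_mul, Complex.norm_I, Complex.norm_real, Real.norm_eq_abs, abs_of_pos h0] at h2
  nlinarith [norm_nonneg b]

theorem discAut_eq (h0 : 0 < ρ) (h1 : ρ < 1) {b u : ℂ} (hb : ‖b‖ ≤ 1)
    (h : b + Complex.I * ρ = u * (1 - Complex.I * ρ * b)) : discAut ρ b = u := by
  rw [discAut, div_eq_iff (one_sub_mul_ne_zero h0 h1 hb), h]

theorem two_I_mul_sin (ψ : ℝ) : 2 * Complex.I * (Real.sin ψ : ℂ) = circlePt ψ - circlePt (-ψ) := by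
  apply Complex.ext <;> simp [circlePt_re, circlePt_im, -Complex.ofReal_sin,
    -Complex.ofReal_cos, ← two_mul]

theorem two_mul_cos (ψ : ℝ) : 2 * (Real.cos ψ : ℂ) = circlePt ψ + circlePt (-ψ) := by
  apply Complex.ext <;> simp [circlePt_re, circlePt_im, two_mul, -Complex.ofReal_sin,
    -Complex.ofReal_cos]

/-- The point `b = e^{-i(ψ + φ)}`, `ψ = arcAngle ρ φ`, is mapped to `e^{i(ψ - φ)}`; this is
`sin ψ = ρ cos φ` in complex form. -/
theorem discAut_discPt (h0 : 0 < ρ) (h1 : ρ < 1) (φ : ℝ) :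
    discAut ρ (discPt ρ φ) = circlePt (arcAngle ρ φ - φ) := by
  refine discAut_eq h0 h1 (by simp [discPt]) ?_
  have h := two_I_mul_sin (arcAngle ρ φ)
  have h2 := two_mul_cos φ
  rw [sin_arcAngle h0 h1, Complex.ofReal_mul] at h
  set ψ := arcAngle ρ φ
  have e : 2 * Complex.I * (ρ * (Real.cos φ : ℂ)) = Complex.I * ρ * (2 * (Real.cos φ : ℂ)) := by
    ring
  rw [e, h2] at h
  rw [discPt, show -(ψ + φ) = -ψ + -φ by ring, sub_eq_add_neg ψ φ, circlePt_add, circlePt_add]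
  have h3 : circlePt φ * circlePt (-φ) = 1 := by
    rw [circlePt_neg, mul_inv_cancel₀ (circlePt_ne_zero _)]
  have h4 : circlePt ψ * circlePt (-ψ) = 1 := by
    rw [circlePt_neg, mul_inv_cancel₀ (circlePt_ne_zero _)]
  linear_combination circlePt (-φ) * h - (Complex.I * ρ) * h3 +
    Complex.I * ρ * circlePt (-φ) ^ 2 * h4

theorem discPt_mul_discAut (h0 : 0 < ρ) (h1 : ρ < 1) (φ : ℝ) :
    discPt ρ φ * discAut ρ (discPt ρ φ) = circlePt (-(2 * φ)) := by
  rw [discAut_discPt h0 h1, discPt, ← circlePt_add]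
  congr 1; ring

theorem discAut_div_discPt (h0 : 0 < ρ) (h1 : ρ < 1) (φ : ℝ) :
    discAut ρ (discPt ρ φ) / discPt ρ φ = circlePt (2 * arcAngle ρ φ) := by
  rw [discAut_discPt h0 h1, discPt, div_eq_mul_inv, ← circlePt_neg, ← circlePt_add]
  congr 1; ring

theorem norm_discAut_le (h0 : 0 < ρ) (h1 : ρ < 1) {b : ℂ} (hb : ‖b‖ ≤ 1) : ‖discAut ρ b‖ ≤ 1 := by
  have h := one_sub_mul_ne_zero h0 h1 hb
  rw [discAut, norm_div, div_le_one (norm_pos_iff.mpr h)]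
  refine le_of_sq_le_sq ?_ (norm_nonneg _)
  rw [← Complex.normSq_eq_norm_sq, ← Complex.normSq_eq_norm_sq]
  have h2 : Complex.normSq b ≤ 1 := by rw [Complex.normSq_eq_norm_sq]; nlinarith [norm_nonneg b]
  simp only [Complex.normSq_apply, Complex.add_re, Complex.mul_re, Complex.I_re, Complex.I_im,
    Complex.ofReal_re, Complex.ofReal_im, Complex.add_im, Complex.mul_im, Complex.sub_re,
    Complex.sub_im, Complex.one_re, Complex.one_im] at h2 ⊢
  nlinarith [mul_nonneg (sub_nonneg.mpr h2) (by nlinarith : (0:ℝ) ≤ 1 - ρ ^ 2)]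

theorem differentiableAt_discAut (h0 : 0 < ρ) (h1 : ρ < 1) :
    ∀ b : ℂ, ‖b‖ ≤ 1 → DifferentiableAt ℂ (discAut ρ) b := fun b hb =>
  (by fun_prop : DifferentiableAt ℂ (fun b : ℂ => b + Complex.I * ρ) b).div (by fun_prop)
    (one_sub_mul_ne_zero h0 h1 hb)

/-- Integration over the arc in the parameter `φ`. -/
theorem integral_arcWeight_mul (h0 : 0 < ρ) (h1 : ρ < 1) {F : ℝ → ℝ} (hF : Continuous F) :
    ∫ φ in 0..Real.pi, arcWeight ρ φ * F (2 * arcAngle ρ φ) =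
      ∫ θ in (-(2 * Real.arcsin ρ))..(2 * Real.arcsin ρ), F θ := by
  have h := intervalIntegral.integral_comp_mul_deriv (a := 0) (b := Real.pi) (g := F)
    (f := fun φ => 2 * arcAngle ρ φ) (f' := fun φ => -arcWeight ρ φ)
    (fun φ _ => ((hasDerivAt_arcAngle h0 h1 φ).const_mul 2).congr_deriv (by ring))
    (continuous_arcWeight h0 h1).neg.continuousOn hF
  have e1 : 2 * arcAngle ρ 0 = 2 * Real.arcsin ρ := by simp [arcAngle]
  have e2 : 2 * arcAngle ρ Real.pi = -(2 * Real.arcsin ρ) := by simp [arcAngle, Real.arcsin_neg]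
  rw [e1, e2, intervalIntegral.integral_symm (-(2 * Real.arcsin ρ))] at h
  rw [← neg_inj, ← h, ← intervalIntegral.integral_neg]
  refine intervalIntegral.integral_congr fun φ _ => ?_
  simp only [Function.comp_apply]; ring

/-- Integration over the unit circle in the parameter `φ`. -/
theorem integral_discPt {E : Type*} [NormedAddCommGroup E] [NormedSpace ℝ E]
    (h0 : 0 < ρ) (h1 : ρ < 1) {F : ℂ → E} (hF : Continuous fun θ => F (circlePt θ)) :
    ∫ φ in (-Real.pi)..Real.pi, (1 - arcWeight ρ φ / 2) • F (discPt ρ φ) =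
      ∫ θ in 0..(2 * Real.pi), F (circlePt θ) := by
  have h := intervalIntegral.integral_deriv_smul_comp (a := -Real.pi) (b := Real.pi)
    (g := fun θ => F (circlePt (-θ)))
    (f := fun φ => arcAngle ρ φ + φ) (f' := fun φ => 1 - arcWeight ρ φ / 2)
    (fun φ _ => ((hasDerivAt_arcAngle h0 h1 φ).add (hasDerivAt_id φ)).congr_deriv (by ring))
    (by have := continuous_arcWeight h0 h1; fun_prop) (hF.comp continuous_neg)
  refine h.trans ?_
  have hper : Function.Periodic (fun θ => F (circlePt θ)) (2 * Real.pi) :=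
    circlePt_periodic.comp F
  have e := arcAngle_neg ρ Real.pi
  rw [e, intervalIntegral.integral_comp_neg (fun θ => F (circlePt θ))]
  have h2 := hper.intervalIntegral_add_eq (-(arcAngle ρ Real.pi + Real.pi)) 0
  rw [zero_add] at h2
  rw [← h2]
  congr 1; ring

/-- The mean value property on the unit circle in the parameter `φ`. -/
theorem integral_discPt_eq {F : ℂ → ℂ} (h0 : 0 < ρ) (h1 : ρ < 1)
    (hF : DiffContOnCl ℂ F (Metric.ball 0 1)) {w : ℂ} (hw : ‖w‖ < 1) :
    ∫ φ in (-Real.pi)..Real.pi,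
      (1 - arcWeight ρ φ / 2) • (discPt ρ φ / (discPt ρ φ - w) * F (discPt ρ φ)) =
      2 * Real.pi * F w := by
  have hc : ContinuousOn F (Metric.closedBall 0 1) := by
    rw [← closure_ball (0 : ℂ) one_ne_zero]; exact hF.continuousOn
  have hne : ∀ θ, circlePt θ - w ≠ 0 := fun θ h => by
    rw [← sub_eq_zero.mp h, norm_circlePt] at hw; exact lt_irrefl _ hw
  rw [integral_discPt (F := fun b => b / (b - w) * F b) h0 h1]
  · have h := DiffContOnCl.circleAverage_smul_div (f := F) (c := 0) (R := 1) (w := w)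
      (by simpa using hF) (by simpa using hw)
    rw [Real.circleAverage_def, inv_smul_eq_iff₀ (by positivity)] at h
    simp only [sub_zero, circleMap_zero, Complex.ofReal_one, one_mul, smul_eq_mul,
      Complex.real_smul] at h
    push_cast at h
    exact h
  · exact (continuous_circlePt.div (by fun_prop) hne).mul
      (hc.comp_continuous continuous_circlePt fun θ => by simp)

/-- The polynomial `P`, of degree at most `n`, as an analytic function of `b` in the closed unit
disc: away from `b = 0` it is `b ^ n * P (discAut ρ b / b)`. -/
noncomputable def discPoly (n : ℕ) (ρ : ℝ) (P : Polynomial ℂ) (b : ℂ) : ℂ :=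
  ∑ k ∈ Finset.range (n + 1), P.coeff k * discAut ρ b ^ k * b ^ (n - k)

theorem discPoly_eq {n : ℕ} {P : Polynomial ℂ} (hP : P.natDegree ≤ n) {b : ℂ} (hb : b ≠ 0) :
    discPoly n ρ P b = b ^ n * P.eval (discAut ρ b / b) := by
  rw [Polynomial.eval_eq_sum_range' (Nat.lt_succ_of_le hP), Finset.mul_sum, discPoly]
  refine Finset.sum_congr rfl fun k hk => ?_
  have hk' : k ≤ n := Nat.lt_succ_iff.mp (Finset.mem_range.mp hk)
  rw [← Nat.sub_add_cancel hk', Nat.add_sub_cancel, pow_add, div_pow]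
  field_simp

theorem discPoly_zero (n : ℕ) (ρ : ℝ) (P : Polynomial ℂ) :
    discPoly n ρ P 0 = P.coeff n * (Complex.I * ρ) ^ n := by
  rw [discPoly, Finset.sum_eq_single n]
  · simp [discAut]
  · intro k hk hkn
    have : n - k ≠ 0 := by have := Finset.mem_range.mp hk; omega
    simp [this]
  · simp

theorem differentiableAt_discPoly (n : ℕ) (h0 : 0 < ρ) (h1 : ρ < 1) (P : Polynomial ℂ) {b : ℂ}
    (hb : ‖b‖ ≤ 1) : DifferentiableAt ℂ (discPoly n ρ P) b := by
  have := differentiableAt_discAut h0 h1 b hb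
  unfold discPoly
  fun_prop

theorem discPoly_discPt {n : ℕ} {P : Polynomial ℂ} (hP : P.natDegree ≤ n) (h0 : 0 < ρ)
    (h1 : ρ < 1) (φ : ℝ) : discPoly n ρ P (discPt ρ φ) =
      discPt ρ φ ^ n * P.eval (circlePt (2 * arcAngle ρ φ)) := by
  rw [discPoly_eq hP (b := discPt ρ φ) (circlePt_ne_zero _), discAut_div_discPt h0 h1]

theorem diffContOnCl_of_differentiableAt {F : ℂ → ℂ}
    (h : ∀ b : ℂ, ‖b‖ ≤ 1 → DifferentiableAt ℂ F b) : DiffContOnCl ℂ F (Metric.ball 0 1) := by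
  refine DifferentiableOn.diffContOnCl fun b hb => ?_
  rw [closure_ball (0 : ℂ) one_ne_zero] at hb
  exact (h b (by simpa using hb)).differentiableWithinAt

end

/-! ### Polynomials in the gap are controlled by the arc -/

section
variable {ρ : ℝ}

theorem integral_symm_interval {E : Type*} [NormedAddCommGroup E] [NormedSpace ℝ E] {f : ℝ → E}
    (hf : Continuous f) (a : ℝ) : ∫ x in (-a)..a, f x = ∫ x in 0..a, (f x + f (-x)) := by
  rw [intervalIntegral.integral_add (hf.intervalIntegrable _ _)
    ((by fun_prop : Continuous fun x => f (-x)).intervalIntegrable _ _),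
    intervalIntegral.integral_comp_neg,
    neg_zero, add_comm,
    intervalIntegral.integral_add_adjacent_intervals (hf.intervalIntegrable _ _)
      (hf.intervalIntegrable _ _)]

theorem norm_one_sub_circlePt (φ : ℝ) : ‖1 - circlePt (-(2 * φ))‖ = 2 * |Real.sin φ| := by
  have h : 1 - circlePt (-(2 * φ)) = circlePt (-φ) * (2 * Complex.I * (Real.sin φ : ℂ)) := by
    rw [two_I_mul_sin, mul_sub, ← circlePt_add, ← circlePt_add]
    rw [show -φ + φ = 0 by ring, show -φ + -φ = -(2 * φ) by ring]
    simp [circlePt]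
  rw [h]
  simp [-Complex.ofReal_sin]

/-- The energy on the arc in the parameter `φ`. -/
theorem energy_zero_eq_integral (h0 : 0 < ρ) (h1 : ρ < 1) (P : Polynomial ℂ) :
    2 * Real.pi * energy (2 * Real.arcsin ρ) 0 P = ∫ φ in 0..Real.pi,
      arcWeight ρ φ * ‖P.eval (circlePt (2 * arcAngle ρ φ))‖ ^ 2 := by
  rw [integral_arcWeight_mul h0 h1 (continuous_norm_sq_eval P), energy_zero,
    mul_inv_cancel_left₀ (by positivity)]

/-- Pointwise bound off the arc: in the variable `b` the point `e^{iθ}` of the gap corresponds to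
`e^{-iθ/2} / l`, inside the unit disc, and the Cauchy formula is applied there to the function
`discPoly n ρ P b ^ 2 * (1 - b * discAut ρ b)`. -/
theorem sq_norm_eval_gap_le (h0 : 0 < ρ) (h1 : ρ < 1) {n : ℕ} {P : Polynomial ℂ}
    (hP : P.natDegree ≤ n) {l θ : ℝ} (hl : 1 < l)
    (h : 2 * Real.sin (θ / 2) = ρ * (l + l⁻¹)) :
    ‖P.eval (circlePt θ)‖ ^ 2 * (1 - l⁻¹) ^ 2 ≤
      l ^ (2 * n) * (4 / ρ * energy (2 * Real.arcsin ρ) 0 P) := by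
  have hl0 : 0 < l := by linarith
  have hli : l⁻¹ < 1 := inv_lt_one_of_one_lt₀ hl
  -- `discAut ρ w = e^{iθ/2} / l`, so that `discAut ρ w / w = e^{iθ}`
  set w : ℂ := circlePt (-(θ / 2)) * (l : ℂ)⁻¹ with hw
  have hwn : ‖w‖ = l⁻¹ := by simp [hw, abs_of_pos hl0]
  have hlc : (l : ℂ) ≠ 0 := by exact_mod_cast hl0.ne'
  have hw0 : w ≠ 0 := mul_ne_zero (circlePt_ne_zero _) (inv_ne_zero hlc)
  have hB : discAut ρ w = circlePt (θ / 2) * (l : ℂ)⁻¹ := by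
    refine discAut_eq h0 h1 (by rw [hwn]; exact hli.le) ?_
    have h2 := two_I_mul_sin (θ / 2)
    have h3 : circlePt (θ / 2) * circlePt (-(θ / 2)) = 1 := by
      rw [circlePt_neg, mul_inv_cancel₀ (circlePt_ne_zero _)]
    have h4 : 2 * Complex.I * (Real.sin (θ / 2) : ℂ) = Complex.I * (ρ * (l + (l : ℂ)⁻¹)) := by
      have := congrArg (fun x : ℝ => (x : ℂ)) h
      push_cast at this
      push_cast
      rw [← this]; ring
    rw [h4] at h2
    rw [hw]
    have h5 : (l : ℂ) * (l : ℂ)⁻¹ = 1 := mul_inv_cancel₀ hlc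
    linear_combination (l : ℂ)⁻¹ * h2 + Complex.I * ρ * (l : ℂ)⁻¹ ^ 2 * h3 -
      Complex.I * ρ * h5
  set F : ℂ → ℂ := fun b => discPoly n ρ P b ^ 2 * (1 - b * discAut ρ b) with hF
  have hFd : DiffContOnCl ℂ F (Metric.ball 0 1) := diffContOnCl_of_differentiableAt fun b hb => by
    have := differentiableAt_discPoly n h0 h1 P hb
    have := differentiableAt_discAut h0 h1 b hb
    simp only [hF]
    fun_prop
  have hFw : ‖F w‖ = ‖P.eval (circlePt θ)‖ ^ 2 * (1 - l⁻¹ ^ 2) * l⁻¹ ^ (2 * n) := by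
    simp only [hF]
    have e1 : discAut ρ w / w = circlePt θ := by
      rw [hB, hw, mul_div_mul_right _ _ (inv_ne_zero hlc), div_eq_mul_inv, ← circlePt_neg, neg_neg,
        ← circlePt_add, add_halves]
    have e2 : w * discAut ρ w = ((l⁻¹ ^ 2 : ℝ) : ℂ) := by
      have h3 : circlePt (-(θ / 2)) * circlePt (θ / 2) = 1 := by
        rw [circlePt_neg, inv_mul_cancel₀ (circlePt_ne_zero _)]
      rw [hB, hw]; push_cast
      linear_combination (l : ℂ)⁻¹ ^ 2 * h3
    have e3 : ‖(1 : ℂ) - ((l⁻¹ ^ 2 : ℝ) : ℂ)‖ = 1 - l⁻¹ ^ 2 := by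
      have h4 : 0 < 1 - l⁻¹ ^ 2 := by nlinarith [inv_pos.mpr hl0]
      rw [← Complex.ofReal_one, ← Complex.ofReal_sub, Complex.norm_real, Real.norm_eq_abs,
        abs_of_pos h4]
    rw [discPoly_eq hP hw0, e1, e2, norm_mul, norm_pow, norm_mul, norm_pow, hwn, e3]
    ring
  -- on the unit circle `|F|` is `|P|²` times `2 |sin φ|`, comparable to the density of arc length
  have key := integral_discPt_eq h0 h1 hFd (w := w) (by rw [hwn]; exact hli)
  have hp : Continuous fun φ => ‖P.eval (circlePt (2 * arcAngle ρ φ))‖ ^ 2 :=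
    (continuous_norm_sq_eval P).comp ((continuous_arcAngle ρ).const_mul 2)
  set p : ℝ → ℝ := fun φ => ‖P.eval (circlePt (2 * arcAngle ρ φ))‖ ^ 2 with hpdef
  have hpneg : ∀ φ, p (-φ) = p φ := fun φ => by simp only [hpdef, arcAngle_neg]
  have hK : 0 < (1 - l⁻¹)⁻¹ := inv_pos.mpr (by linarith)
  have hbound : 2 * Real.pi * ‖F w‖ ≤ ∫ φ in (-Real.pi)..Real.pi,
      2 * ((1 - l⁻¹)⁻¹ * (p φ * (2 * |Real.sin φ|))) := by
    have e : ‖2 * (Real.pi : ℂ) * F w‖ = 2 * Real.pi * ‖F w‖ := by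
      simp [abs_of_pos Real.pi_pos]
    rw [← e, ← key]
    refine intervalIntegral.norm_integral_le_of_norm_le (by linarith [Real.pi_pos])
      (Filter.Eventually.of_forall fun φ _ => ?_) (Continuous.intervalIntegrable (by fun_prop) _ _)
    have hn : ‖discPt ρ φ‖ = 1 := norm_circlePt _
    have h5 : 1 - l⁻¹ ≤ ‖discPt ρ φ - w‖ := by
      have := norm_sub_norm_le (discPt ρ φ) w
      rwa [hn, hwn] at this
    have h6 : ‖F (discPt ρ φ)‖ = p φ * (2 * |Real.sin φ|) := by
      simp only [hF, hpdef]
      rw [discPoly_discPt hP h0 h1, discPt_mul_discAut h0 h1, norm_mul, norm_one_sub_circlePt,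
        norm_pow, norm_mul, norm_pow, hn, one_pow, one_mul]
    have hw2 := abs_le.mp (abs_arcWeight_le h0 h1 φ)
    rw [norm_smul, norm_mul, norm_div, hn, h6, one_div, Real.norm_eq_abs, abs_of_nonneg (by linarith)]
    have hp0 : 0 ≤ p φ * (2 * |Real.sin φ|) := by positivity
    gcongr
    linarith
  have hint : ∫ φ in (-Real.pi)..Real.pi, 2 * ((1 - l⁻¹)⁻¹ * (p φ * (2 * |Real.sin φ|))) ≤
      ∫ φ in 0..Real.pi, (4 / ρ * (1 - l⁻¹)⁻¹) * (arcWeight ρ φ * p φ) := by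
    rw [integral_symm_interval (by fun_prop)]
    have hwc := continuous_arcWeight h0 h1
    refine intervalIntegral.integral_mono_on Real.pi_pos.le
      (Continuous.intervalIntegrable (by fun_prop) _ _)
      (Continuous.intervalIntegrable (by fun_prop) _ _) fun φ hφ => ?_
    have hs : 0 ≤ Real.sin φ := Real.sin_nonneg_of_mem_Icc hφ
    have hk := cos_arcAngle_pos h0 h1 φ
    have h7 : Real.sin φ ≤ arcWeight ρ φ / (2 * ρ) := by
      rw [arcWeight, div_div, le_div_iff₀ (by positivity)]
      have := Real.cos_le_one (arcAngle ρ φ)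
      nlinarith [mul_nonneg (mul_nonneg h0.le hs) (sub_nonneg.mpr this)]
    rw [hpneg, Real.sin_neg, abs_neg, abs_of_nonneg hs]
    have hp0 : 0 ≤ p φ := by positivity
    calc _ = 8 * (1 - l⁻¹)⁻¹ * p φ * Real.sin φ := by ring
      _ ≤ 8 * (1 - l⁻¹)⁻¹ * p φ * (arcWeight ρ φ / (2 * ρ)) := by gcongr
      _ = _ := by field_simp; ring
  rw [intervalIntegral.integral_const_mul (4 / ρ * (1 - l⁻¹)⁻¹), hpdef,
    ← energy_zero_eq_integral h0 h1] at hint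
  have h8 : ‖F w‖ * (1 - l⁻¹) ≤ 4 / ρ * energy (2 * Real.arcsin ρ) 0 P := by
    have := hbound.trans hint
    have h9 : ‖F w‖ ≤ 4 / ρ * (1 - l⁻¹)⁻¹ * energy (2 * Real.arcsin ρ) 0 P := by
      have h10 : 0 < 2 * Real.pi := by positivity
      refine le_of_mul_le_mul_left ?_ h10
      linarith
    calc _ ≤ 4 / ρ * (1 - l⁻¹)⁻¹ * energy (2 * Real.arcsin ρ) 0 P * (1 - l⁻¹) :=
          mul_le_mul_of_nonneg_right h9 (by linarith)
      _ = _ := by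
          have h12 : (1 - l⁻¹)⁻¹ * (1 - l⁻¹) = 1 := inv_mul_cancel₀ (by linarith)
          linear_combination (4 / ρ * energy (2 * Real.arcsin ρ) 0 P) * h12
  rw [hFw] at h8
  have h11 : l ^ (2 * n) * l⁻¹ ^ (2 * n) = 1 := by rw [← mul_pow, mul_inv_cancel₀ hl0.ne', one_pow]
  have hi : 0 < l⁻¹ := inv_pos.mpr hl0
  calc ‖P.eval (circlePt θ)‖ ^ 2 * (1 - l⁻¹) ^ 2
      ≤ ‖P.eval (circlePt θ)‖ ^ 2 * ((1 - l⁻¹ ^ 2) * (1 - l⁻¹)) := by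
        gcongr; nlinarith
    _ = l ^ (2 * n) * (‖P.eval (circlePt θ)‖ ^ 2 * (1 - l⁻¹ ^ 2) * l⁻¹ ^ (2 * n) * (1 - l⁻¹)) := by
        linear_combination (-(‖P.eval (circlePt θ)‖ ^ 2 * ((1 - l⁻¹ ^ 2) * (1 - l⁻¹)))) * h11
    _ ≤ _ := by gcongr

end

section
variable {ρ : ℝ}

theorem tan_half_angle {α : ℝ} (h2 : 0 < Real.sin α) :
    (1 + Real.cos α) / Real.sin α = (Real.tan (α / 2))⁻¹ := by
  have e1 : Real.sin α = 2 * Real.sin (α / 2) * Real.cos (α / 2) := by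
    rw [← Real.sin_two_mul]; congr 1; ring
  have e2 : 1 + Real.cos α = 2 * Real.cos (α / 2) ^ 2 := by
    have := Real.cos_two_mul (α / 2)
    rw [show 2 * (α / 2) = α by ring] at this
    linarith
  rw [e1] at h2
  have hs : Real.sin (α / 2) ≠ 0 := fun h => by simp [h] at h2
  have hc : Real.cos (α / 2) ≠ 0 := fun h => by simp [h] at h2
  rw [e1, e2, Real.tan_eq_sin_div_cos, inv_div]
  field_simp

/-- If the gap point `e^{iθ}` is bounded away from the arc of half-opening `2 arcsin r`, then `P`
is exponentially smaller there than at the worst gap point of the arc with `ρ = sin α`. -/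
theorem sq_norm_eval_gap_le_exp {r α : ℝ} (hr0 : 0 < r) (hr : r ≤ Real.sin α)
    (hs1 : Real.sin α < 1) (hc : 0 < Real.cos α)
    {n : ℕ} {P : Polynomial ℂ} (hP : P.natDegree ≤ n) {θ c a : ℝ} (hc0 : 0 < c) (hc1 : c ≤ 1)
    (h1 : 1 + c ≤ Real.sin (θ / 2) / r) (h2 : Real.sin (θ / 2) / r ≤ 1 / Real.sin α)
    (ha : a * (1 + Real.cos α) ≤ 1 - Real.sin α * (Real.sin (θ / 2) / r)) :
    ‖P.eval (circlePt θ)‖ ^ 2 ≤ (16 / (r * c ^ 2)) * energy (2 * Real.arcsin r) 0 P *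
      ((Real.tan (α / 2))⁻¹ ^ (2 * n) * Real.exp (-(2 * n * a))) := by
  have hs0 : 0 < Real.sin α := hr0.trans_le hr
  set t := Real.sin (θ / 2) / r with ht
  -- the larger solution of `l + 1 / l = 2t`
  set l := t + √(t ^ 2 - 1) with hl
  have ht1 : 1 < t := by linarith
  have hq : 0 ≤ t ^ 2 - 1 := by nlinarith
  have hsq := Real.sq_sqrt hq
  have hl1 : 1 + c ≤ l := by linarith [Real.sqrt_nonneg (t ^ 2 - 1)]
  have hl0 : 0 < l := by linarith
  have hinv : l⁻¹ = t - √(t ^ 2 - 1) :=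
    inv_eq_of_mul_eq_one_left (by rw [hl]; nlinarith)
  have key := sq_norm_eval_gap_le hr0 (hr.trans_lt hs1) hP (l := l) (θ := θ) (by linarith)
    (by rw [hinv, hl, ht]; field_simp; ring)
  -- the largest value of `l` is attained at `θ = π`
  have hL := tan_half_angle hs0
  set L := (Real.tan (α / 2))⁻¹ with hLdef
  have hLpos : 0 < L := by rw [← hL]; positivity
  have hlL : l ≤ L * Real.exp (-a) := by
    have e1 : √(t ^ 2 - 1) ≤ Real.cos α / Real.sin α := by
      refine Real.sqrt_le_iff.mpr ⟨by positivity, ?_⟩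
      have h3 : t ^ 2 ≤ (1 / Real.sin α) ^ 2 := by gcongr
      have h4 : (Real.cos α / Real.sin α) ^ 2 = (1 / Real.sin α) ^ 2 - 1 := by
        have := Real.sin_sq_add_cos_sq α
        field_simp
        linarith
      linarith
    have e2 : a * L ≤ 1 / Real.sin α - t := by
      rw [← hL, mul_div_assoc', div_le_iff₀ hs0]
      refine ha.trans_eq ?_
      field_simp
    have e3 : L = 1 / Real.sin α + Real.cos α / Real.sin α := by rw [← hL]; ring
    have e4 := Real.add_one_le_exp (-a)
    calc l ≤ L * (-a + 1) := by nlinarith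
      _ ≤ _ := by gcongr
  have e5 : l ^ (2 * n) ≤ L ^ (2 * n) * Real.exp (-(2 * n * a)) := by
    calc l ^ (2 * n) ≤ (L * Real.exp (-a)) ^ (2 * n) := by gcongr
      _ = _ := by
          rw [mul_pow, ← Real.exp_nat_mul]; congr 2; push_cast; ring
  have e6 : c / 2 ≤ 1 - l⁻¹ := by
    have h3 : l⁻¹ ≤ (1 + c)⁻¹ := by gcongr
    have h4 : (1 + c)⁻¹ ≤ 1 - c / 2 := by
      rw [inv_le_iff_one_le_mul₀ (by linarith)]; nlinarith
    linarith
  have hE : 0 ≤ energy (2 * Real.arcsin r) 0 P :=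
    energy_zero_nonneg (by have := Real.arcsin_nonneg.mpr hr0.le; linarith) P
  have e7 : ‖P.eval (circlePt θ)‖ ^ 2 * (c / 2) ^ 2 ≤
      L ^ (2 * n) * Real.exp (-(2 * n * a)) * (4 / r * energy (2 * Real.arcsin r) 0 P) :=
    calc _ ≤ ‖P.eval (circlePt θ)‖ ^ 2 * (1 - l⁻¹) ^ 2 := by gcongr
      _ ≤ _ := key
      _ ≤ _ := by gcongr
  rw [← le_div_iff₀ (by positivity)] at e7
  refine e7.trans_eq ?_
  field_simp
  ring

theorem energy_zero_mono {θ θ' : ℝ} (h0 : 0 ≤ θ) (h : θ ≤ θ') (P : Polynomial ℂ) :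
    energy θ 0 P ≤ energy θ' 0 P := by
  rw [energy_zero, energy_zero]
  have := intervalIntegral.integral_mono_interval (μ := MeasureTheory.volume) (c := -θ') (d := θ')
    (a := -θ) (b := θ) (f := fun θ => ‖P.eval (circlePt θ)‖ ^ 2) (by linarith) (by linarith) h
    (Filter.Eventually.of_forall fun θ => by positivity)
    ((continuous_norm_sq_eval P).intervalIntegrable _ _)
  gcongr

/-- Gaussian pointwise bound on the whole gap. Close to the ends of the gap the polynomial is
compared with its values on a slightly shorter arc. -/
theorem sq_norm_eval_gap_le_gaussian {m α : ℝ} (hm : 0 < m) (hα0 : 0 ≤ α) (hα : α ≤ Real.pi / 2)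
    (hs : m ≤ Real.sin α) (hc : m ≤ Real.cos α) {n : ℕ} {P : Polynomial ℂ} (hP : P.natDegree ≤ n)
    {θ : ℝ} (h1 : 2 * α ≤ θ) (h2 : θ ≤ 2 * Real.pi - 2 * α) :
    ‖P.eval (circlePt θ)‖ ^ 2 ≤ (4608 / m ^ 5) * energy (2 * α) 0 P *
      ((Real.tan (α / 2))⁻¹ ^ (2 * n) *
        Real.exp (-(m ^ 2 / (4 * Real.pi ^ 2) * n) * (Real.pi - θ) ^ 2)) := by
  have hs0 : 0 < Real.sin α := hm.trans_le hs
  have hc0 : 0 < Real.cos α := hm.trans_le hc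
  have hsc := Real.sin_sq_add_cos_sq α
  have hs1 : Real.sin α < 1 := by nlinarith
  have hc1 : Real.cos α ≤ 1 := Real.cos_le_one α
  have hm1 : m ≤ 1 := hc.trans hc1
  have hmc : m ^ 2 ≤ 2 * (1 - Real.sin α) := by nlinarith
  have hpi := Real.pi_pos
  have hT : 0 ≤ (Real.tan (α / 2))⁻¹ ^ (2 * n) := by rw [pow_mul]; positivity
  have hE := energy_zero_nonneg (by linarith : 0 ≤ 2 * α) P
  -- the threshold for being close to the ends of the gap, so small that `3c = m² / 4` can be
  -- absorbed by `1 - sin α ≥ m² / 2`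
  set c : ℝ := m ^ 2 / 12 with hcdef
  have hcpos : 0 < c := by positivity
  have hcle : c ≤ 1 / 12 := by rw [hcdef]; nlinarith
  set x := Real.pi - θ with hx
  -- the exponent per degree, quadratic at `θ = π` and at most `m² / 8` on the whole gap
  set a := m ^ 2 / (8 * Real.pi ^ 2) * x ^ 2 with ha
  have hsin : Real.sin (θ / 2) = Real.cos (x / 2) := by
    rw [hx, ← Real.cos_pi_div_two_sub]; congr 1; ring
  have hxabs : |x| ≤ Real.pi := abs_le.mpr ⟨by linarith, by linarith⟩
  have hx2 : x ^ 2 ≤ Real.pi ^ 2 := sq_le_sq' (by linarith [abs_le.mp hxabs])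
    (abs_le.mp hxabs).2
  have hcosx : Real.sin (θ / 2) ≤ 1 - 1 / (2 * Real.pi ^ 2) * x ^ 2 := by
    rw [hsin]
    refine (Real.cos_le_one_sub_mul_cos_sq ?_).trans_eq ?_
    · rw [abs_div, abs_two]; linarith
    · field_simp
  have hge : Real.sin α ≤ Real.sin (θ / 2) := by
    rw [hsin, ← Real.cos_pi_div_two_sub, ← Real.cos_abs (x / 2)]
    refine Real.cos_le_cos_of_nonneg_of_le_pi (abs_nonneg _) (by linarith) ?_
    rw [abs_le]; constructor <;> linarith
  have hle1 : Real.sin (θ / 2) ≤ 1 := Real.sin_le_one _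
  have hexp : Real.exp (-(2 * n * a)) = Real.exp (-(m ^ 2 / (4 * Real.pi ^ 2) * n) * x ^ 2) := by
    congr 1; rw [ha]; field_simp; ring
  have ha0 : 0 ≤ a := by positivity
  have ha1 : 2 * a ≤ 1 / (2 * Real.pi ^ 2) * x ^ 2 := by
    have : m ^ 2 ≤ 1 := by nlinarith
    calc 2 * a = m ^ 2 * (1 / (4 * Real.pi ^ 2) * x ^ 2) := by rw [ha]; field_simp; ring
      _ ≤ 1 * (1 / (4 * Real.pi ^ 2) * x ^ 2) := by gcongr
      _ ≤ _ := by rw [one_mul]; gcongr; norm_num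
  have ha2 : 2 * a ≤ m ^ 2 / 4 := by
    calc 2 * a = m ^ 2 / (4 * Real.pi ^ 2) * x ^ 2 := by rw [ha]; field_simp; ring
      _ ≤ m ^ 2 / (4 * Real.pi ^ 2) * Real.pi ^ 2 := by gcongr
      _ = _ := by field_simp
  have haa : a * (1 + Real.cos α) ≤ 2 * a := by nlinarith
  rw [← hexp]
  rcases le_or_gt (1 + c) (Real.sin (θ / 2) / Real.sin α) with hcase | hcase
  · have h := sq_norm_eval_gap_le_exp hs0 le_rfl hs1 hc0 hP (a := a) hcpos (by linarith) hcase
      (by gcongr) (by rw [mul_div_cancel₀ _ hs0.ne']; linarith)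
    rw [Real.arcsin_sin (by linarith) hα] at h
    refine h.trans ?_
    have : 16 / (Real.sin α * c ^ 2) ≤ 4608 / m ^ 5 := by
      calc 16 / (Real.sin α * c ^ 2) ≤ 16 / (m * c ^ 2) := by gcongr
        _ = 2304 / m ^ 5 := by rw [hcdef]; field_simp; norm_num
        _ ≤ _ := by gcongr; norm_num
    gcongr
  · -- the arc of half-opening `2 arcsin r` is shorter, and `θ` is bounded away from it
    set r := Real.sin α / (1 + c) with hr
    have hr0 : 0 < r := by positivity
    have hrle : r ≤ Real.sin α := div_le_self hs0.le (by linarith)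
    have et : Real.sin (θ / 2) / r = Real.sin (θ / 2) / Real.sin α * (1 + c) := by
      rw [hr]; field_simp
    have ht1 : 1 ≤ Real.sin (θ / 2) / Real.sin α := by rwa [one_le_div hs0]
    have ht2 : Real.sin (θ / 2) / r ≤ 1 + 3 * c := by
      rw [et]
      calc _ ≤ (1 + c) * (1 + c) := by gcongr
        _ ≤ _ := by nlinarith only [hcpos, hcle]
    have ht3 : Real.sin α * (Real.sin (θ / 2) / r) ≤ 1 - m ^ 2 / 4 := by
      have h3c : 3 * c = m ^ 2 / 4 := by rw [hcdef]; ring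
      rw [h3c] at ht2
      have h4 : (1 + Real.sin α) * m ^ 2 ≤ 2 * (2 * (1 - Real.sin α)) := by
        gcongr; linarith
      calc _ ≤ Real.sin α * (1 + m ^ 2 / 4) := mul_le_mul_of_nonneg_left ht2 hs0.le
        _ ≤ _ := by linarith
    have h := sq_norm_eval_gap_le_exp hr0 hrle hs1 hc0 hP (a := a) (θ := θ) hcpos (by linarith)
      (by rw [et]; exact le_mul_of_one_le_left (by linarith) ht1)
      (by rw [le_div_iff₀ hs0, mul_comm]; linarith [sq_nonneg m]) (by linarith)
    refine h.trans ?_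
    have : 16 / (r * c ^ 2) ≤ 4608 / m ^ 5 := by
      have : m / 2 ≤ r := by
        rw [hr]
        exact div_le_div₀ hs0.le hs (by linarith) (by linarith)
      calc 16 / (r * c ^ 2) ≤ 16 / (m / 2 * c ^ 2) := by gcongr
        _ = _ := by rw [hcdef]; field_simp; norm_num
    have h5 : energy (2 * Real.arcsin r) 0 P ≤ energy (2 * α) 0 P := by
      have h6 : Real.arcsin r ≤ α := by
        rw [← Real.arcsin_sin (by linarith : -(Real.pi / 2) ≤ α) hα]
        exact Real.monotone_arcsin hrle
      exact energy_zero_mono (by have := Real.arcsin_nonneg.mpr hr0.le; linarith) (by linarith) P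
    have h7 := energy_zero_nonneg
      (by have := Real.arcsin_nonneg.mpr hr0.le; linarith : 0 ≤ 2 * Real.arcsin r) P
    gcongr

/-- The energy in the gap of a polynomial of degree at most `n` is at most
`C n^{-1/2} (cot (θ₀ / 4))^{2n}` times its energy on the arc. -/
theorem gapEnergy_le {m α : ℝ} (hm : 0 < m) (hα0 : 0 ≤ α) (hα : α ≤ Real.pi / 2)
    (hs : m ≤ Real.sin α) (hc : m ≤ Real.cos α) {n : ℕ} (hn : 0 < n) {P : Polynomial ℂ}
    (hP : P.natDegree ≤ n) :
    gapEnergy (2 * α) P ≤ 4608 / m ^ 6 * (2 * Real.pi) / √n * (Real.tan (α / 2))⁻¹ ^ (2 * n) *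
      energy (2 * α) 0 P := by
  rw [gapEnergy_eq]
  have hn' : (0 : ℝ) < n := by exact_mod_cast hn
  set b := m ^ 2 / (4 * Real.pi ^ 2) * n with hb
  have hb0 : 0 < b := by positivity
  have hg : MeasureTheory.Integrable fun θ : ℝ => Real.exp (-b * (Real.pi - θ) ^ 2) :=
    (integrable_exp_neg_mul_sq hb0).comp_sub_left Real.pi
  have h1 : ∫ θ in (2 * α)..(2 * Real.pi - 2 * α), ‖P.eval (circlePt θ)‖ ^ 2 ≤
      ∫ θ in (2 * α)..(2 * Real.pi - 2 * α), (4608 / m ^ 5) * energy (2 * α) 0 P *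
        ((Real.tan (α / 2))⁻¹ ^ (2 * n) * Real.exp (-b * (Real.pi - θ) ^ 2)) :=
    intervalIntegral.integral_mono_on (by linarith)
      ((continuous_norm_sq_eval P).intervalIntegrable _ _)
      (Continuous.intervalIntegrable (by fun_prop) _ _)
      fun θ hθ => sq_norm_eval_gap_le_gaussian hm hα0 hα hs hc hP hθ.1 hθ.2
  have h2 : ∫ θ in (2 * α)..(2 * Real.pi - 2 * α), Real.exp (-b * (Real.pi - θ) ^ 2) ≤
      √(Real.pi / b) := by
    rw [intervalIntegral.integral_of_le (by linarith), ← integral_gaussian b,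
      ← MeasureTheory.integral_sub_left_eq_self _ MeasureTheory.volume Real.pi]
    exact MeasureTheory.setIntegral_le_integral hg (Filter.Eventually.of_forall fun θ => by positivity)
  rw [intervalIntegral.integral_const_mul, intervalIntegral.integral_const_mul] at h1
  have h3 : √(Real.pi / b) ≤ (2 * Real.pi) ^ 2 / (m * √n) := by
    rw [hb]
    refine Real.sqrt_le_iff.mpr ⟨by positivity, ?_⟩
    rw [div_pow, mul_pow m, Real.sq_sqrt hn'.le, div_le_div_iff₀ (by positivity) (by positivity)]
    have hp := Real.pi_gt_three
    have : Real.pi * (m ^ 2 * n) ≤ (4 * Real.pi ^ 2) * (m ^ 2 * n) := by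
      gcongr; nlinarith
    calc _ = Real.pi * (m ^ 2 * n) := by ring
      _ ≤ _ := this
      _ = ((4 * Real.pi ^ 2) * (m ^ 2 * n)) * 1 := by ring
      _ = (2 * Real.pi) ^ 4 * (m ^ 2 / (4 * Real.pi ^ 2) * n) := by field_simp; ring
      _ = _ := by ring
  have hE := energy_zero_nonneg (by linarith : 0 ≤ 2 * α) P
  have hT : 0 ≤ (Real.tan (α / 2))⁻¹ ^ (2 * n) := by rw [pow_mul]; positivity
  calc (2 * Real.pi)⁻¹ * _ ≤ (2 * Real.pi)⁻¹ * (4608 / m ^ 5 * energy (2 * α) 0 P *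
        ((Real.tan (α / 2))⁻¹ ^ (2 * n) * ((2 * Real.pi) ^ 2 / (m * √n)))) := by
        refine mul_le_mul_of_nonneg_left (h1.trans ?_) (by positivity)
        gcongr
        exact h2.trans h3
    _ = _ := by field_simp

end

/-! ### The lower bound for the energy of a monic polynomial -/

section

theorem continuousAt_sqrt_of_re_nonneg {z : ℂ} (hz : 0 ≤ z.re) :
    ContinuousAt (fun z : ℂ => z ^ (2⁻¹ : ℂ)) z := by
  rcases eq_or_ne z 0 with rfl | h
  · have h := (Complex.continuousAt_cpow_zero_of_re_pos (z := (2⁻¹ : ℂ)) (by norm_num))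
    exact ContinuousAt.comp (f := fun z : ℂ => (z, (2⁻¹ : ℂ))) h (by fun_prop)
  · refine continuousAt_id.cpow continuousAt_const ?_
    rw [Complex.mem_slitPlane_iff]
    rcases hz.lt_or_eq with h2 | h2
    · exact Or.inl h2
    · right; intro h3; exact h (Complex.ext h2.symm h3)

/-- The square root of `(1 - x) (1 - t x)` that is analytic in the unit disc. -/
noncomputable def diskSqrt (t : ℝ) (x : ℂ) : ℂ := (1 - x) ^ (2⁻¹ : ℂ) * (1 - t * x) ^ (2⁻¹ : ℂ)

theorem re_one_sub_mul_nonneg {t : ℝ} (h0 : 0 ≤ t) (h1 : t ≤ 1) {x : ℂ} (hx : ‖x‖ ≤ 1) :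
    0 ≤ (1 - t * x).re := by
  have := (Complex.re_le_norm x).trans hx
  simp only [Complex.sub_re, Complex.one_re, Complex.re_ofReal_mul]
  nlinarith

theorem re_one_sub_mul_pos {t : ℝ} (h0 : 0 ≤ t) (h1 : t ≤ 1) {x : ℂ} (hx : ‖x‖ < 1) :
    0 < (1 - t * x).re := by
  have := (Complex.re_le_norm x).trans_lt hx
  simp only [Complex.sub_re, Complex.one_re, Complex.re_ofReal_mul]
  rcases le_or_gt x.re 0 with h | h <;> nlinarith

theorem diskSqrt_sq (t : ℝ) (x : ℂ) : diskSqrt t x ^ 2 = (1 - x) * (1 - t * x) := by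
  have h : ∀ z : ℂ, (z ^ (2⁻¹ : ℂ)) ^ 2 = z := fun z => by
    exact Complex.cpow_nat_inv_pow z (n := 2) two_ne_zero
  rw [diskSqrt, mul_pow, h, h]

theorem diskSqrt_conj {t : ℝ} (h0 : 0 ≤ t) (h1 : t ≤ 1) {x : ℂ} (hx : ‖x‖ ≤ 1) :
    diskSqrt t ((starRingEnd ℂ) x) = (starRingEnd ℂ) (diskSqrt t x) := by
  have h : ∀ s : ℝ, 0 ≤ s → s ≤ 1 → (1 - s * (starRingEnd ℂ) x) ^ (2⁻¹ : ℂ) =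
      (starRingEnd ℂ) ((1 - s * x) ^ (2⁻¹ : ℂ)) := fun s hs0 hs1 => by
    have h2 : (1 - s * x).arg ≠ Real.pi := fun h3 => by
      have h4 := (Complex.arg_eq_pi_iff.mp h3).1
      exact absurd (re_one_sub_mul_nonneg hs0 hs1 hx) (not_le.mpr h4)
    have h5 := Complex.conj_cpow (1 - s * x) (2⁻¹ : ℂ) h2
    simp only [map_sub, map_one, map_mul, Complex.conj_ofReal, map_inv₀, map_ofNat] at h5
    exact h5
  have h3 := h 1 zero_le_one le_rfl
  simp only [Complex.ofReal_one, one_mul] at h3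
  rw [diskSqrt, diskSqrt, map_mul, h t h0 h1, h3]

theorem continuousAt_diskSqrt {t : ℝ} (h0 : 0 ≤ t) (h1 : t ≤ 1) {x : ℂ} (hx : ‖x‖ ≤ 1) :
    ContinuousAt (diskSqrt t) x := by
  have h : ∀ s : ℝ, 0 ≤ s → s ≤ 1 → ContinuousAt (fun x : ℂ => (1 - s * x) ^ (2⁻¹ : ℂ)) x :=
    fun s hs0 hs1 => ContinuousAt.comp (f := fun x : ℂ => 1 - s * x)
      (continuousAt_sqrt_of_re_nonneg (re_one_sub_mul_nonneg hs0 hs1 hx)) (by fun_prop)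
  have h3 := h 1 zero_le_one le_rfl
  simp only [Complex.ofReal_one, one_mul] at h3
  exact h3.mul (h t h0 h1)

theorem differentiableAt_diskSqrt {t : ℝ} (h0 : 0 ≤ t) (h1 : t ≤ 1) {x : ℂ} (hx : ‖x‖ < 1) :
    DifferentiableAt ℂ (diskSqrt t) x := by
  have h : ∀ s : ℝ, 0 ≤ s → s ≤ 1 → DifferentiableAt ℂ (fun x : ℂ => (1 - s * x) ^ (2⁻¹ : ℂ)) x :=
    fun s hs0 hs1 => DifferentiableAt.cpow_const (by fun_prop)
      (Complex.mem_slitPlane_iff.mpr (Or.inl (re_one_sub_mul_pos hs0 hs1 hx)))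
  have h3 := h 1 zero_le_one le_rfl
  simp only [Complex.ofReal_one, one_mul] at h3
  exact h3.mul (h t h0 h1)

theorem norm_discAut_lt {ρ : ℝ} (h0 : 0 < ρ) (h1 : ρ < 1) {b : ℂ} (hb : ‖b‖ < 1) :
    ‖discAut ρ b‖ < 1 := by
  have h := one_sub_mul_ne_zero h0 h1 hb.le
  rw [discAut, norm_div, div_lt_one (norm_pos_iff.mpr h)]
  refine lt_of_pow_lt_pow_left₀ 2 (norm_nonneg _) ?_
  rw [← Complex.normSq_eq_norm_sq, ← Complex.normSq_eq_norm_sq]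
  have h2 : Complex.normSq b < 1 := by rw [Complex.normSq_eq_norm_sq]; nlinarith [norm_nonneg b]
  simp only [Complex.normSq_apply, Complex.add_re, Complex.mul_re, Complex.I_re, Complex.I_im,
    Complex.ofReal_re, Complex.ofReal_im, Complex.add_im, Complex.mul_im, Complex.sub_re,
    Complex.sub_im, Complex.one_re, Complex.one_im] at h2 ⊢
  nlinarith [mul_pos (sub_pos.mpr h2) (by nlinarith : (0:ℝ) < 1 - ρ ^ 2)]

/-- The function against which a polynomial of degree `n` is tested: its product with
`discPoly n ρ P` has mean value `coeff P n * (iρ) ^ n` over the unit circle. Here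
`ρ = 2β / (1 + β²)`. -/
noncomputable def testFun (ρ β : ℝ) (b : ℂ) : ℂ :=
  diskSqrt (β ^ 2) (b * discAut ρ b) / (1 - Complex.I * β * b)

variable {ρ β : ℝ}

theorem diffContOnCl_discPoly_mul_testFun (h0 : 0 < ρ) (h1 : ρ < 1) (hb0 : 0 < β) (hb1 : β < 1)
    (n : ℕ) (P : Polynomial ℂ) :
    DiffContOnCl ℂ (fun b => discPoly n ρ P b * testFun ρ β b) (Metric.ball 0 1) := by
  have hq : β ^ 2 ≤ 1 := by nlinarith
  constructor
  · intro b hb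
    have hb' : ‖b‖ < 1 := by simpa using hb
    have h2 : ‖b * discAut ρ b‖ < 1 := by
      rw [norm_mul]; nlinarith [norm_discAut_lt h0 h1 hb', norm_nonneg b, norm_nonneg (discAut ρ b)]
    have h3 : DifferentiableAt ℂ (fun b => diskSqrt (β ^ 2) (b * discAut ρ b)) b :=
      DifferentiableAt.comp b (g := diskSqrt (β ^ 2)) (f := fun b => b * discAut ρ b)
        (differentiableAt_diskSqrt (sq_nonneg β) hq h2)
        (differentiableAt_id.mul (differentiableAt_discAut h0 h1 b hb'.le))
    exact ((differentiableAt_discPoly n h0 h1 P hb'.le).mul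
      (h3.div (by fun_prop) (one_sub_mul_ne_zero hb0 hb1 hb'.le))).differentiableWithinAt
  · rw [closure_ball (0 : ℂ) one_ne_zero]
    intro b hb
    have hb' : ‖b‖ ≤ 1 := by simpa using hb
    have h2 : ‖b * discAut ρ b‖ ≤ 1 := by
      rw [norm_mul]; nlinarith [norm_discAut_le h0 h1 hb', norm_nonneg b, norm_nonneg (discAut ρ b)]
    have h3 : ContinuousAt (fun b => diskSqrt (β ^ 2) (b * discAut ρ b)) b :=
      ContinuousAt.comp (g := diskSqrt (β ^ 2)) (f := fun b => b * discAut ρ b)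
        (continuousAt_diskSqrt (sq_nonneg β) hq h2)
        (continuousAt_id.mul (differentiableAt_discAut h0 h1 b hb').continuousAt)
    exact ((differentiableAt_discPoly n h0 h1 P hb').continuousAt.mul
      (h3.div (by fun_prop) (one_sub_mul_ne_zero hb0 hb1 hb'))).continuousWithinAt

/-- `1 - w / 2 = |1 - iβb|² / ((1 + β²) κ²)` for the weight `w` and `κ = cos (arcAngle ρ φ)`. -/
theorem one_sub_arcWeight (h0 : 0 < ρ) (h1 : ρ < 1) (hρ : ρ * (1 + β ^ 2) = 2 * β) (φ : ℝ) :
    (1 - arcWeight ρ φ / 2) * ((1 + β ^ 2) * Real.cos (arcAngle ρ φ) ^ 2) =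
      Complex.normSq (1 - Complex.I * β * discPt ρ φ) := by
  have hk := cos_arcAngle_pos h0 h1 φ
  have hs := sin_arcAngle h0 h1 φ
  have hk2 := cos_sq_arcAngle h0 h1 φ
  have e1 : Complex.normSq (1 - Complex.I * β * discPt ρ φ) =
      1 + β ^ 2 - 2 * β * Real.sin (arcAngle ρ φ + φ) := by
    rw [Complex.normSq_apply]
    simp only [Complex.mul_re, Complex.I_re, Complex.I_im, discPt, circlePt_re, circlePt_im,
      Real.cos_neg, Real.sin_neg,
      Complex.ofReal_re, Complex.ofReal_im, Complex.mul_im, Complex.sub_re,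
      Complex.sub_im, Complex.one_re, Complex.one_im]
    have := Real.sin_sq_add_cos_sq (arcAngle ρ φ + φ)
    linear_combination β ^ 2 * this
  rw [e1, ← hρ, Real.sin_add, hs, arcWeight]
  have e2 : (1 - 2 * ρ * Real.sin φ / Real.cos (arcAngle ρ φ) / 2) * ((1 + β ^ 2) *
      Real.cos (arcAngle ρ φ) ^ 2) = (1 + β ^ 2) * (Real.cos (arcAngle ρ φ) ^ 2 -
        ρ * Real.sin φ * Real.cos (arcAngle ρ φ)) := by field_simp
  rw [e2, hk2]; ring

theorem norm_one_sub_sq_mul (h0 : 0 < ρ) (h1 : ρ < 1) (hρ : ρ * (1 + β ^ 2) = 2 * β) (φ : ℝ) :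
    ‖1 - ((β ^ 2 : ℝ) : ℂ) * circlePt (-(2 * φ))‖ =
      (1 + β ^ 2) * Real.cos (arcAngle ρ φ) := by
  have hk := cos_arcAngle_pos h0 h1 φ
  rw [← sq_eq_sq₀ (norm_nonneg _) (by positivity), ← Complex.normSq_eq_norm_sq,
    Complex.normSq_apply, mul_pow, cos_sq_arcAngle h0 h1 φ]
  simp only [Complex.mul_re, circlePt_re, circlePt_im, Real.cos_neg, Real.sin_neg,
    Complex.ofReal_re, Complex.ofReal_im, Complex.mul_im, Complex.sub_re,
    Complex.sub_im, Complex.one_re, Complex.one_im]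
  have h3 := Real.sin_sq_add_cos_sq (2 * φ)
  have h4 := Real.cos_two_mul φ
  linear_combination β ^ 4 * h3 - 2 * β ^ 2 * h4 +
    Real.cos φ ^ 2 * (ρ * (1 + β ^ 2) + 2 * β) * hρ

theorem normSq_diskSqrt (h0 : 0 < ρ) (h1 : ρ < 1) (hρ : ρ * (1 + β ^ 2) = 2 * β) (φ : ℝ) :
    Complex.normSq (diskSqrt (β ^ 2) (circlePt (-(2 * φ)))) =
      2 * |Real.sin φ| * ((1 + β ^ 2) * Real.cos (arcAngle ρ φ)) := by
  rw [Complex.normSq_eq_norm_sq, ← norm_pow, diskSqrt_sq, norm_mul, norm_one_sub_circlePt,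
    norm_one_sub_sq_mul h0 h1 hρ]

/-- The density against which `P` is integrated when `discPoly n ρ P * testFun ρ β` is averaged
over the unit circle in the parameter `φ`. -/
noncomputable def testDensity (n : ℕ) (ρ β φ : ℝ) : ℂ :=
  discPt ρ φ ^ n * diskSqrt (β ^ 2) (circlePt (-(2 * φ))) *
    (starRingEnd ℂ) (1 - Complex.I * β * discPt ρ φ) /
    (((1 + β ^ 2) * Real.cos (arcAngle ρ φ) ^ 2 : ℝ) : ℂ)

theorem continuous_testDensity (h0 : 0 < ρ) (h1 : ρ < 1) (hb0 : 0 < β) (hb1 : β < 1) (n : ℕ) :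
    Continuous (testDensity n ρ β) := by
  have h2 : Continuous fun φ : ℝ => diskSqrt (β ^ 2) (circlePt (-(2 * φ))) :=
    continuous_iff_continuousAt.mpr fun φ => ContinuousAt.comp (g := diskSqrt (β ^ 2))
      (f := fun φ : ℝ => circlePt (-(2 * φ)))
      (continuousAt_diskSqrt (sq_nonneg β) (by nlinarith) (by simp)) (by fun_prop)
  have h3 := continuous_discPt ρ
  have h4 := continuous_arcAngle ρ
  refine Continuous.div (((h3.pow n).mul h2).mul (Complex.continuous_conj.comp (by fun_prop)))
    (by fun_prop) fun φ => ?_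
  have hk := cos_arcAngle_pos h0 h1 φ
  exact_mod_cast (by positivity : (1 + β ^ 2) * Real.cos (arcAngle ρ φ) ^ 2 ≠ 0)

/-- The leading coefficient of `P` as an integral over the arc: the mean value property for
`discPoly n ρ P * testFun ρ β`, with the two points of the circle over each point of the arc
added up. -/
theorem integral_eval_mul_testDensity (h0 : 0 < ρ) (h1 : ρ < 1) (hb0 : 0 < β) (hb1 : β < 1)
    (hρ : ρ * (1 + β ^ 2) = 2 * β) {n : ℕ} {P : Polynomial ℂ} (hP : P.natDegree ≤ n) :
    ∫ φ in 0..Real.pi, P.eval (circlePt (2 * arcAngle ρ φ)) *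
      (testDensity n ρ β φ + testDensity n ρ β (-φ)) =
      2 * Real.pi * (P.coeff n * (Complex.I * ρ) ^ n) := by
  have h := integral_discPt_eq h0 h1 (diffContOnCl_discPoly_mul_testFun h0 h1 hb0 hb1 n P)
    (w := 0) (by simp)
  have hc : Continuous fun φ => P.eval (circlePt (2 * arcAngle ρ φ)) * testDensity n ρ β φ :=
    ((continuous_eval_circlePt P).comp ((continuous_arcAngle ρ).const_mul 2)).mul
      (continuous_testDensity h0 h1 hb0 hb1 n)
  have e0 : testFun ρ β 0 = 1 := by simp [testFun, diskSqrt]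
  rw [discPoly_zero, e0, mul_one] at h
  rw [← h]
  have e1 := integral_symm_interval hc Real.pi
  simp only [arcAngle_neg, ← mul_add] at e1
  rw [← e1]
  refine intervalIntegral.integral_congr fun φ _ => ?_
  have hk := cos_arcAngle_pos h0 h1 φ
  have hne : discPt ρ φ ≠ 0 := circlePt_ne_zero _
  have h2 : 1 - Complex.I * β * discPt ρ φ ≠ 0 :=
    one_sub_mul_ne_zero hb0 hb1 (norm_circlePt _).le
  have h3 := congrArg (fun x : ℝ => (x : ℂ)) (one_sub_arcWeight h0 h1 hρ φ)
  simp only [← Complex.mul_conj] at h3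
  rw [Complex.ofReal_mul] at h3
  have h4 : (((1 + β ^ 2) * Real.cos (arcAngle ρ φ) ^ 2 : ℝ) : ℂ) ≠ 0 := by
    exact_mod_cast (by positivity : (1 + β ^ 2) * Real.cos (arcAngle ρ φ) ^ 2 ≠ 0)
  simp only [sub_zero]
  rw [div_self hne, one_mul, discPoly_discPt hP h0 h1, testFun, discPt_mul_discAut h0 h1,
    testDensity, Complex.real_smul]
  rw [← eq_div_iff h4] at h3
  rw [h3]
  field_simp

/-- The product of the linear factors belonging to the two points of the circle over one point of
the arc. -/
theorem one_add_mul_one_sub (h0 : 0 < ρ) (h1 : ρ < 1) (hρ : ρ * (1 + β ^ 2) = 2 * β) (φ : ℝ) :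
    (1 + (β : ℂ) ^ 2) * ((1 + Complex.I * β * circlePt (arcAngle ρ φ + φ)) *
      (1 - Complex.I * β * circlePt (φ - arcAngle ρ φ))) =
      (1 - (β : ℂ) ^ 2) * (1 - ((β ^ 2 : ℝ) : ℂ) * circlePt (2 * φ)) := by
  have hsin := two_I_mul_sin (arcAngle ρ φ)
  rw [sin_arcAngle h0 h1, Complex.ofReal_mul] at hsin
  have hcos := two_mul_cos φ
  set ψ := arcAngle ρ φ
  have hx : circlePt φ * circlePt (-φ) = 1 := by
    rw [circlePt_neg, mul_inv_cancel₀ (circlePt_ne_zero _)]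
  have hy : circlePt ψ * circlePt (-ψ) = 1 := by
    rw [circlePt_neg, mul_inv_cancel₀ (circlePt_ne_zero _)]
  have hr := congrArg (fun x : ℝ => (x : ℂ)) hρ
  push_cast at hr
  rw [show 2 * φ = φ + φ by ring, show φ - ψ = φ + -ψ by ring, circlePt_add, circlePt_add,
    circlePt_add]
  push_cast
  have h2 : circlePt ψ - circlePt (-ψ) = Complex.I * ρ * (circlePt φ + circlePt (-φ)) := by
    rw [← hsin, ← hcos]; ring
  generalize circlePt φ = x at *
  generalize circlePt (-φ) = x' at *
  generalize circlePt ψ = y at *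
  generalize circlePt (-ψ) = y' at *
  generalize (β : ℂ) = b at *
  generalize (ρ : ℂ) = r at *
  linear_combination (1 + b ^ 2) * Complex.I * b * x * h2 - b * x * (x + x') * hr -
    2 * b ^ 2 * hx - (1 + b ^ 2) * b ^ 2 * x ^ 2 * Complex.I ^ 2 * hy +
    (x ^ 2 * r * b * (1 + b ^ 2) + x * x' * r * b * (1 + b ^ 2) -
      (1 + b ^ 2) * b ^ 2 * x ^ 2) * Complex.I_sq

/-- The cross term of the two halves of the density oscillates with frequency `2n`. -/
theorem testDensity_mul_conj (h0 : 0 < ρ) (h1 : ρ < 1) (hb0 : 0 < β) (hb1 : β < 1)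
    (hρ : ρ * (1 + β ^ 2) = 2 * β) (n : ℕ) (φ : ℝ) :
    testDensity n ρ β φ * (starRingEnd ℂ) (testDensity n ρ β (-φ)) =
      (((1 - β ^ 2) / (1 + β ^ 2) / Real.cos (arcAngle ρ φ) ^ 2 : ℝ) : ℂ) *
        (circlePt (-(2 * n * φ)) * (1 - circlePt (-(2 * φ)))) := by
  have hk := cos_arcAngle_pos h0 h1 φ
  have hkk := norm_one_sub_sq_mul h0 h1 hρ φ
  set ψ := arcAngle ρ φ with hψ
  have hd : discPt ρ φ = circlePt (-(ψ + φ)) := rfl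
  have hd' : discPt ρ (-φ) = circlePt (φ - ψ) := by
    rw [discPt, arcAngle_neg]; congr 1; ring
  have hpow : circlePt (-(ψ + φ)) ^ n * circlePt (-(φ - ψ)) ^ n = circlePt (-(2 * n * φ)) := by
    rw [← mul_pow, ← circlePt_add, circlePt, circlePt, ← Complex.exp_nat_mul]
    congr 1; push_cast; ring
  set e := circlePt (-(2 * φ)) with he
  have hconj : (starRingEnd ℂ) e = circlePt (2 * φ) := by rw [he, star_circlePt, neg_neg]
  have hK : (starRingEnd ℂ) (diskSqrt (β ^ 2) (circlePt (-(2 * -φ)))) = diskSqrt (β ^ 2) e := by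
    rw [← diskSqrt_conj (sq_nonneg β) (by nlinarith) (by simp), star_circlePt, he]
    congr 2; ring
  have hK2 := diskSqrt_sq (β ^ 2) e
  have hlin := one_add_mul_one_sub h0 h1 hρ φ
  have hnorm : (1 - ((β ^ 2 : ℝ) : ℂ) * e) * (1 - ((β ^ 2 : ℝ) : ℂ) * circlePt (2 * φ)) =
      (((1 + β ^ 2) * Real.cos ψ) ^ 2 : ℝ) := by
    rw [← hkk, ← Complex.normSq_eq_norm_sq, ← Complex.mul_conj, map_sub, map_one, map_mul,
      Complex.conj_ofReal, hconj]
  have hc1 : (starRingEnd ℂ) (1 - Complex.I * β * circlePt (-(ψ + φ))) =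
      1 + Complex.I * β * circlePt (ψ + φ) := by
    simp only [map_sub, map_one, map_mul, Complex.conj_I, Complex.conj_ofReal, star_circlePt,
      neg_neg]
    ring
  have hB : ((1 + β ^ 2 : ℝ) : ℂ) ≠ 0 := by exact_mod_cast (by positivity : 1 + β ^ 2 ≠ 0)
  have hk0 : ((Real.cos ψ : ℝ) : ℂ) ≠ 0 := by exact_mod_cast hk.ne'
  rw [testDensity, testDensity, arcAngle_neg, ← hψ, map_div₀, map_mul, map_mul, map_pow,
    Complex.conj_conj, Complex.conj_ofReal, hK, hd, hd', star_circlePt, hc1, ← hpow, ← he]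
  rw [div_mul_div_comm, div_eq_iff (by
    exact_mod_cast (by positivity : ((1 + β ^ 2) * Real.cos ψ ^ 2) *
      ((1 + β ^ 2) * Real.cos ψ ^ 2) ≠ 0))]
  push_cast at hB hk0 hnorm hK2 hlin ⊢
  field_simp
  refine mul_left_cancel₀ hB ?_
  linear_combination (1 + (β : ℂ) ^ 2) * (circlePt (-(ψ + φ)) ^ n * circlePt (-(φ - ψ)) ^ n) *
    ((1 + Complex.I * β * circlePt (ψ + φ)) * (1 - Complex.I * β * circlePt (φ - ψ))) * hK2 +
    (circlePt (-(ψ + φ)) ^ n * circlePt (-(φ - ψ)) ^ n) * (1 - e) * (1 - (β : ℂ) ^ 2 * e) * hlin +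
    (circlePt (-(ψ + φ)) ^ n * circlePt (-(φ - ψ)) ^ n) * (1 - e) * (1 - (β : ℂ) ^ 2) * hnorm

/-- The square of the density is, up to an oscillating term, a multiple of the density of arc
length, which makes the Cauchy–Schwarz inequality asymptotically sharp. -/
theorem normSq_testDensity_add (h0 : 0 < ρ) (h1 : ρ < 1) (hb0 : 0 < β) (hb1 : β < 1)
    (hρ : ρ * (1 + β ^ 2) = 2 * β) (n : ℕ) {φ : ℝ} (hφ : 0 ≤ Real.sin φ) :
    ‖testDensity n ρ β φ + testDensity n ρ β (-φ)‖ ^ 2 = arcWeight ρ φ * (2 / ρ * (1 +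
      (1 - β ^ 2) / (1 + β ^ 2) / Real.cos (arcAngle ρ φ) * Real.sin ((2 * n + 1) * φ))) := by
  have h : ∀ φ : ℝ, Complex.normSq (testDensity n ρ β φ) =
      2 * |Real.sin φ| * (1 - arcWeight ρ φ / 2) / Real.cos (arcAngle ρ φ) := fun φ => by
    have hk := cos_arcAngle_pos h0 h1 φ
    rw [testDensity, map_div₀, map_mul, map_mul, map_pow, Complex.normSq_conj,
      ← one_sub_arcWeight h0 h1 hρ, normSq_diskSqrt h0 h1 hρ, Complex.normSq_ofReal,
      Complex.normSq_eq_norm_sq, discPt, norm_circlePt, one_pow, one_pow, one_mul]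
    field_simp
  have hk := cos_arcAngle_pos h0 h1 φ
  have e2 : (circlePt (-(2 * n * φ)) * (1 - circlePt (-(2 * φ)))).re =
      2 * Real.sin φ * Real.sin ((2 * n + 1) * φ) := by
    rw [mul_sub, mul_one, ← circlePt_add, Complex.sub_re, circlePt_re, circlePt_re, Real.cos_sub_cos]
    rw [show (-(2 * n * φ) + (-(2 * n * φ) + -(2 * φ))) / 2 = -((2 * n + 1) * φ) by ring,
      show (-(2 * n * φ) - (-(2 * n * φ) + -(2 * φ))) / 2 = φ by ring, Real.sin_neg]
    ring
  rw [← Complex.normSq_eq_norm_sq, Complex.normSq_add, h, h,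
    testDensity_mul_conj h0 h1 hb0 hb1 hρ, Complex.re_ofReal_mul, e2, arcAngle_neg, arcWeight_neg,
    Real.sin_neg, abs_neg, abs_of_nonneg hφ, arcWeight]
  field_simp
  ring

/-- An oscillatory integral against a continuously differentiable function is `O(1 / m)`. -/
theorem norm_integral_mul_circlePt_le {g g' : ℝ → ℝ} (hg : ∀ x, HasDerivAt g (g' x) x)
    (hg' : Continuous g') {A D : ℝ} (hA : ∀ x, |g x| ≤ A) (hD : ∀ x, |g' x| ≤ D) {m : ℝ}
    (hm : 0 < m) :
    ‖∫ x in 0..Real.pi, (g x : ℂ) * circlePt (m * x)‖ ≤ (2 * A + D * Real.pi) / m := by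
  have hmc : (m : ℂ) ≠ 0 := by exact_mod_cast hm.ne'
  have hv : ∀ x : ℝ, HasDerivAt (fun x : ℝ => circlePt (m * x) / (Complex.I * m))
      (circlePt (m * x)) x := fun x => by
    have h := ((hasDerivAt_circlePt (m * x)).scomp x ((hasDerivAt_id x).const_mul m)).div_const
      (Complex.I * m)
    refine h.congr_deriv ?_
    rw [Complex.real_smul]
    field_simp [Complex.I_ne_zero]
  have h := intervalIntegral.integral_mul_deriv_eq_deriv_mul (a := 0) (b := Real.pi)
    (fun x _ => (hg x).ofReal_comp) (fun x _ => hv x)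
    ((Complex.continuous_ofReal.comp hg').intervalIntegrable _ _)
    (Continuous.intervalIntegrable (by fun_prop) _ _)
  rw [h]
  have hcos : ∀ x, ‖circlePt (m * x) / (Complex.I * m)‖ ≤ 1 / m := fun x => by
    simp [abs_of_pos hm]
  have hb : ∀ (x : ℝ) (y : ℂ), |x| ≤ A → ‖y‖ ≤ 1 / m → ‖(x : ℂ) * y‖ ≤ A * (1 / m) :=
    fun x y hx hy => by
      rw [norm_mul, Complex.norm_real, Real.norm_eq_abs]
      have := (abs_nonneg x).trans hx
      gcongr
  have h1 := hb _ _ (hA Real.pi) (hcos Real.pi)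
  have h2 := hb _ _ (hA 0) (hcos 0)
  have h3 : ‖∫ x in 0..Real.pi, (g' x : ℂ) * (circlePt (m * x) / (Complex.I * m))‖ ≤
      D * (1 / m) * |Real.pi - 0| := by
    refine intervalIntegral.norm_integral_le_of_norm_le_const fun x _ => ?_
    rw [norm_mul, Complex.norm_real, Real.norm_eq_abs]
    have := (abs_nonneg _).trans (hD x)
    exact mul_le_mul (hD x) (hcos x) (norm_nonneg _) this
  rw [sub_zero, abs_of_pos Real.pi_pos] at h3
  calc _ ≤ A * (1 / m) + A * (1 / m) + D * (1 / m) * Real.pi :=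
        (norm_sub_le _ _).trans (add_le_add ((norm_sub_le _ _).trans (add_le_add h1 h2)) h3)
    _ = _ := by ring

theorem abs_integral_mul_sin_le {g g' : ℝ → ℝ} (hg : ∀ x, HasDerivAt g (g' x) x)
    (hg' : Continuous g') {A D : ℝ} (hA : ∀ x, |g x| ≤ A) (hD : ∀ x, |g' x| ≤ D) {m : ℝ}
    (hm : 0 < m) : |∫ x in 0..Real.pi, g x * Real.sin (m * x)| ≤ (2 * A + D * Real.pi) / m := by
  refine le_trans ?_ (norm_integral_mul_circlePt_le hg hg' hA hD hm)
  have hc : Continuous g := continuous_iff_continuousAt.mpr fun x => (hg x).continuousAt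
  have h := Complex.imCLM.intervalIntegral_comp_comm (μ := MeasureTheory.volume)
    (a := 0) (b := Real.pi) (f := fun x : ℝ => (g x : ℂ) * circlePt (m * x))
    (Continuous.intervalIntegrable (by fun_prop) _ _)
  have e : ∫ x in 0..Real.pi, g x * Real.sin (m * x) =
      (∫ x in 0..Real.pi, (g x : ℂ) * circlePt (m * x)).im := by
    refine Eq.trans ?_ h
    refine intervalIntegral.integral_congr fun x _ => ?_
    simp [circlePt_im]
  rw [e]
  exact Complex.abs_im_le_norm _

theorem hasDerivAt_inv_cos_arcAngle (h0 : 0 < ρ) (h1 : ρ < 1) (φ : ℝ) :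
    HasDerivAt (fun φ => (Real.cos (arcAngle ρ φ))⁻¹)
      (-(Real.sin (arcAngle ρ φ) * (arcWeight ρ φ / 2)) / Real.cos (arcAngle ρ φ) ^ 2) φ := by
  have h := ((Real.hasDerivAt_cos _).comp φ (hasDerivAt_arcAngle h0 h1 φ)).fun_inv
    (cos_arcAngle_pos h0 h1 φ).ne'
  refine h.congr_deriv ?_
  simp only [Function.comp_apply]
  ring

theorem le_cos_arcAngle (h0 : 0 < ρ) (h1 : ρ < 1) {c : ℝ} (hc : c ^ 2 ≤ 1 - ρ ^ 2)
    (φ : ℝ) : c ≤ Real.cos (arcAngle ρ φ) := by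
  refine le_of_sq_le_sq ?_ (cos_arcAngle_pos h0 h1 φ).le
  rw [cos_sq_arcAngle h0 h1]
  nlinarith [Real.sin_sq_add_cos_sq φ, sq_nonneg (Real.sin φ), sq_nonneg ρ]

/-- The energy on the arc of a monic polynomial of degree `n` is at least
`ρ ^ (2n + 1) (1 - O(1 / n))`. -/
theorem le_energy_zero_of_monic (h0 : 0 < ρ) (h1 : ρ < 1) (hb0 : 0 < β) (hb1 : β < 1)
    (hρ : ρ * (1 + β ^ 2) = 2 * β) {c : ℝ} (hc : c = (1 - β ^ 2) / (1 + β ^ 2)) {n : ℕ}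
    {P : Polynomial ℂ} (hP : P.natDegree ≤ n) (hcoeff : P.coeff n = 1) :
    ρ ^ (2 * n + 1) * (1 - (2 + Real.pi / c) / (Real.pi * (2 * n + 1))) ≤
      energy (2 * Real.arcsin ρ) 0 P := by
  have hpi := Real.pi_pos
  have hc0 : 0 < c := by rw [hc]; have : β ^ 2 < 1 := by nlinarith
                         have : 0 < 1 - β ^ 2 := by linarith
                         positivity
  have hcρ : c ^ 2 = 1 - ρ ^ 2 := by
    have : ρ = 2 * β / (1 + β ^ 2) := by rw [eq_div_iff (by positivity), hρ]
    rw [hc, this]; field_simp; ring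
  have hk := le_cos_arcAngle h0 h1 hcρ.le
  have hkpos := cos_arcAngle_pos h0 h1
  have hm : (0 : ℝ) < 2 * n + 1 := by positivity
  -- oscillatory part of the integral of the density
  have hosc := abs_integral_mul_sin_le (g := fun φ => c * (Real.cos (arcAngle ρ φ))⁻¹)
    (g' := fun φ => c * (-(Real.sin (arcAngle ρ φ) * (arcWeight ρ φ / 2)) /
      Real.cos (arcAngle ρ φ) ^ 2)) (A := 1) (D := 1 / c) (m := 2 * n + 1)
    (fun φ => (hasDerivAt_inv_cos_arcAngle h0 h1 φ).const_mul c)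
    (by
      have h2 := continuous_arcWeight h0 h1
      have h3 := continuous_arcAngle ρ
      exact continuous_const.mul (Continuous.div (by fun_prop) (by fun_prop)
        fun φ => (pow_pos (hkpos φ) 2).ne'))
    (fun φ => by
      rw [abs_of_pos (mul_pos hc0 (inv_pos.mpr (hkpos φ))), ← div_eq_mul_inv,
        div_le_one (hkpos φ)]
      exact hk φ)
    (fun φ => by
      rw [abs_mul, abs_of_pos hc0, abs_div, abs_neg, abs_mul, abs_div, abs_two,
        abs_of_pos (pow_pos (hkpos φ) 2)]
      have h2 := Real.abs_sin_le_one (arcAngle ρ φ)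
      have h3 := abs_arcWeight_le h0 h1 φ
      have h4 : |Real.sin (arcAngle ρ φ)| * (|arcWeight ρ φ| / 2) ≤ 1 * 1 := by
        gcongr; linarith
      calc _ ≤ c * ((1 * 1) / c ^ 2) := by
            have := hk φ
            gcongr
        _ = _ := by field_simp) hm
  have hint := integral_eval_mul_testDensity h0 h1 hb0 hb1 hρ hP
  rw [hcoeff, one_mul] at hint
  set T := fun φ => testDensity n ρ β φ + testDensity n ρ β (-φ) with hT
  set p := fun φ => ‖P.eval (circlePt (2 * arcAngle ρ φ))‖ with hp
  set N := fun φ => 2 / ρ * (1 + (c * (Real.cos (arcAngle ρ φ))⁻¹) * Real.sin ((2 * n + 1) * φ))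
    with hN
  -- the weight in the inequality between the means that is optimal when the energy is
  -- `ρ ^ (2n + 1)`
  set L := ρ ^ (n + 1) with hL
  have hL0 : 0 < L := by positivity
  have hwc := continuous_arcWeight h0 h1
  have hpc : Continuous p :=
    ((continuous_eval_circlePt P).comp ((continuous_arcAngle ρ).const_mul 2)).norm
  have hNc : Continuous N := by
    have h3 := continuous_arcAngle ρ
    have h4 : Continuous fun φ => (Real.cos (arcAngle ρ φ))⁻¹ :=
      Continuous.inv₀ (by fun_prop) fun φ => (hkpos φ).ne'
    fun_prop
  have hle : 2 * Real.pi * ρ ^ n ≤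
      ∫ φ in 0..Real.pi, (L⁻¹ / 2 * (arcWeight ρ φ * p φ ^ 2) + L / 2 * N φ) := by
    have e : ‖2 * (Real.pi : ℂ) * (Complex.I * ρ) ^ n‖ = 2 * Real.pi * ρ ^ n := by
      simp [abs_of_pos hpi, abs_of_pos h0]
    rw [← e, ← hint]
    refine intervalIntegral.norm_integral_le_of_norm_le hpi.le
      (Filter.Eventually.of_forall fun φ hφ => ?_) (Continuous.intervalIntegrable (by fun_prop) _ _)
    have hs : 0 ≤ Real.sin φ := Real.sin_nonneg_of_mem_Icc ⟨hφ.1.le, hφ.2⟩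
    have hw := arcWeight_nonneg h0 h1 hs
    have hTn := normSq_testDensity_add h0 h1 hb0 hb1 hρ n hs
    rw [norm_mul]
    change p φ * ‖T φ‖ ≤ _
    have hTN : ‖T φ‖ ^ 2 = arcWeight ρ φ * N φ := by
      rw [hTn, ← hc, div_eq_mul_inv c]
    have hN0 : 0 ≤ N φ := by
      have h2 : |c * (Real.cos (arcAngle ρ φ))⁻¹ * Real.sin ((2 * n + 1) * φ)| ≤ 1 := by
        rw [abs_mul, abs_of_pos (mul_pos hc0 (inv_pos.mpr (hkpos φ)))]
        have h3 : c * (Real.cos (arcAngle ρ φ))⁻¹ ≤ 1 := by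
          rw [← div_eq_mul_inv, div_le_one (hkpos φ)]; exact hk φ
        exact mul_le_one₀ h3 (abs_nonneg _) (Real.abs_sin_le_one _)
      have := (abs_le.mp h2).1
      exact mul_nonneg (by positivity) (by linarith)
    -- weighted inequality between the arithmetic and the geometric mean
    have hw2 : 0 ≤ L⁻¹ / 2 * (arcWeight ρ φ * p φ ^ 2) + L / 2 * N φ := by positivity
    refine (abs_le_of_sq_le_sq' ?_ hw2).2
    rw [mul_pow, hTN]
    have h5 : L⁻¹ * L = 1 := inv_mul_cancel₀ hL0.ne'
    have h6 := sq_nonneg (L⁻¹ / 2 * (arcWeight ρ φ * p φ ^ 2) - L / 2 * N φ)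
    have h7 : (L⁻¹ / 2 * (arcWeight ρ φ * p φ ^ 2) + L / 2 * N φ) ^ 2 =
      (L⁻¹ / 2 * (arcWeight ρ φ * p φ ^ 2) - L / 2 * N φ) ^ 2 +
        (L⁻¹ * L) * (p φ ^ 2 * (arcWeight ρ φ * N φ)) := by ring
    rw [h7, h5]; linarith
  have hE := energy_zero_eq_integral h0 h1 P
  have hNint : ∫ φ in 0..Real.pi, N φ ≤ 2 / ρ * (Real.pi + (2 + Real.pi / c) / (2 * n + 1)) := by
    have h4 : Continuous fun φ => (Real.cos (arcAngle ρ φ))⁻¹ :=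
      Continuous.inv₀ (Real.continuous_cos.comp (continuous_arcAngle ρ)) fun φ => (hkpos φ).ne'
    rw [intervalIntegral.integral_const_mul, intervalIntegral.integral_add
      (Continuous.intervalIntegrable (by fun_prop) _ _)
      (Continuous.intervalIntegrable (by fun_prop) _ _)]
    have h5 := (le_abs_self _).trans hosc
    have h6 : (2 * 1 + 1 / c * Real.pi) / (2 * (n : ℝ) + 1) = (2 + Real.pi / c) / (2 * n + 1) := by
      ring
    rw [h6] at h5
    simp only [intervalIntegral.integral_const, sub_zero, smul_eq_mul, mul_one]
    gcongr
  rw [intervalIntegral.integral_add (Continuous.intervalIntegrable (by fun_prop) _ _)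
      (Continuous.intervalIntegrable (by fun_prop) _ _), intervalIntegral.integral_const_mul,
      intervalIntegral.integral_const_mul, ← hE] at hle
  set E := energy (2 * Real.arcsin ρ) 0 P
  set δ := (2 + Real.pi / c) / (2 * n + 1) with hδ
  have h8 : 2 * Real.pi * ρ ^ n ≤ L⁻¹ / 2 * (2 * Real.pi * E) +
      L / 2 * (2 / ρ * (Real.pi + δ)) := hle.trans (by gcongr)
  have h9 : L / 2 * (2 / ρ * (Real.pi + δ)) = ρ ^ n * (Real.pi + δ) := by
    rw [hL, pow_succ]; field_simp
  rw [h9] at h8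
  have h10 : ρ ^ n * (Real.pi - δ) ≤ L⁻¹ * (Real.pi * E) := by linarith
  have h11 : L * (ρ ^ n * (Real.pi - δ)) ≤ Real.pi * E := by
    calc _ ≤ L * (L⁻¹ * (Real.pi * E)) := by gcongr
      _ = _ := mul_inv_cancel_left₀ hL0.ne' _
  have h12 : ρ ^ (2 * n + 1) * (1 - (2 + Real.pi / c) / (Real.pi * (2 * n + 1))) =
      L * (ρ ^ n * (Real.pi - δ)) / Real.pi := by
    rw [hL, hδ]
    field_simp
    ring
  rw [h12, div_le_iff₀ hpi]
  linarith

end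

/-! ### Polynomial approximation of `(1 - x) ^ (-1/2)` in the unit disc -/

/-- The Taylor coefficients of `(1 - x) ^ (-1/2)` at the origin. -/
noncomputable def invSqrtCoeff (k : ℕ) : ℝ := Ring.multichoose (1 / 2 : ℝ) k

theorem invSqrtCoeff_zero : invSqrtCoeff 0 = 1 := Ring.multichoose_zero_right _

theorem invSqrtCoeff_nonneg (k : ℕ) : 0 ≤ invSqrtCoeff k := by
  have h := Ring.factorial_nsmul_multichoose_eq_ascPochhammer (1 / 2 : ℝ) k
  have h2 : 0 < (ascPochhammer ℝ k).eval (1 / 2) := ascPochhammer_pos k _ (by norm_num)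
  rw [Polynomial.ascPochhammer_smeval_eq_eval, nsmul_eq_mul] at h
  have h3 : (0 : ℝ) < (k.factorial : ℝ) := by exact_mod_cast k.factorial_pos
  exact (pos_of_mul_pos_right (h ▸ h2) h3.le).le

/-- The square of the series is the geometric series. -/
theorem sum_invSqrtCoeff_mul (k : ℕ) : ∑ x ∈ Finset.HasAntidiagonal.antidiagonal k,
    invSqrtCoeff x.1 * invSqrtCoeff x.2 = 1 := by
  have h := Ring.add_choose_eq k (Commute.all (-(1 / 2 : ℝ)) (-(1 / 2)))
  have h2 : ∀ n, invSqrtCoeff n = (-1) ^ n * Ring.choose (-(1 / 2 : ℝ)) n := fun n => by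
    rw [Ring.choose_neg', invSqrtCoeff, Int.negOnePow_def, Units.smul_def]
    simp [← mul_assoc, ← mul_pow]
  have h3 : (1 : ℝ) = (-1) ^ k * Ring.choose (-1 : ℝ) k := by
    rw [Ring.choose_neg', Ring.multichoose_one, Int.negOnePow_def, Units.smul_def]
    simp [← mul_pow]
  rw [show -(1 / 2 : ℝ) + -(1 / 2) = -1 by norm_num] at h
  rw [h3, h, Finset.mul_sum]
  refine Finset.sum_congr rfl fun x hx => ?_
  have hk : x.1 + x.2 = k := Finset.HasAntidiagonal.mem_antidiagonal.mp hx
  rw [h2, h2, ← hk, pow_add]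
  ring

theorem invSqrtCoeff_le_one (k : ℕ) : invSqrtCoeff k ≤ 1 := by
  rw [← sum_invSqrtCoeff_mul k]
  have h := Finset.single_le_sum (s := Finset.HasAntidiagonal.antidiagonal k)
    (f := fun x : ℕ × ℕ => invSqrtCoeff x.1 * invSqrtCoeff x.2)
    (fun x _ => mul_nonneg (invSqrtCoeff_nonneg _) (invSqrtCoeff_nonneg _)) (a := (0, k))
    (Finset.HasAntidiagonal.mem_antidiagonal.mpr (zero_add k))
  simpa [invSqrtCoeff_zero] using h

theorem summable_norm_invSqrt {x : ℂ} (hx : ‖x‖ < 1) :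
    Summable fun k => ‖(invSqrtCoeff k : ℂ) * x ^ k‖ := by
  refine Summable.of_nonneg_of_le (fun k => norm_nonneg _) (fun k => ?_)
    (summable_geometric_of_lt_one (norm_nonneg x) hx)
  rw [norm_mul, norm_pow, Complex.norm_real, Real.norm_eq_abs, abs_of_nonneg (invSqrtCoeff_nonneg k)]
  exact mul_le_of_le_one_left (by positivity) (invSqrtCoeff_le_one k)

theorem sq_tsum_invSqrt {x : ℂ} (hx : ‖x‖ < 1) :
    (∑' k, (invSqrtCoeff k : ℂ) * x ^ k) ^ 2 = (1 - x)⁻¹ := by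
  rw [sq, tsum_mul_tsum_eq_tsum_sum_antidiagonal_of_summable_norm (summable_norm_invSqrt hx)
    (summable_norm_invSqrt hx), ← tsum_geometric_of_norm_lt_one hx]
  refine tsum_congr fun n => ?_
  have h := congrArg (fun x : ℝ => (x : ℂ)) (sum_invSqrtCoeff_mul n)
  push_cast at h
  rw [← one_mul (x ^ n), ← h, Finset.sum_mul]
  refine Finset.sum_congr rfl fun k hk => ?_
  rw [← (Finset.HasAntidiagonal.mem_antidiagonal.mp hk : k.1 + k.2 = n), pow_add]
  ring

/-- The Taylor polynomial of degree `m` of `(1 - t x) ^ (-1/2)`. -/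
noncomputable def invSqrtPoly (t : ℝ) (m : ℕ) : Polynomial ℝ :=
  ∑ k ∈ Finset.range (m + 1), Polynomial.C (invSqrtCoeff k * t ^ k) * Polynomial.X ^ k

theorem natDegree_invSqrtPoly_le (t : ℝ) (m : ℕ) : (invSqrtPoly t m).natDegree ≤ m :=
  Polynomial.natDegree_sum_le_of_forall_le _ _ fun _ hk =>
    (Polynomial.natDegree_C_mul_X_pow_le _ _).trans (Nat.lt_succ_iff.mp (Finset.mem_range.mp hk))

theorem coeff_invSqrtPoly (t : ℝ) (m k : ℕ) :
    (invSqrtPoly t m).coeff k = if k ≤ m then invSqrtCoeff k * t ^ k else 0 := by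
  simp only [invSqrtPoly, Polynomial.finsetSum_coeff, Polynomial.coeff_C_mul_X_pow,
    Finset.sum_ite_eq, Finset.mem_range, Nat.lt_succ_iff]

theorem coeff_invSqrtPoly_nonneg {t : ℝ} (ht : 0 ≤ t) (m k : ℕ) :
    0 ≤ (invSqrtPoly t m).coeff k := by
  rw [coeff_invSqrtPoly]
  split_ifs
  · exact mul_nonneg (invSqrtCoeff_nonneg k) (by positivity)
  · exact le_rfl

theorem coeff_zero_invSqrtPoly (t : ℝ) (m : ℕ) : (invSqrtPoly t m).coeff 0 = 1 := by
  simp [coeff_invSqrtPoly, invSqrtCoeff_zero]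

theorem aeval_invSqrtPoly (t : ℝ) (m : ℕ) (x : ℂ) : Polynomial.aeval x (invSqrtPoly t m) =
    ∑ k ∈ Finset.range (m + 1), (invSqrtCoeff k : ℂ) * (t * x) ^ k := by
  simp only [invSqrtPoly, map_sum, map_mul, Polynomial.aeval_C, map_pow, Polynomial.aeval_X,
    Complex.coe_algebraMap, mul_pow, mul_assoc]

theorem sq_eval_one_invSqrtPoly_le {t : ℝ} (h0 : 0 ≤ t) (h1 : t < 1) (m : ℕ) :
    (invSqrtPoly t m).eval 1 ^ 2 ≤ (1 - t)⁻¹ := by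
  have ht : ‖(t : ℂ)‖ < 1 := by rw [Complex.norm_real, Real.norm_eq_abs, abs_of_nonneg h0]; exact h1
  have hs : Summable fun k => invSqrtCoeff k * t ^ k := by
    have := summable_norm_invSqrt ht
    refine this.congr fun k => ?_
    rw [norm_mul, norm_pow, Complex.norm_real, Complex.norm_real, Real.norm_eq_abs,
      Real.norm_eq_abs, abs_of_nonneg (invSqrtCoeff_nonneg k), abs_of_nonneg h0]
  have h2 := sq_tsum_invSqrt ht
  have h3 : (∑' k, invSqrtCoeff k * t ^ k) ^ 2 = (1 - t)⁻¹ := by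
    exact_mod_cast h2
  rw [← h3]
  have h4 : (invSqrtPoly t m).eval 1 = ∑ k ∈ Finset.range (m + 1), invSqrtCoeff k * t ^ k := by
    simp [invSqrtPoly, Polynomial.eval_finsetSum]
  have h5 : ∀ k, 0 ≤ invSqrtCoeff k * t ^ k := fun k =>
    mul_nonneg (invSqrtCoeff_nonneg k) (by positivity)
  rw [h4]
  have := Finset.sum_nonneg (s := Finset.range (m + 1)) fun k _ => h5 k
  gcongr
  exact hs.sum_le_tsum _ fun k _ => h5 k

/-- The truncation error of the Taylor polynomial, for the squares of the absolute values. -/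
theorem sq_norm_aeval_invSqrtPoly_le {t : ℝ} (h0 : 0 ≤ t) (h1 : t < 1) (m : ℕ) {x : ℂ}
    (hx : ‖x‖ ≤ 1) {δ : ℝ} (hδ : t ^ (m + 1) / (1 - t) ≤ δ) :
    ‖Polynomial.aeval x (invSqrtPoly t m)‖ ^ 2 ≤ (1 + δ) * ‖1 - t * x‖⁻¹ + (δ + δ ^ 2) := by
  have htx : ‖(t : ℂ) * x‖ ≤ t := by
    rw [norm_mul, Complex.norm_real, Real.norm_eq_abs, abs_of_nonneg h0]
    exact mul_le_of_le_one_right h0 hx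
  have htx1 := htx.trans_lt h1
  have hsum := summable_norm_invSqrt htx1
  set S := ∑' k, (invSqrtCoeff k : ℂ) * (t * x) ^ k with hS
  have hS2 : ‖S‖ ^ 2 = ‖1 - t * x‖⁻¹ := by rw [← norm_pow, hS, sq_tsum_invSqrt htx1, norm_inv]
  have htail : ‖S - Polynomial.aeval x (invSqrtPoly t m)‖ ≤ δ := by
    rw [aeval_invSqrtPoly, hS, ← hsum.of_norm.sum_add_tsum_nat_add (m + 1), add_sub_cancel_left]
    refine le_trans ?_ hδ
    have hg := (hasSum_geometric_of_lt_one h0 h1).mul_left (t ^ (m + 1))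
    rw [div_eq_mul_inv]
    refine tsum_of_norm_bounded hg fun k => ?_
    rw [norm_mul, norm_pow, Complex.norm_real, Real.norm_eq_abs,
      abs_of_nonneg (invSqrtCoeff_nonneg _), ← pow_add, add_comm (m + 1) k]
    calc _ ≤ 1 * t ^ (k + (m + 1)) := by
          gcongr
          exact invSqrtCoeff_le_one _
      _ = _ := one_mul _
  have hδ0 : 0 ≤ δ := (norm_nonneg _).trans htail
  have h2 : ‖Polynomial.aeval x (invSqrtPoly t m)‖ ≤ ‖S‖ + δ := by
    have h3 := norm_sub_norm_le (Polynomial.aeval x (invSqrtPoly t m)) S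
    rw [norm_sub_rev] at h3
    linarith
  rw [← hS2]
  calc _ ≤ (‖S‖ + δ) ^ 2 := by gcongr
    _ ≤ _ := by nlinarith [mul_nonneg hδ0 (sq_nonneg (‖S‖ - 1))]

/-- The polynomial `invSqrtPoly t m` is almost an inverse square root of `1 - s x`. -/
theorem norm_mul_sq_norm_aeval_invSqrtPoly_le {s t : ℝ} (h0 : 0 ≤ t) (h1 : t < 1) (hs : s ≤ 1)
    (hts : t ≤ s) (m : ℕ) {x : ℂ} (hx : ‖x‖ ≤ 1) {δ : ℝ} (hδ : t ^ (m + 1) / (1 - t) ≤ δ)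
    (hδ1 : δ ≤ 1) {K : ℝ} (hK2 : K ≤ 2) (hK : ‖1 - s * x‖ ≤ K * ‖1 - t * x‖) :
    ‖1 - s * x‖ * ‖Polynomial.aeval x (invSqrtPoly t m)‖ ^ 2 ≤ K + 6 * δ := by
  have h := sq_norm_aeval_invSqrtPoly_le h0 h1 m hx hδ
  have hδ0 : 0 ≤ δ := le_trans (div_nonneg (by positivity) (by linarith)) hδ
  have hv : 0 < ‖1 - t * x‖ := by
    refine norm_pos_iff.mpr fun h2 => ?_
    have h3 : ‖(t : ℂ) * x‖ = 1 := by rw [← sub_eq_zero.mp h2]; simp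
    rw [norm_mul, Complex.norm_real, Real.norm_eq_abs, abs_of_nonneg h0] at h3
    nlinarith [norm_nonneg x]
  have hu : ‖1 - s * x‖ ≤ 2 := by
    refine (norm_sub_le _ _).trans ?_
    rw [norm_one, norm_mul, Complex.norm_real, Real.norm_eq_abs, abs_of_nonneg (h0.trans hts)]
    nlinarith [norm_nonneg x, h0.trans hts]
  have huv : ‖1 - s * x‖ * ‖1 - t * x‖⁻¹ ≤ K := by
    rw [← div_eq_mul_inv, div_le_iff₀ hv]; exact hK
  calc _ ≤ ‖1 - s * x‖ * ((1 + δ) * ‖1 - t * x‖⁻¹ + (δ + δ ^ 2)) := by gcongr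
    _ = (1 + δ) * (‖1 - s * x‖ * ‖1 - t * x‖⁻¹) + ‖1 - s * x‖ * (δ + δ ^ 2) := by ring
    _ ≤ (1 + δ) * K + 2 * (δ + δ ^ 2) := by gcongr
    _ ≤ _ := by nlinarith

theorem norm_one_sub_le_mul {t : ℝ} (h0 : 0 ≤ t) {x : ℂ} (hx : ‖x‖ = 1) :
    ‖1 - ((1 : ℝ) : ℂ) * x‖ ≤ 2 / (1 + t) * ‖1 - t * x‖ := by
  rw [div_mul_eq_mul_div, le_div_iff₀ (by linarith)]
  refine le_of_sq_le_sq ?_ (by positivity)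
  rw [mul_pow, mul_pow, ← Complex.normSq_eq_norm_sq, ← Complex.normSq_eq_norm_sq]
  have h2 : Complex.normSq x = 1 := by rw [Complex.normSq_eq_norm_sq, hx, one_pow]
  have h3 : -1 ≤ x.re := by
    have := (abs_le.mp ((Complex.abs_re_le_norm x).trans hx.le)).1
    exact this
  simp only [Complex.normSq_apply, Complex.mul_re, Complex.ofReal_re, Complex.ofReal_im,
    Complex.mul_im, Complex.sub_re, Complex.sub_im, Complex.one_re, Complex.one_im] at h2 ⊢
  nlinarith [mul_nonneg (sq_nonneg (1 - t)) (by linarith : 0 ≤ 1 + x.re)]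

/-! ### The upper bound for the minimal energy -/

/-- Polynomials that are, up to the factor `e^{ijψ}`, Chebyshev polynomials on the arc: the value
of `arcCheb ρ j` at `e^{2iψ}`, `sin ψ = ρ cos φ`, is `2 e^{ijψ} cos (jφ)`. -/
noncomputable def arcCheb (ρ : ℝ) : ℕ → Polynomial ℂ
  | 0 => 2
  | 1 => Polynomial.C (Complex.I * ρ)⁻¹ * (Polynomial.X - 1)
  | j + 2 => Polynomial.C (Complex.I * ρ)⁻¹ * ((Polynomial.X - 1) * arcCheb ρ (j + 1)) -
      Polynomial.X * arcCheb ρ j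

section
variable {ρ β : ℝ}

open Polynomial in
theorem natDegree_arcCheb_le (ρ : ℝ) : ∀ j, (arcCheb ρ j).natDegree ≤ j
  | 0 => by rw [arcCheb]; exact (natDegree_ofNat 2).le
  | 1 => by rw [arcCheb]; compute_degree
  | j + 2 => by
    have h1 := natDegree_arcCheb_le ρ j
    have h2 := natDegree_arcCheb_le ρ (j + 1)
    rw [arcCheb]
    refine (natDegree_sub_le _ _).trans (max_le ?_ ?_)
    · refine (natDegree_C_mul_le _ _).trans (natDegree_mul_le.trans ?_)
      have : (X - 1 : ℂ[X]).natDegree ≤ 1 := by compute_degree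
      omega
    · refine natDegree_mul_le.trans ?_
      have := natDegree_X_le (R := ℂ)
      omega

open Polynomial in
theorem coeff_arcCheb (ρ : ℝ) : ∀ j, (arcCheb ρ (j + 1)).coeff (j + 1) =
    (Complex.I * ρ : ℂ)⁻¹ ^ (j + 1)
  | 0 => by rw [zero_add, arcCheb, coeff_C_mul, coeff_sub, coeff_X_one, coeff_one]; simp
  | j + 1 => by
    have h1 := natDegree_arcCheb_le ρ j
    have h2 := natDegree_arcCheb_le ρ (j + 1)
    rw [arcCheb, coeff_sub, coeff_C_mul, sub_mul, one_mul, coeff_sub, coeff_X_mul, coeff_X_mul,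
      coeff_eq_zero_of_natDegree_lt (h2.trans_lt (Nat.lt_succ_self _)),
      coeff_eq_zero_of_natDegree_lt (h1.trans_lt (Nat.lt_succ_self _)), coeff_arcCheb ρ j]
    ring

theorem circlePt_mul_circlePt_neg (φ : ℝ) : circlePt φ * circlePt (-φ) = 1 := by
  rw [circlePt_neg, mul_inv_cancel₀ (circlePt_ne_zero _)]

theorem circlePt_nat_mul (j : ℕ) (a : ℝ) : circlePt (j * a) = circlePt a ^ j := by
  rw [circlePt, circlePt, ← Complex.exp_nat_mul]
  congr 1; push_cast; ring

theorem circlePt_two_mul (a : ℝ) : circlePt (2 * a) = circlePt a ^ 2 := circlePt_nat_mul 2 a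

theorem circlePt_two_mul_arcAngle_sub_one (h0 : 0 < ρ) (h1 : ρ < 1) (φ : ℝ) :
    circlePt (2 * arcAngle ρ φ) - 1 =
      Complex.I * ρ * (circlePt (arcAngle ρ φ) * (circlePt φ + circlePt (-φ))) := by
  have hsin := two_I_mul_sin (arcAngle ρ φ)
  rw [sin_arcAngle h0 h1, Complex.ofReal_mul] at hsin
  have hcos := two_mul_cos φ
  have hy := circlePt_mul_circlePt_neg (arcAngle ρ φ)
  rw [circlePt_two_mul]
  linear_combination (-circlePt (arcAngle ρ φ)) * hsin + hy +
    circlePt (arcAngle ρ φ) * Complex.I * ρ * hcos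

theorem eval_arcCheb (h0 : 0 < ρ) (h1 : ρ < 1) (φ : ℝ) : ∀ j : ℕ,
    (arcCheb ρ j).eval (circlePt (2 * arcAngle ρ φ)) =
      circlePt (j * arcAngle ρ φ) * (circlePt (j * φ) + circlePt (-(j * φ)))
  | 0 => by rw [arcCheb]; simp [circlePt]; norm_num
  | 1 => by
    have hρ : (Complex.I * ρ : ℂ) ≠ 0 := mul_ne_zero Complex.I_ne_zero (by exact_mod_cast h0.ne')
    rw [arcCheb, Polynomial.eval_mul, Polynomial.eval_C, Polynomial.eval_sub, Polynomial.eval_X,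
      Polynomial.eval_one, circlePt_two_mul_arcAngle_sub_one h0 h1, inv_mul_cancel_left₀ hρ]
    simp
  | j + 2 => by
    rw [arcCheb]
    simp only [Polynomial.eval_sub, Polynomial.eval_mul, Polynomial.eval_C, Polynomial.eval_X,
      Polynomial.eval_one]
    have hρ : (Complex.I * ρ : ℂ) ≠ 0 := mul_ne_zero Complex.I_ne_zero (by exact_mod_cast h0.ne')
    have hx := circlePt_mul_circlePt_neg φ
    rw [eval_arcCheb h0 h1 φ j, eval_arcCheb h0 h1 φ (j + 1),
      circlePt_two_mul_arcAngle_sub_one h0 h1, mul_assoc (Complex.I * ρ : ℂ),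
      inv_mul_cancel_left₀ hρ, circlePt_two_mul]
    simp only [circlePt_nat_mul, ← mul_neg]
    linear_combination circlePt (arcAngle ρ φ) ^ (j + 2) *
      (circlePt φ ^ j + circlePt (-φ) ^ j) * hx

/-- The trial polynomial attached to a polynomial `g` of degree at most `M`: the combination of
the Chebyshev polynomials of the arc that splits there into two halves of modulus
`ρ ^ n |g(e^{-2iφ})| |1 - iβb|`. It is monic when `g` has constant coefficient `1`. -/
noncomputable def trialPoly (n : ℕ) (ρ β : ℝ) (g : Polynomial ℝ) (M : ℕ) : Polynomial ℂ :=
  Polynomial.C ((Complex.I * ρ) ^ n) * ∑ k ∈ Finset.range (M + 1),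
    Polynomial.C (g.coeff k : ℂ) * (Polynomial.X ^ k * (arcCheb ρ (n - 2 * k) -
      Polynomial.C (Complex.I * β) * arcCheb ρ (n - 1 - 2 * k)))

open Polynomial in
theorem natDegree_trialPoly_term_le {n k : ℕ} (hk : 2 * k + 1 ≤ n) : (X ^ k * (arcCheb ρ (n - 2 * k) -
      C (Complex.I * β) * arcCheb ρ (n - 1 - 2 * k))).natDegree ≤ n - k := by
  refine natDegree_mul_le.trans ?_
  rw [natDegree_X_pow]
  have h1 := natDegree_arcCheb_le ρ (n - 2 * k)
  have h2 := natDegree_arcCheb_le ρ (n - 1 - 2 * k)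
  have h3 := natDegree_sub_le (arcCheb ρ (n - 2 * k))
    (C (Complex.I * β) * arcCheb ρ (n - 1 - 2 * k))
  have h4 := natDegree_C_mul_le (Complex.I * β) (arcCheb ρ (n - 1 - 2 * k))
  have h5 : max (arcCheb ρ (n - 2 * k)).natDegree
    (C (Complex.I * β) * arcCheb ρ (n - 1 - 2 * k)).natDegree ≤ n - 2 * k :=
      max_le h1 (by omega)
  omega

open Polynomial in
theorem natDegree_trialPoly_le {n M : ℕ} (hM : 2 * M + 1 ≤ n) (g : ℝ[X]) :
    (trialPoly n ρ β g M).natDegree ≤ n := by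
  refine (natDegree_C_mul_le _ _).trans (natDegree_sum_le_of_forall_le _ _ fun k hk => ?_)
  have hk' : k ≤ M := Nat.lt_succ_iff.mp (Finset.mem_range.mp hk)
  exact (natDegree_C_mul_le _ _).trans ((natDegree_trialPoly_term_le (by omega)).trans (by omega))

open Polynomial in
theorem coeff_trialPoly (h0 : 0 < ρ) {n M : ℕ} (hM : 2 * M + 1 ≤ n) {g : ℝ[X]}
    (hg : g.coeff 0 = 1) : (trialPoly n ρ β g M).coeff n = 1 := by
  obtain ⟨n, rfl⟩ : ∃ k, n = k + 1 := ⟨n - 1, by omega⟩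
  rw [trialPoly, coeff_C_mul, finsetSum_coeff, Finset.sum_eq_single 0]
  · have h1 := natDegree_arcCheb_le ρ n
    rw [hg, pow_zero, one_mul, Complex.ofReal_one, C_1, one_mul]
    rw [mul_zero, Nat.sub_zero, Nat.sub_zero, Nat.add_sub_cancel, coeff_sub, coeff_C_mul,
      coeff_eq_zero_of_natDegree_lt (h1.trans_lt (Nat.lt_succ_self _)), coeff_arcCheb, mul_zero,
      sub_zero, ← mul_pow, mul_inv_cancel₀, one_pow]
    exact mul_ne_zero Complex.I_ne_zero (by exact_mod_cast h0.ne')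
  · intro k hk hk0
    have hk' : k ≤ M := Nat.lt_succ_iff.mp (Finset.mem_range.mp hk)
    rw [coeff_C_mul, coeff_eq_zero_of_natDegree_lt (p := X ^ k * _), mul_zero]
    exact (natDegree_trialPoly_term_le (by omega)).trans_lt (by omega)
  · simp

/-- One of the two halves of the trial polynomial on the arc, the factor `(iρ) ^ n e^{inψ}`
removed; the other half is its value at `-φ`. -/
noncomputable def trialHalf (n : ℕ) (ρ β : ℝ) (g : Polynomial ℝ) (φ : ℝ) : ℂ :=
  circlePt (n * φ) * Polynomial.aeval (circlePt (-(2 * φ))) g *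
    (1 - Complex.I * β * discPt ρ φ)

theorem eval_trialPoly (h0 : 0 < ρ) (h1 : ρ < 1) {n M : ℕ} (hM : 2 * M + 1 ≤ n)
    {g : Polynomial ℝ} (hg : g.natDegree ≤ M) (φ : ℝ) :
    (trialPoly n ρ β g M).eval (circlePt (2 * arcAngle ρ φ)) =
      (Complex.I * ρ) ^ n * circlePt (n * arcAngle ρ φ) *
        (trialHalf n ρ β g φ + trialHalf n ρ β g (-φ)) := by
  rw [trialPoly, Polynomial.eval_mul, Polynomial.eval_C, Polynomial.eval_finsetSum, mul_assoc]
  congr 1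
  rw [trialHalf, trialHalf, Polynomial.aeval_eq_sum_range' (Nat.lt_succ_of_le hg),
    Polynomial.aeval_eq_sum_range' (Nat.lt_succ_of_le hg), Finset.mul_sum, Finset.mul_sum,
    Finset.sum_mul, Finset.sum_mul, ← Finset.sum_add_distrib, Finset.mul_sum]
  refine Finset.sum_congr rfl fun k hk => ?_
  have hk' : k ≤ M := Nat.lt_succ_iff.mp (Finset.mem_range.mp hk)
  simp only [Polynomial.eval_sub, Polynomial.eval_mul, Polynomial.eval_C, Polynomial.eval_X,
      Polynomial.eval_pow, Complex.real_smul]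
  rw [eval_arcCheb h0 h1, eval_arcCheb h0 h1]
  obtain ⟨r, rfl⟩ : ∃ r, n = r + 1 + 2 * k := ⟨n - 1 - 2 * k, by omega⟩
  have e1 : r + 1 + 2 * k - 2 * k = r + 1 := by omega
  have e2 : r + 1 + 2 * k - 1 - 2 * k = r := by omega
  have d1 : discPt ρ φ = circlePt (-arcAngle ρ φ) * circlePt (-φ) := by
    rw [discPt, ← circlePt_add]; congr 1; ring
  have d2 : discPt ρ (-φ) = circlePt (-arcAngle ρ φ) * circlePt φ := by
    rw [discPt, ← circlePt_add, arcAngle_neg]; congr 1; ring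
  rw [e1, e2, d1, d2]
  simp only [circlePt_nat_mul, ← mul_neg, circlePt_two_mul, neg_neg]
  have hx := circlePt_mul_circlePt_neg φ
  have hy := circlePt_mul_circlePt_neg (arcAngle ρ φ)
  have hxk : circlePt φ ^ (2 * k) * circlePt (-φ) ^ (2 * k) = 1 := by rw [← mul_pow, hx, one_pow]
  generalize circlePt φ = x at *
  generalize circlePt (-φ) = x' at *
  generalize circlePt (arcAngle ρ φ) = y at *
  generalize circlePt (-arcAngle ρ φ) = y' at *
  generalize (g.coeff k : ℂ) = a at *
  simp only [← pow_mul]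
  linear_combination (-a * y ^ (r + 1 + 2 * k) * (x ^ (r + 1) * (1 - Complex.I * β * (y' * x')) +
      x' ^ (r + 1) * (1 - Complex.I * β * (y' * x)))) * hxk +
    (a * y ^ (r + 2 * k) * Complex.I * β * (x ^ r + x' ^ r)) * (x * x' * hy + hx)

end

section
variable {ρ β : ℝ}

theorem hasDerivAt_arcWeight (h0 : 0 < ρ) (h1 : ρ < 1) (φ : ℝ) :
    HasDerivAt (arcWeight ρ) (2 * ρ * Real.cos φ * (Real.cos (arcAngle ρ φ))⁻¹ +
      2 * ρ * Real.sin φ * (-(Real.sin (arcAngle ρ φ) * (arcWeight ρ φ / 2)) /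
        Real.cos (arcAngle ρ φ) ^ 2)) φ :=
  ((Real.hasDerivAt_sin φ).const_mul (2 * ρ)).mul (hasDerivAt_inv_cos_arcAngle h0 h1 φ)

theorem norm_integral_arcWeight_mul_circlePt_le (h0 : 0 < ρ) (h1 : ρ < 1) {c : ℝ} (hc0 : 0 < c)
    (hc : c ^ 2 ≤ 1 - ρ ^ 2) {m : ℝ} (hm : 0 < m) :
    ‖∫ φ in 0..Real.pi, (arcWeight ρ φ : ℂ) * circlePt (m * φ)‖ ≤ 20 / (c ^ 2 * m) := by
  have hk := le_cos_arcAngle h0 h1 hc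
  have hkpos := cos_arcAngle_pos h0 h1
  have hc1 : c ≤ 1 := by nlinarith
  have h := norm_integral_mul_circlePt_le (hasDerivAt_arcWeight h0 h1) (A := 2) (D := 4 / c ^ 2)
    (by
      have h2 := continuous_arcWeight h0 h1
      have h3 := continuous_arcAngle ρ
      have h4 : Continuous fun φ => (Real.cos (arcAngle ρ φ))⁻¹ :=
        Continuous.inv₀ (by fun_prop) fun φ => (hkpos φ).ne'
      exact (Continuous.mul (by fun_prop) h4).add (Continuous.mul (by fun_prop)
        (Continuous.div (by fun_prop) (by fun_prop) fun φ => (pow_pos (hkpos φ) 2).ne')))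
    (abs_arcWeight_le h0 h1) (fun φ => by
      have h2 : |2 * ρ * Real.cos φ * (Real.cos (arcAngle ρ φ))⁻¹| ≤ 2 / c ^ 2 := by
        rw [abs_mul, abs_mul, abs_of_pos (inv_pos.mpr (hkpos φ)), abs_of_pos (by positivity)]
        have h5 : (Real.cos (arcAngle ρ φ))⁻¹ ≤ (c ^ 2)⁻¹ :=
          inv_anti₀ (by positivity) (le_trans (by nlinarith) (hk φ))
        have h6 := (inv_pos.mpr (hkpos φ)).le
        calc _ ≤ 2 * 1 * 1 * (c ^ 2)⁻¹ := by
              gcongr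
              exact Real.abs_cos_le_one φ
          _ = _ := by ring
      have h3 : |2 * ρ * Real.sin φ * (-(Real.sin (arcAngle ρ φ) * (arcWeight ρ φ / 2)) /
          Real.cos (arcAngle ρ φ) ^ 2)| ≤ 2 / c ^ 2 := by
        rw [abs_mul, abs_mul, abs_div, abs_neg, abs_mul (Real.sin (arcAngle ρ φ)), abs_div, abs_two,
          abs_of_pos (pow_pos (hkpos φ) 2), abs_of_pos (by positivity : 0 < 2 * ρ)]
        have h5 := abs_arcWeight_le h0 h1 φ
        have h6 := hk φ
        calc _ ≤ 2 * 1 * 1 * (1 * (2 / 2) / c ^ 2) := by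
              gcongr
              · exact Real.abs_sin_le_one φ
              · exact Real.abs_sin_le_one _
          _ = _ := by ring
      calc _ ≤ _ := abs_add_le _ _
        _ ≤ 2 / c ^ 2 + 2 / c ^ 2 := add_le_add h2 h3
        _ = _ := by ring) hm
  refine h.trans ?_
  rw [← div_div]
  gcongr
  have hp := Real.pi_lt_four
  have h2 : 2 * 2 ≤ 4 / c ^ 2 := by rw [le_div_iff₀ (by positivity)]; nlinarith
  calc _ ≤ 4 / c ^ 2 + 4 / c ^ 2 * 4 := by gcongr
    _ = _ := by ring

/-- If all frequencies are at least `N - M`, the integral of a trigonometric polynomial with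
nonnegative coefficients against the weight is small. -/
theorem norm_integral_arcWeight_mul_aeval_le (h0 : 0 < ρ) (h1 : ρ < 1) {c : ℝ} (hc0 : 0 < c)
    (hc : c ^ 2 ≤ 1 - ρ ^ 2) {G : Polynomial ℝ} {M : ℕ} (hG : G.natDegree ≤ M)
    (hG0 : ∀ k, 0 ≤ G.coeff k) {N : ℝ} (hN : (M : ℝ) < N) :
    ‖∫ φ in 0..Real.pi, (arcWeight ρ φ : ℂ) * (circlePt (2 * N * φ) *
      Polynomial.aeval (circlePt (-(2 * φ))) G)‖ ≤ 10 / (c ^ 2 * (N - M)) * G.eval 1 := by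
  have hw := continuous_arcWeight h0 h1
  have e : ∀ φ : ℝ, (arcWeight ρ φ : ℂ) * (circlePt (2 * N * φ) *
      Polynomial.aeval (circlePt (-(2 * φ))) G) = ∑ k ∈ Finset.range (M + 1), (G.coeff k : ℂ) *
        ((arcWeight ρ φ : ℂ) * circlePt (2 * (N - k) * φ)) := fun φ => by
    rw [Polynomial.aeval_eq_sum_range' (Nat.lt_succ_of_le hG), Finset.mul_sum, Finset.mul_sum]
    refine Finset.sum_congr rfl fun k _ => ?_
    rw [Complex.real_smul, ← circlePt_nat_mul,
      show 2 * (N - k) * φ = 2 * N * φ + k * -(2 * φ) by ring, circlePt_add]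
    ring
  simp only [e]
  rw [intervalIntegral.integral_finsetSum fun k _ =>
    Continuous.intervalIntegrable (by fun_prop) _ _]
  rw [Polynomial.eval_eq_sum_range' (Nat.lt_succ_of_le hG), Finset.mul_sum]
  refine (norm_sum_le _ _).trans (Finset.sum_le_sum fun k hk => ?_)
  have hk' : (k : ℝ) ≤ M := by exact_mod_cast Nat.lt_succ_iff.mp (Finset.mem_range.mp hk)
  rw [intervalIntegral.integral_const_mul, norm_mul, Complex.norm_real, Real.norm_eq_abs,
    abs_of_nonneg (hG0 k), one_pow, mul_one, mul_comm]
  refine mul_le_mul_of_nonneg_right ?_ (hG0 k)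
  refine (norm_integral_arcWeight_mul_circlePt_le h0 h1 hc0 hc (by linarith)).trans ?_
  calc 20 / (c ^ 2 * (2 * (N - k))) ≤ 20 / (c ^ 2 * (2 * (N - M))) := by
        have : 0 < N - M := by linarith
        gcongr
    _ = _ := by field_simp; ring

theorem normSq_trialHalf (h0 : 0 < ρ) (h1 : ρ < 1) (hρ : ρ * (1 + β ^ 2) = 2 * β) (n : ℕ)
    (g : Polynomial ℝ) (φ : ℝ) : Complex.normSq (trialHalf n ρ β g φ) =
      ‖Polynomial.aeval (circlePt (-(2 * φ))) g‖ ^ 2 *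
        ((1 - arcWeight ρ φ / 2) * ((1 + β ^ 2) * Real.cos (arcAngle ρ φ) ^ 2)) := by
  rw [trialHalf, map_mul, map_mul, one_sub_arcWeight h0 h1 hρ, Complex.normSq_eq_norm_sq,
    Complex.normSq_eq_norm_sq, norm_circlePt, one_pow, one_mul]

theorem aeval_circlePt_neg (g : Polynomial ℝ) (φ : ℝ) : Polynomial.aeval (circlePt (-φ)) g =
    (starRingEnd ℂ) (Polynomial.aeval (circlePt φ) g) := by
  rw [← star_circlePt, Polynomial.aeval_conj]

theorem trialHalf_mul_conj (h0 : 0 < ρ) (h1 : ρ < 1) (hρ : ρ * (1 + β ^ 2) = 2 * β) (n : ℕ)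
    (g : Polynomial ℝ) (φ : ℝ) :
    trialHalf n ρ β g φ * (starRingEnd ℂ) (trialHalf n ρ β g (-φ)) =
      (((1 - β ^ 2) / (1 + β ^ 2) : ℝ) : ℂ) * (circlePt (2 * n * φ) *
        (Polynomial.aeval (circlePt (-(2 * φ))) g ^ 2 *
          (1 - ((β ^ 2 : ℝ) : ℂ) * circlePt (-(2 * φ))))) := by
  have hlin := one_add_mul_one_sub h0 h1 hρ (-φ)
  have hd : discPt ρ φ = circlePt (-φ - arcAngle ρ φ) := by rw [discPt]; congr 1; ring
  have hd' : (starRingEnd ℂ) (discPt ρ (-φ)) = circlePt (arcAngle ρ φ + -φ) := by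
    rw [discPt, star_circlePt, arcAngle_neg, neg_neg]
  have hn : circlePt (2 * n * φ) = circlePt (n * φ) * circlePt (n * φ) := by
    rw [← circlePt_add]; congr 1; ring
  have hB : (1 + (β : ℂ) ^ 2) ≠ 0 := by exact_mod_cast (by positivity : 1 + β ^ 2 ≠ 0)
  rw [arcAngle_neg, show 2 * -φ = -(2 * φ) by ring] at hlin
  rw [trialHalf, trialHalf, show -(2 * -φ) = 2 * φ by ring, map_mul, map_mul, ← aeval_circlePt_neg,
    star_circlePt, map_sub, map_one, map_mul, map_mul, Complex.conj_I, Complex.conj_ofReal, hd, hd',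
    hn, show -(n * -φ) = n * φ by ring]
  push_cast at hlin ⊢
  refine mul_left_cancel₀ hB ?_
  rw [← mul_assoc (1 + (β : ℂ) ^ 2) ((1 - (β : ℂ) ^ 2) / (1 + (β : ℂ) ^ 2)), mul_div_cancel₀ _ hB]
  linear_combination circlePt (n * φ) ^ 2 * Polynomial.aeval (circlePt (-(2 * φ))) g ^ 2 * hlin

/-- The squares of the two halves give the main term, and their product an oscillating term. -/
theorem sq_norm_eval_trialPoly (h0 : 0 < ρ) (h1 : ρ < 1) (hρ : ρ * (1 + β ^ 2) = 2 * β) {n M : ℕ}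
    (hM : 2 * M + 1 ≤ n) {g : Polynomial ℝ} (hg : g.natDegree ≤ M) (φ : ℝ) :
    ‖(trialPoly n ρ β g M).eval (circlePt (2 * arcAngle ρ φ))‖ ^ 2 = ρ ^ (2 * n) *
      (2 * ((1 + β ^ 2) * Real.cos (arcAngle ρ φ) ^ 2) *
        ‖Polynomial.aeval (circlePt (-(2 * φ))) g‖ ^ 2 +
      2 * ((1 - β ^ 2) / (1 + β ^ 2)) * (circlePt (2 * n * φ) *
        (Polynomial.aeval (circlePt (-(2 * φ))) g ^ 2 *
          (1 - ((β ^ 2 : ℝ) : ℂ) * circlePt (-(2 * φ))))).re) := by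
  rw [eval_trialPoly h0 h1 hM hg, norm_mul, norm_mul, norm_circlePt, mul_one, mul_pow, norm_pow,
    norm_mul, Complex.norm_I, one_mul, Complex.norm_real, Real.norm_eq_abs, abs_of_pos h0,
    ← Complex.normSq_eq_norm_sq (_ + _), Complex.normSq_add, normSq_trialHalf h0 h1 hρ,
    normSq_trialHalf h0 h1 hρ, trialHalf_mul_conj h0 h1 hρ, Complex.re_ofReal_mul, arcAngle_neg,
    arcWeight_neg, show -(2 * -φ) = 2 * φ by ring, aeval_circlePt_neg, RCLike.norm_conj]
  ring

end

section
variable {ρ β : ℝ}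

/-- The polynomial close to `((1 - x) (1 - β² x)) ^ (-1/2)` that enters the trial polynomial. -/
noncomputable def trialFactor (t β : ℝ) (m : ℕ) : Polynomial ℝ :=
  invSqrtPoly t m * invSqrtPoly (β ^ 2) m

theorem natDegree_trialFactor_le (t β : ℝ) (m : ℕ) : (trialFactor t β m).natDegree ≤ 2 * m :=
  Polynomial.natDegree_mul_le.trans (by
    have h1 := natDegree_invSqrtPoly_le t m
    have h2 := natDegree_invSqrtPoly_le (β ^ 2) m
    omega)

theorem coeff_mul_nonneg {p q : Polynomial ℝ} (hp : ∀ k, 0 ≤ p.coeff k) (hq : ∀ k, 0 ≤ q.coeff k)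
    (k : ℕ) : 0 ≤ (p * q).coeff k := by
  rw [Polynomial.coeff_mul]
  exact Finset.sum_nonneg fun x _ => mul_nonneg (hp _) (hq _)

theorem coeff_sq_trialFactor_nonneg {t : ℝ} (ht : 0 ≤ t) (β : ℝ) (m k : ℕ) :
    0 ≤ (trialFactor t β m ^ 2).coeff k := by
  have h := coeff_mul_nonneg (coeff_invSqrtPoly_nonneg ht m)
    (coeff_invSqrtPoly_nonneg (sq_nonneg β) m)
  rw [sq]
  exact coeff_mul_nonneg h h k

theorem eval_one_sq_trialFactor_le {t : ℝ} (h0 : 0 ≤ t) (h1 : t < 1) (hb : β ^ 2 < 1) (m : ℕ) :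
    (trialFactor t β m ^ 2).eval 1 ≤ (1 - t)⁻¹ * (1 - β ^ 2)⁻¹ := by
  rw [trialFactor, mul_pow, Polynomial.eval_mul, Polynomial.eval_pow, Polynomial.eval_pow]
  exact mul_le_mul (sq_eval_one_invSqrtPoly_le h0 h1 m)
    (sq_eval_one_invSqrtPoly_le (sq_nonneg β) hb m) (sq_nonneg _) (inv_nonneg.mpr (by linarith))

/-- On the unit circle the square of the modulus of `trialFactor t β m` is almost at most that of
`((1 - x) (1 - β² x)) ^ (-1/2)`. The parameter `t < 1` moves the singularity at `x = 1` out of the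
closed disc, at the price of the factor `2 / (1 + t)`. -/
theorem norm_mul_sq_norm_trialFactor_le {t : ℝ} (h0 : 0 ≤ t) (h1 : t < 1) (hb : β ^ 2 < 1)
    (m : ℕ) {x : ℂ} (hx : ‖x‖ = 1) {δ₁ δ₂ : ℝ} (hδ₁ : t ^ (m + 1) / (1 - t) ≤ δ₁) (h₁ : δ₁ ≤ 1)
    (hδ₂ : (β ^ 2) ^ (m + 1) / (1 - β ^ 2) ≤ δ₂) (h₂ : δ₂ ≤ 1) :
    ‖1 - x‖ * ‖1 - ((β ^ 2 : ℝ) : ℂ) * x‖ * ‖Polynomial.aeval x (trialFactor t β m)‖ ^ 2 ≤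
      (2 / (1 + t) + 6 * δ₁) * (1 + 6 * δ₂) := by
  have e1 := norm_mul_sq_norm_aeval_invSqrtPoly_le h0 h1 le_rfl h1.le m hx.le hδ₁ h₁
    (K := 2 / (1 + t)) (by rw [div_le_iff₀ (by linarith)]; linarith) (norm_one_sub_le_mul h0 hx)
  have e2 := norm_mul_sq_norm_aeval_invSqrtPoly_le (sq_nonneg β) hb hb.le le_rfl m hx.le hδ₂ h₂
    (K := 1) (by norm_num) (by rw [one_mul])
  rw [Complex.ofReal_one, one_mul] at e1
  rw [trialFactor, map_mul, norm_mul]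
  calc _ = (‖1 - x‖ * ‖Polynomial.aeval x (invSqrtPoly t m)‖ ^ 2) * (‖1 - ((β ^ 2 : ℝ) : ℂ) * x‖ *
        ‖Polynomial.aeval x (invSqrtPoly (β ^ 2) m)‖ ^ 2) := by ring
    _ ≤ _ := mul_le_mul e1 e2 (by positivity) ((by positivity : (0 : ℝ) ≤ _).trans e1)

/-- The energy of the trial polynomial: the main term, in which `trialFactor t β m` cancels the
density of arc length, and the contribution of the oscillating term. -/
theorem energy_trialPoly_le (h0 : 0 < ρ) (h1 : ρ < 1) (hb0 : 0 < β) (hb1 : β < 1)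
    (hρ : ρ * (1 + β ^ 2) = 2 * β) {c : ℝ} (hc : c = (1 - β ^ 2) / (1 + β ^ 2)) {n m : ℕ}
    (hm : 4 * m + 1 < n) {t : ℝ} (ht0 : 0 ≤ t) (ht1 : t < 1) {δ₁ δ₂ : ℝ}
    (hδ₁ : t ^ (m + 1) / (1 - t) ≤ δ₁) (h₁ : δ₁ ≤ 1)
    (hδ₂ : (β ^ 2) ^ (m + 1) / (1 - β ^ 2) ≤ δ₂) (h₂ : δ₂ ≤ 1) :
    energy (2 * Real.arcsin ρ) 0 (trialPoly n ρ β (trialFactor t β m) (2 * m)) ≤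
      ρ ^ (2 * n) * (ρ * ((2 / (1 + t) + 6 * δ₁) * (1 + 6 * δ₂)) +
        20 / (c ^ 2 * ((1 - t) * (n - 1 - 4 * m)))) := by
  have hpi := Real.pi_pos
  have hb2 : β ^ 2 < 1 := by nlinarith
  have hc0 : 0 < c := by rw [hc]; exact div_pos (by linarith) (by positivity)
  have hcb : c ≤ 1 - β ^ 2 := by
    rw [hc, div_le_iff₀ (by positivity)]; nlinarith [sq_nonneg β]
  have hcρ : c ^ 2 = 1 - ρ ^ 2 := by
    have : ρ = 2 * β / (1 + β ^ 2) := by rw [eq_div_iff (by positivity), hρ]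
    rw [hc, this]; field_simp; ring
  set g := trialFactor t β m with hg
  have hgd : g.natDegree ≤ 2 * m := natDegree_trialFactor_le t β m
  have hGd : (g ^ 2).natDegree ≤ 4 * m := Polynomial.natDegree_pow_le.trans (by omega)
  have hw := continuous_arcWeight h0 h1
  have hac : ∀ p : Polynomial ℝ, Continuous fun φ : ℝ =>
      Polynomial.aeval (circlePt (-(2 * φ))) p := fun p => by fun_prop
  set K := (2 / (1 + t) + 6 * δ₁) * (1 + 6 * δ₂) with hK
  set U : ℝ → ℂ := fun φ => (arcWeight ρ φ : ℂ) * (circlePt (2 * (n : ℝ) * φ) *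
      Polynomial.aeval (circlePt (-(2 * φ))) (g ^ 2)) with hU
  set V : ℝ → ℂ := fun φ => (arcWeight ρ φ : ℂ) * (circlePt (2 * ((n : ℝ) - 1) * φ) *
      Polynomial.aeval (circlePt (-(2 * φ))) (g ^ 2)) with hV
  have hUc : Continuous U := by have := hac (g ^ 2); fun_prop
  have hVc : Continuous V := by have := hac (g ^ 2); fun_prop
  have hn : (4 : ℝ) * m + 1 < n := by exact_mod_cast hm
  have hUi := norm_integral_arcWeight_mul_aeval_le h0 h1 hc0 hcρ.le hGd
    (coeff_sq_trialFactor_nonneg ht0 β m) (N := n) (by push_cast; linarith)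
  have hVi := norm_integral_arcWeight_mul_aeval_le h0 h1 hc0 hcρ.le hGd
    (coeff_sq_trialFactor_nonneg ht0 β m) (N := n - 1) (by push_cast; linarith)
  have hG1 := eval_one_sq_trialFactor_le ht0 ht1 hb2 m
  change ‖∫ φ in 0..Real.pi, U φ‖ ≤ _ at hUi
  change ‖∫ φ in 0..Real.pi, V φ‖ ≤ _ at hVi
  have hint : 2 * Real.pi * energy (2 * Real.arcsin ρ) 0 (trialPoly n ρ β g (2 * m)) ≤
      ∫ φ in 0..Real.pi, ρ ^ (2 * n) * (2 * ρ * K + 2 * c * (U φ - (β ^ 2 : ℝ) * V φ).re) := by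
    rw [energy_zero_eq_integral h0 h1]
    have hpc := (continuous_norm_sq_eval (trialPoly n ρ β g (2 * m))).comp
      ((continuous_arcAngle ρ).const_mul 2)
    refine intervalIntegral.integral_mono_on hpi.le
      (Continuous.intervalIntegrable (hw.mul hpc) _ _)
      (Continuous.intervalIntegrable (by fun_prop) _ _) fun φ hφ => ?_
    have hs : 0 ≤ Real.sin φ := Real.sin_nonneg_of_mem_Icc hφ
    have hk := cos_arcAngle_pos h0 h1 φ
    rw [sq_norm_eval_trialPoly h0 h1 hρ (by omega) hgd, ← hc]
    have e1 : U φ - (β ^ 2 : ℝ) * V φ = (arcWeight ρ φ : ℂ) * (circlePt (2 * n * φ) *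
        (Polynomial.aeval (circlePt (-(2 * φ))) g ^ 2 *
          (1 - ((β ^ 2 : ℝ) : ℂ) * circlePt (-(2 * φ))))) := by
      have e2 : circlePt (2 * ((n : ℝ) - 1) * φ) =
          circlePt (2 * n * φ) * circlePt (-(2 * φ)) := by
        rw [← circlePt_add]; congr 1; ring
      simp only [hU, hV, map_pow, e2]
      ring
    rw [e1, Complex.re_ofReal_mul]
    have e3 := norm_mul_sq_norm_trialFactor_le (β := β) ht0 ht1 hb2 m
      (norm_circlePt (-(2 * φ))) hδ₁ h₁ hδ₂ h₂
    rw [norm_one_sub_circlePt, norm_one_sub_sq_mul h0 h1 hρ, abs_of_nonneg hs, ← hg, ← hK] at e3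
    have e4 : arcWeight ρ φ * (2 * ((1 + β ^ 2) * Real.cos (arcAngle ρ φ) ^ 2) *
        ‖Polynomial.aeval (circlePt (-(2 * φ))) g‖ ^ 2) ≤ 2 * ρ * K := by
      calc _ = 2 * ρ * (2 * Real.sin φ * ((1 + β ^ 2) * Real.cos (arcAngle ρ φ)) *
            ‖Polynomial.aeval (circlePt (-(2 * φ))) g‖ ^ 2) := by
            rw [arcWeight]; field_simp
        _ ≤ _ := by gcongr
    have hρn : 0 ≤ ρ ^ (2 * n) := by positivity
    rw [mul_left_comm]
    refine mul_le_mul_of_nonneg_left ?_ hρn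
    rw [mul_add]
    refine add_le_add e4 (le_of_eq ?_)
    ring
  have hre : ∫ φ in 0..Real.pi, (U φ - (β ^ 2 : ℝ) * V φ).re =
      (∫ φ in 0..Real.pi, (U φ - (β ^ 2 : ℝ) * V φ)).re :=
    Complex.reCLM.intervalIntegral_comp_comm (μ := MeasureTheory.volume)
      (f := fun φ => U φ - (β ^ 2 : ℝ) * V φ) (Continuous.intervalIntegrable (by fun_prop) _ _)
  rw [intervalIntegral.integral_const_mul, intervalIntegral.integral_add
    (Continuous.intervalIntegrable (by fun_prop) _ _)
    (Continuous.intervalIntegrable (by fun_prop) _ _), intervalIntegral.integral_const_mul (2 * c),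
    hre, intervalIntegral.integral_sub (Continuous.intervalIntegrable hUc _ _)
    (Continuous.intervalIntegrable (by fun_prop) _ _),
    intervalIntegral.integral_const_mul ((β ^ 2 : ℝ) : ℂ)] at hint
  simp only [intervalIntegral.integral_const, sub_zero, smul_eq_mul] at hint
  set q := (1 - t) * ((n : ℝ) - 1 - 4 * m) with hq
  have hq0 : 0 < q := mul_pos (by linarith) (by linarith)
  have hosc : ((∫ φ in 0..Real.pi, U φ) - (β ^ 2 : ℝ) * ∫ φ in 0..Real.pi, V φ).re ≤
      20 / (c ^ 3 * q) := by
    refine (Complex.re_le_norm _).trans ((norm_sub_le _ _).trans ?_)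
    rw [norm_mul, Complex.norm_real, Real.norm_eq_abs, abs_of_nonneg (sq_nonneg β)]
    have hG2 : (g ^ 2).eval 1 ≤ (1 - t)⁻¹ * c⁻¹ := hG1.trans (by gcongr)
    have hd : (0 : ℝ) < n - 1 - 4 * m := by linarith
    have b1 : 10 / (c ^ 2 * (((n : ℝ) - 1) - ((4 * m : ℕ) : ℝ))) * (g ^ 2).eval 1 ≤
        10 / (c ^ 3 * q) := by
      push_cast
      calc _ ≤ 10 / (c ^ 2 * ((n : ℝ) - 1 - 4 * m)) * ((1 - t)⁻¹ * c⁻¹) := by gcongr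
        _ = _ := by
          have : 1 - t ≠ 0 := by linarith
          rw [hq]; field_simp
    have hg0 : 0 ≤ (g ^ 2).eval 1 := by rw [Polynomial.eval_pow]; positivity
    have b2 : 10 / (c ^ 2 * ((n : ℝ) - ((4 * m : ℕ) : ℝ))) * (g ^ 2).eval 1 ≤
        10 / (c ^ 3 * q) := by
      refine le_trans ?_ b1
      have : (0 : ℝ) < n - 1 - ((4 * m : ℕ) : ℝ) := by push_cast; linarith
      gcongr
      linarith
    have b3 : β ^ 2 * ‖∫ φ in 0..Real.pi, V φ‖ ≤ 1 * (10 / (c ^ 3 * q)) :=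
      mul_le_mul hb2.le (hVi.trans b1) (norm_nonneg _) zero_le_one
    calc _ ≤ 10 / (c ^ 3 * q) + 1 * (10 / (c ^ 3 * q)) := add_le_add (hUi.trans b2) b3
      _ = _ := by ring
  have hfin : 2 * Real.pi * energy (2 * Real.arcsin ρ) 0 (trialPoly n ρ β g (2 * m)) ≤
      2 * Real.pi * (ρ ^ (2 * n) * (ρ * K + 20 / (c ^ 2 * q))) := by
    refine hint.trans ?_
    have h3 : 2 * c * (20 / (c ^ 3 * q)) ≤ 2 * Real.pi * (20 / (c ^ 2 * q)) := by
      have : 2 * c * (20 / (c ^ 3 * q)) = 2 * 1 * (20 / (c ^ 2 * q)) := by field_simp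
      rw [this]
      have := Real.pi_gt_three
      gcongr
      linarith
    calc _ ≤ ρ ^ (2 * n) * (Real.pi * (2 * ρ * K) + 2 * c * (20 / (c ^ 3 * q))) := by gcongr
      _ ≤ ρ ^ (2 * n) * (Real.pi * (2 * ρ * K) + 2 * Real.pi * (20 / (c ^ 2 * q))) := by gcongr
      _ = _ := by ring
  exact le_of_mul_le_mul_left hfin (by positivity)

end

/-- A polynomial rate of decay suffices for the truncation errors. -/
theorem one_sub_pow_le_inv_sq {x : ℝ} (hx0 : 0 < x) (hx1 : x ≤ 1) {k : ℕ} (hk : 0 < k) :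
    (1 - x) ^ k ≤ 2 / (k * x) ^ 2 := by
  have hk' : (0 : ℝ) < k := by exact_mod_cast hk
  have h1 : (1 - x) ^ k ≤ Real.exp (-(k * x)) := by
    calc (1 - x) ^ k ≤ Real.exp (-x) ^ k := by
          gcongr
          exact Real.one_sub_le_exp_neg x
      _ = _ := by rw [← Real.exp_nat_mul]; congr 1; ring
  refine h1.trans ?_
  have h2 := Real.quadratic_le_exp_of_nonneg (mul_pos hk' hx0).le
  rw [Real.exp_neg, inv_le_comm₀ (Real.exp_pos _) (by positivity), inv_div]
  nlinarith [mul_pos hk' hx0]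

/-- For `ρ` bounded away from `0` and `1` there is a monic polynomial of degree `n` with energy at
most `ρ ^ (2n + 1) (1 + O(n^{-1/2}))` on the arc. -/
theorem exists_monic_energy_le {m : ℝ} (hm : 0 < m) : ∃ C : ℝ, ∃ N : ℕ, 0 ≤ C ∧
    ∀ n : ℕ, N ≤ n → ∀ ρ β : ℝ, m ≤ ρ → ρ < 1 → 0 < β → β < 1 → ρ * (1 + β ^ 2) = 2 * β →
      m ≤ (1 - β ^ 2) / (1 + β ^ 2) → ∃ P : Polynomial ℂ, P.natDegree ≤ n ∧ P.coeff n = 1 ∧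
        energy (2 * Real.arcsin ρ) 0 P ≤ ρ ^ (2 * n + 1) * (1 + C / √n) := by
  refine ⟨769 + 768 / m ^ 3 + 769 * (768 / m ^ 3) + 80 / m ^ 3, max 16384 ⌈(128 / m ^ 3) ^ 2⌉₊,
    by positivity, fun n hn ρ β hmρ h1 hb0 hb1 hρ hc => ?_⟩
  have h0 : 0 < ρ := hm.trans_le hmρ
  have hb2 : β ^ 2 < 1 := by nlinarith
  set c := (1 - β ^ 2) / (1 + β ^ 2) with hcdef
  have hc0 : 0 < c := hm.trans_le hc
  have hcb : c ≤ 1 - β ^ 2 := by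
    rw [hcdef, div_le_iff₀ (by positivity)]; nlinarith [sq_nonneg β]
  have hn1 : 16384 ≤ n := (le_max_left _ _).trans hn
  have hnR : (16384 : ℝ) ≤ n := by exact_mod_cast hn1
  have hn2 : (128 / m ^ 3) ^ 2 ≤ (n : ℝ) :=
    (Nat.le_ceil _).trans (by exact_mod_cast (le_max_right _ _).trans hn)
  set R := √(n : ℝ) with hR
  have hR2 : R ^ 2 = n := Real.sq_sqrt (by linarith)
  have hR128 : 128 ≤ R := by
    rw [hR]; exact Real.le_sqrt_of_sq_le (by linarith)
  have hRm : 128 / m ^ 3 ≤ R := Real.le_sqrt_of_sq_le hn2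
  have hR0 : 0 < R := by linarith
  -- the degree of the Taylor polynomials; all frequencies of the oscillating term stay above a
  -- multiple of `n`
  set k := n / 8 with hk
  have hk8 : (n : ℝ) ≤ 8 * ((k + 1 : ℕ) : ℝ) := by
    have : n ≤ 8 * (k + 1) := by omega
    exact_mod_cast this
  have hk4 : (8 * k : ℝ) ≤ n := by
    have : 8 * k ≤ n := by omega
    exact_mod_cast this
  -- balances the loss `(1 - t) / 2` against the truncation error `t ^ (k + 1) / (1 - t)` and the
  -- oscillating term `1 / (n (1 - t))`
  set t := 1 - R⁻¹ with ht
  have hRi : R⁻¹ ≤ 1 := inv_le_one_of_one_le₀ (by linarith)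
  have hRi0 : 0 < R⁻¹ := inv_pos.mpr hR0
  have hδ₁ : t ^ (k + 1) / (1 - t) ≤ 128 / R := by
    have e := one_sub_pow_le_inv_sq hRi0 hRi (Nat.succ_pos k)
    have h1t : 1 - t = R⁻¹ := by rw [ht]; ring
    rw [h1t, div_le_iff₀ hRi0]
    refine e.trans ?_
    have h3 : R / 8 ≤ ((k + 1 : ℕ) : ℝ) * R⁻¹ := by
      rw [← div_eq_mul_inv, div_le_div_iff₀ (by norm_num) hR0]
      nlinarith
    calc (2 : ℝ) / (((k.succ : ℕ) : ℝ) * R⁻¹) ^ 2 ≤ 2 / (R / 8) ^ 2 := by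
          gcongr
      _ = _ := by field_simp; norm_num
  have hδ₂ : (β ^ 2) ^ (k + 1) / (1 - β ^ 2) ≤ 128 / m ^ 3 / R := by
    have e := one_sub_pow_le_inv_sq (x := 1 - β ^ 2) (by linarith) (by nlinarith) (Nat.succ_pos k)
    rw [sub_sub_cancel] at e
    have hmb : m ≤ 1 - β ^ 2 := hc.trans hcb
    rw [div_le_iff₀ (by linarith)]
    refine e.trans ?_
    have h3 : R / 8 * m ≤ ((k + 1 : ℕ) : ℝ) * (1 - β ^ 2) := by
      gcongr
      nlinarith
    calc (2 : ℝ) / (((k.succ : ℕ) : ℝ) * (1 - β ^ 2)) ^ 2 ≤ 2 / (R / 8 * m) ^ 2 := by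
          gcongr
      _ = 128 / m ^ 2 / R / R := by field_simp; norm_num
      _ ≤ 128 / m ^ 2 / R / 1 := by gcongr; linarith
      _ = 128 / m ^ 3 / R * m := by field_simp
      _ ≤ _ := by gcongr
  have h₁ : 128 / R ≤ 1 := by rwa [div_le_one hR0]
  have h₂ : 128 / m ^ 3 / R ≤ 1 := by rwa [div_le_one hR0]
  have key := energy_trialPoly_le h0 h1 hb0 hb1 hρ hcdef (n := n) (m := k) (by omega) (t := t)
    (by linarith) (by linarith) hδ₁ h₁ hδ₂ h₂
  refine ⟨_, natDegree_trialPoly_le (by omega) _, coeff_trialPoly h0 (by omega) ?_, key.trans ?_⟩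
  · rw [trialFactor, Polynomial.mul_coeff_zero, coeff_zero_invSqrtPoly, coeff_zero_invSqrtPoly,
      one_mul]
  · have e1 : 2 / (1 + t) ≤ 1 + R⁻¹ := by
      rw [ht, div_le_iff₀ (by linarith)]; nlinarith
    have e2 : 20 / (c ^ 2 * ((1 - t) * ((n : ℝ) - 1 - 4 * k))) ≤ ρ * (80 / m ^ 3 * R⁻¹) := by
      have h3 : (n : ℝ) / 4 ≤ n - 1 - 4 * k := by linarith
      have h1t : 1 - t = R⁻¹ := by rw [ht]; ring
      rw [h1t]
      calc _ ≤ 20 / (m ^ 2 * (R⁻¹ * ((n : ℝ) / 4))) := by gcongr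
        _ = m * (80 / m ^ 3 * R⁻¹) := by rw [← hR2]; field_simp; norm_num
        _ ≤ _ := by gcongr
    have hA : 2 / (1 + t) + 6 * (128 / R) ≤ 1 + 769 * R⁻¹ := by
      rw [div_eq_mul_inv 128 R]; linarith
    have hB : 1 + 6 * (128 / m ^ 3 / R) = 1 + 768 / m ^ 3 * R⁻¹ := by
      rw [div_eq_mul_inv _ R]; ring
    have hAB : (2 / (1 + t) + 6 * (128 / R)) * (1 + 6 * (128 / m ^ 3 / R)) ≤
        1 + (769 + 768 / m ^ 3 + 769 * (768 / m ^ 3)) * R⁻¹ := by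
      rw [hB]
      have hD : 0 ≤ 768 / m ^ 3 := by positivity
      calc _ ≤ (1 + 769 * R⁻¹) * (1 + 768 / m ^ 3 * R⁻¹) := by gcongr
        _ = 1 + (769 + 768 / m ^ 3) * R⁻¹ + 769 * (768 / m ^ 3) * R⁻¹ * R⁻¹ := by ring
        _ ≤ 1 + (769 + 768 / m ^ 3) * R⁻¹ + 769 * (768 / m ^ 3) * R⁻¹ * 1 := by gcongr
        _ = _ := by ring
    calc _ ≤ ρ ^ (2 * n) * (ρ * (1 + (769 + 768 / m ^ 3 + 769 * (768 / m ^ 3)) * R⁻¹) +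
          ρ * (80 / m ^ 3 * R⁻¹)) := by gcongr
      _ = _ := by rw [div_eq_mul_inv _ R]; ring

/-! ### Uniform asymptotics on compact sets of angles -/

theorem degree_sub_X_pow_lt {P : Polynomial ℂ} {n : ℕ} (hP : P.natDegree ≤ n)
    (hc : P.coeff n = 1) : (P - Polynomial.X ^ n).degree < (n : WithBot ℕ) := by
  rw [Polynomial.degree_lt_iff_coeff_zero]
  intro k hk
  rw [Polynomial.coeff_sub, Polynomial.coeff_X_pow]
  rcases hk.eq_or_lt with rfl | hk'
  · simp [hc]
  · rw [Polynomial.coeff_eq_zero_of_natDegree_lt (hP.trans_lt hk'), if_neg hk'.ne', sub_zero]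

section
variable {m α : ℝ}

/-- The basic relations between `ρ = sin α`, `β = tan (α / 2)` and `cos α`. -/
theorem half_angle_relations (hs : 0 < Real.sin α) (hα0 : 0 ≤ α)
    (hα : α < Real.pi / 2) : 0 < Real.tan (α / 2) ∧ Real.tan (α / 2) < 1 ∧
      Real.sin α * (1 + Real.tan (α / 2) ^ 2) = 2 * Real.tan (α / 2) ∧
      Real.cos α = (1 - Real.tan (α / 2) ^ 2) / (1 + Real.tan (α / 2) ^ 2) := by
  have hα' : 0 < α := hα0.lt_of_ne fun h => by simp [← h] at hs
  have hpi := Real.pi_pos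
  have hc : 0 < Real.cos (α / 2) := Real.cos_pos_of_mem_Ioo ⟨by linarith, by linarith⟩
  have e1 : Real.sin α = 2 * Real.sin (α / 2) * Real.cos (α / 2) := by
    rw [← Real.sin_two_mul]; congr 1; ring
  have e2 : Real.cos α = Real.cos (α / 2) ^ 2 - Real.sin (α / 2) ^ 2 := by
    rw [← Real.cos_two_mul']; congr 1; ring
  have e3 := Real.sin_sq_add_cos_sq (α / 2)
  refine ⟨Real.tan_pos_of_pos_of_lt_pi_div_two (by linarith) (by linarith), ?_, ?_, ?_⟩
  · rw [← Real.tan_pi_div_four]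
    exact Real.tan_lt_tan_of_lt_of_lt_pi_div_two (by linarith) (by linarith) (by linarith)
  · rw [e1, Real.tan_eq_sin_div_cos]
    field_simp
    linear_combination Real.sin (α / 2) * e3
  · rw [e2, Real.tan_eq_sin_div_cos]
    field_simp
    linear_combination (Real.cos (α / 2) ^ 2 - Real.sin (α / 2) ^ 2) * e3

/-- The square of the norm of the monic orthogonal polynomial is `ρ ^ (2n + 1) (1 + O(n^{-1/2}))`,
uniformly in the weight `s` of the gap below the critical value `tan (α / 2) ^ (2n)`. -/
theorem exists_energy_asymptotics (hm : 0 < m) : ∃ C : ℝ, ∃ N : ℕ, 0 ≤ C ∧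
    ∀ n : ℕ, N ≤ n → ∀ α : ℝ, 0 ≤ α → α ≤ Real.pi / 2 → m ≤ Real.sin α → m ≤ Real.cos α →
      ∀ s : ℝ, 0 ≤ s → s ≤ Real.tan (α / 2) ^ (2 * n) → ∀ Φ : Polynomial ℂ,
        IsMonicOrthogonal (2 * α) s n Φ →
          |energy (2 * α) s Φ - Real.sin α ^ (2 * n + 1)| ≤
            Real.sin α ^ (2 * n + 1) * (C / √n) := by
  obtain ⟨C₁, N, hC₁, hup⟩ := exists_monic_energy_le hm
  set K : ℝ := 4608 / m ^ 6 * (2 * Real.pi) with hK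
  have hpi := Real.pi_pos
  have hK0 : 0 ≤ K := by positivity
  refine ⟨(1 + 1 / m) + (C₁ + K + C₁ * K), max N 1, by positivity,
    fun n hn α hα0 hα hsm hcm s hs0 hs Φ hΦ => ?_⟩
  have hnN : N ≤ n := (le_max_left _ _).trans hn
  have hn1 : 1 ≤ n := (le_max_right _ _).trans hn
  have hnR : (1 : ℝ) ≤ n := by exact_mod_cast hn1
  have hsin : 0 < Real.sin α := hm.trans_le hsm
  have hcos : 0 < Real.cos α := hm.trans_le hcm
  have hα' : α < Real.pi / 2 := hα.lt_of_ne fun h => by rw [h, Real.cos_pi_div_two] at hcos; linarith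
  have hsin1 : Real.sin α < 1 := by nlinarith [Real.sin_sq_add_cos_sq α]
  obtain ⟨hb0, hb1, hρ, hc⟩ := half_angle_relations hsin hα0 hα'
  set β := Real.tan (α / 2) with hβ
  set ρ := Real.sin α with hρdef
  have hang : 2 * Real.arcsin ρ = 2 * α := by rw [hρdef, Real.arcsin_sin (by linarith) hα]
  set R := √(n : ℝ) with hR
  have hR2 : R ^ 2 = n := Real.sq_sqrt (by linarith)
  have hR1 : 1 ≤ R := Real.one_le_sqrt.mpr hnR
  have hR0 : 0 < R := by linarith
  have hRi : R⁻¹ ≤ 1 := inv_le_one_of_one_le₀ hR1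
  have hRi0 : 0 < R⁻¹ := inv_pos.mpr hR0
  have hpow : 0 < ρ ^ (2 * n + 1) := by positivity
  -- the lower bound
  have hlow : ρ ^ (2 * n + 1) * (1 - (1 + 1 / m) * R⁻¹) ≤ energy (2 * α) s Φ := by
    have h1 := le_energy_zero_of_monic hsin hsin1 hb0 hb1 hρ hc (n := n) (P := Φ)
      hΦ.natDegree_eq.le (by
        have := hΦ.monic.coeff_natDegree
        rwa [hΦ.natDegree_eq] at this)
    rw [hang] at h1
    refine le_trans ?_ (h1.trans (energy_zero_le (by linarith) hs0 Φ))
    have h2 : (2 + Real.pi / Real.cos α) / (Real.pi * (2 * n + 1)) ≤ (1 + 1 / m) * R⁻¹ := by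
      have h3 : Real.pi / Real.cos α ≤ Real.pi / m := by gcongr
      have h4 : R ≤ 2 * n + 1 := by nlinarith
      calc _ ≤ (Real.pi + Real.pi / m) / (Real.pi * R) := by
            have := Real.pi_gt_three
            gcongr
            linarith
        _ = _ := by field_simp
    gcongr
  -- the upper bound
  have hupp : energy (2 * α) s Φ ≤ ρ ^ (2 * n + 1) * (1 + (C₁ + K + C₁ * K) * R⁻¹) := by
    obtain ⟨P, hPd, hPc, hPE⟩ := hup n hnN ρ β hsm hsin1 hb0 hb1 hρ (by rwa [← hc])
    rw [hang] at hPE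
    refine (hΦ.energy_le (by linarith) (by linarith) hs0 (degree_sub_X_pow_lt hPd hPc)).trans ?_
    have hgap := gapEnergy_le hm hα0 hα hsm hcm hn1 hPd
    rw [← hK, ← hβ, ← hR] at hgap
    have hE := energy_zero_nonneg (by linarith : 0 ≤ 2 * α) P
    have h5 : s * gapEnergy (2 * α) P ≤ K / R * energy (2 * α) 0 P := by
      calc s * gapEnergy (2 * α) P
          ≤ β ^ (2 * n) * (K / R * β⁻¹ ^ (2 * n) * energy (2 * α) 0 P) := by
            have := gapEnergy_nonneg (by linarith : 2 * α ≤ Real.pi) P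
            gcongr
        _ = (β * β⁻¹) ^ (2 * n) * (K / R * energy (2 * α) 0 P) := by rw [mul_pow]; ring
        _ = _ := by rw [mul_inv_cancel₀ hb0.ne', one_pow, one_mul]
    rw [energy_eq]
    calc _ ≤ energy (2 * α) 0 P * (1 + K * R⁻¹) := by rw [div_eq_mul_inv] at h5; linarith
      _ ≤ ρ ^ (2 * n + 1) * (1 + C₁ / R) * (1 + K * R⁻¹) := by gcongr
      _ = ρ ^ (2 * n + 1) * (1 + (C₁ + K) * R⁻¹ + C₁ * K * R⁻¹ * R⁻¹) := by
          rw [div_eq_mul_inv]; ring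
      _ ≤ ρ ^ (2 * n + 1) * (1 + (C₁ + K) * R⁻¹ + C₁ * K * R⁻¹ * 1) := by gcongr
      _ = _ := by ring
  rw [abs_le, div_eq_mul_inv]
  have h6 : 0 ≤ (1 + 1 / m) * R⁻¹ := by positivity
  have h7 : 0 ≤ (C₁ + K + C₁ * K) * R⁻¹ := by positivity
  constructor
  · nlinarith [mul_nonneg hpow.le h7]
  · nlinarith [mul_nonneg hpow.le h6]

/-- A bound for the value at the endpoint of the arc, from a bound for the energy. -/
theorem norm_eval_arcEnd_le (hm : 0 < m) (hα0 : 0 < α) (hα : α ≤ Real.pi / 2)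
    (hsm : m ≤ Real.sin α) (hcm : m ≤ Real.cos α) {n : ℕ} (hn : 1 ≤ n) {s : ℝ} (hs0 : 0 ≤ s)
    (hs1 : s ≤ 1 - m) {Φ : Polynomial ℂ} (hΦ : IsMonicOrthogonal (2 * α) s n Φ) {C : ℝ}
    (hC : 0 ≤ C) (hE : energy (2 * α) s Φ ≤ Real.sin α ^ (2 * n) * (1 + C)) :
    ‖Φ.eval (arcEnd (2 * α))‖ ≤
      Real.sin α ^ n * ((1 + 3 * Real.pi * (1 + C) / m ^ 3) * √n) := by
  have hpi := Real.pi_pos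
  have hnR : (1 : ℝ) ≤ n := by exact_mod_cast hn
  have hend := hΦ.sq_norm_eval_arcEnd_le (by linarith : 0 < 2 * α) (by linarith) hs0
    (by linarith) hn
  change _ * ‖Φ.eval (arcEnd (2 * α))‖ ^ 2 ≤ _ at hend
  rw [Real.sin_two_mul] at hend
  have hρ : 0 < Real.sin α := hm.trans_le hsm
  generalize ‖Φ.eval (arcEnd (2 * α))‖ = y at *
  generalize Real.sin α = ρ at *
  generalize Real.cos α = c at *
  have h15 : m * (2 * m * m) ≤ (1 - s) * (2 * ρ * c) :=
    mul_le_mul (by linarith) (by gcongr) (by positivity) (by linarith)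
  have hE0 := energy_nonneg (by linarith : 0 ≤ 2 * α) (by linarith) hs0 Φ
  set A := 3 * Real.pi * (1 + C) / m ^ 3 with hA
  have hA0 : 0 ≤ A := by positivity
  have h10 : m * (2 * m * m) * y ^ 2 ≤
      2 * Real.pi * ((2 * n + n) * (ρ ^ (2 * n) * (1 + C))) :=
    (mul_le_mul_of_nonneg_right h15 (sq_nonneg y)).trans (hend.trans (by gcongr))
  have h11 : y ^ 2 ≤ ρ ^ (2 * n) * n * A := by
    have h12 : 0 < m * (2 * m * m) := by positivity
    refine le_of_mul_le_mul_left (h10.trans_eq ?_) h12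
    rw [hA]
    field_simp
    ring
  have h9 : y ^ 2 ≤ (ρ ^ n * ((1 + A) * √n)) ^ 2 := by
    have h13 : A ≤ (1 + A) ^ 2 := by nlinarith
    calc y ^ 2 ≤ ρ ^ (2 * n) * n * (1 + A) ^ 2 := h11.trans (by gcongr)
      _ = ρ ^ (2 * n) * √n ^ 2 * (1 + A) ^ 2 := by rw [Real.sq_sqrt (by linarith)]
      _ = _ := by ring
  exact (abs_le_of_sq_le_sq' h9 (by positivity)).2

end

theorem exp_neg_ellConst {θ₀ : ℝ} (h : 0 < Real.sin (θ₀ / 2)) (n : ℕ) :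
    Real.exp (-(n * ellConst θ₀)) = Real.sin (θ₀ / 2) ^ (2 * n) := by
  rw [ellConst, ← Real.exp_log (pow_pos h (2 * n)), Real.log_pow]
  congr 1; push_cast; ring

theorem exp_neg_half_ellConst {θ₀ : ℝ} (h : 0 < Real.sin (θ₀ / 2)) (n : ℕ) :
    Real.exp (-(n * ellConst θ₀ / 2)) = Real.sin (θ₀ / 2) ^ n := by
  rw [ellConst, ← Real.exp_log (pow_pos h n), Real.log_pow]
  congr 1; ring

theorem exp_xCrit {θ₀ : ℝ} (h : 0 < Real.tan (θ₀ / 4)) (n : ℕ) :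
    Real.exp (n * xCrit θ₀) = (Real.tan (θ₀ / 4))⁻¹ ^ (2 * n) := by
  rw [xCrit, ← Real.exp_log (pow_pos (inv_pos.mpr h) (2 * n)), Real.log_pow, Real.log_inv]
  congr 1; push_cast; ring

theorem mainTheorem4 (ε : ℝ) (hε : 0 < ε) :
    ∃ C : ℝ, ∃ N : ℕ, ∀ n : ℕ, N ≤ n → ∀ θ₀ : ℝ, ε ≤ θ₀ → θ₀ ≤ Real.pi - ε →
      ∃ Y : ℝ → ℂ → Matrix (Fin 2) (Fin 2) ℂ,
        ∀ s ∈ Set.Ico (0 : ℝ) (Real.exp (-(n * xCrit θ₀))),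
          -- for each such `s`, `Y s` is the unique solution of the Riemann-Hilbert problem
          (IsRHSolution n θ₀ s (Y s) ∧
            ∀ Z : ℂ → Matrix (Fin 2) (Fin 2) ℂ,
              IsRHSolution n θ₀ s Z → Set.EqOn Z (Y s) offCircle) ∧
          -- asymptotics of the entry `12` at the origin
          ‖Y s 0 0 1 - ((Real.exp (-(n * ellConst θ₀)) * Real.sin (θ₀ / 2) : ℝ) : ℂ)‖
            ≤ Real.exp (-(n * ellConst θ₀)) * (C / Real.sqrt n) ∧
          -- its logarithmic derivative with respect to `s`
          (∃ d : ℂ,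
            HasDerivWithinAt (fun t : ℝ => Complex.log (Y t 0 0 1)) d
              (Set.Ico (0 : ℝ) (Real.exp (-(n * xCrit θ₀)))) s ∧
            ‖d‖ ≤ C / Real.sqrt n * Real.exp (n * xCrit θ₀)) ∧
          -- the boundary value of the entry `11` at the endpoint
          (∃ y : ℂ,
            Tendsto (fun z : ℂ => Y s z 0 0) (𝓝[offCircle] (arcEnd θ₀)) (𝓝 y) ∧
            ‖y‖ ≤ Real.exp (-(n * ellConst θ₀ / 2)) * (C * Real.sqrt n)) := by
  have hpi := Real.pi_pos
  rcases lt_or_ge (Real.pi / 2) ε with hε2 | hε2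
  · exact ⟨0, 0, fun n _ θ₀ h1 h2 => absurd h1 (by linarith)⟩
  -- a lower bound for `sin (θ₀ / 2)` and `cos (θ₀ / 2)`, uniform in `θ₀`
  set m := Real.sin (ε / 2) with hmdef
  have hm : 0 < m := Real.sin_pos_of_pos_of_lt_pi (by linarith) (by linarith)
  obtain ⟨C₁, N, hC₁, hasymp⟩ := exists_energy_asymptotics hm
  set K : ℝ := 4608 / m ^ 6 * (2 * Real.pi) with hK
  have hK0 : 0 ≤ K := by positivity
  set C₂ : ℝ := 1 + 3 * Real.pi * (1 + C₁) / m ^ 3 with hC₂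
  have hC₂1 : 1 ≤ C₂ := by
    have : 0 ≤ 3 * Real.pi * (1 + C₁) / m ^ 3 := by positivity
    linarith
  refine ⟨C₁ + K + C₂, max N 1, fun n hn θ₀ hθ1 hθ2 => ?_⟩
  have hnN : N ≤ n := (le_max_left _ _).trans hn
  have hn1 : 1 ≤ n := (le_max_right _ _).trans hn
  have hnR : (1 : ℝ) ≤ n := by exact_mod_cast hn1
  obtain ⟨α, rfl⟩ : ∃ α, θ₀ = 2 * α := ⟨θ₀ / 2, by ring⟩
  have hα0 : 0 ≤ α := by linarith
  have hα : α < Real.pi / 2 := by linarith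
  have hsm : m ≤ Real.sin α := by
    apply Real.sin_le_sin_of_le_of_le_pi_div_two <;> linarith
  have hcm : m ≤ Real.cos α := by
    rw [← Real.sin_pi_div_two_sub]
    apply Real.sin_le_sin_of_le_of_le_pi_div_two <;> linarith
  have hsin : 0 < Real.sin α := hm.trans_le hsm
  have hcos : 0 < Real.cos α := hm.trans_le hcm
  obtain ⟨hb0, hb1, hρ, hc⟩ := half_angle_relations hsin hα0 hα
  have ea : 2 * α / 2 = α := by ring
  have eb : 2 * α / 4 = α / 2 := by ring
  have hell := exp_neg_ellConst (θ₀ := 2 * α) (by rwa [ea]) n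
  have hell2 := exp_neg_half_ellConst (θ₀ := 2 * α) (by rwa [ea]) n
  have hx := exp_xCrit (θ₀ := 2 * α) (by rwa [eb]) n
  have hxn : Real.exp (-(n * xCrit (2 * α))) = Real.tan (α / 2) ^ (2 * n) := by
    rw [Real.exp_neg, hx, eb, inv_pow, inv_inv]
  rw [ea] at hell hell2 ⊢
  rw [eb] at hx
  rw [hell, hell2, hx, hxn]
  set β := Real.tan (α / 2) with hβ
  set ρ := Real.sin α with hρdef
  set R := √(n : ℝ) with hR
  have hR2 : R ^ 2 = n := Real.sq_sqrt (by linarith)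
  have hR1 : 1 ≤ R := Real.one_le_sqrt.mpr hnR
  have hR0 : 0 < R := by linarith
  have hρ1 : ρ ≤ 1 := Real.sin_le_one α
  -- for negative `s` the weight need not be positive, and the polynomials are chosen arbitrarily
  have hexΦ : ∀ s : ℝ, ∃ Φ : Polynomial ℂ, 0 ≤ s → IsMonicOrthogonal (2 * α) s n Φ := fun s => by
    by_cases hs : 0 ≤ s
    · obtain ⟨Φ, h⟩ := exists_isMonicOrthogonal (by linarith : 0 < 2 * α) (by linarith) hs n
      exact ⟨Φ, fun _ => h⟩
    · exact ⟨0, fun h => absurd h hs⟩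
  have hexQ : ∀ s : ℝ, ∃ Q : Polynomial ℂ, 0 ≤ s → Q.degree < (n : WithBot ℕ) ∧ ∀ k < n,
      (symbolMean (2 * α) s fun θ => Q.eval (circlePt θ) * circlePt θ ^ (-(k : ℤ))) =
        if k = 0 then -1 else 0 := fun s => by
    by_cases hs : 0 ≤ s
    · obtain ⟨Q, h⟩ := exists_polynomial_moments (by linarith : 0 < 2 * α) (by linarith) hs n
        fun k => if k = 0 then -1 else 0
      exact ⟨Q, fun _ => h⟩
    · exact ⟨0, fun h => absurd h hs⟩
  choose Φ hΦ using hexΦ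
  choose Q hQ using hexQ
  refine ⟨fun s z => !![(Φ s).eval z, cauchyTransform (2 * α) s n (Φ s) z;
    (Q s).eval z, cauchyTransform (2 * α) s n (Q s) z], fun s hs => ?_⟩
  have hs0 : 0 ≤ s := hs.1
  have hΦs := hΦ s hs0
  have hsol := isRHSolution_of_moments s (by linarith : 0 < 2 * α) (by linarith) hn1
    hΦs.degree_sub (hQ s hs0).1 hΦs.moments (hQ s hs0).2
  have hY12 : ∀ t : ℝ, 0 ≤ t → cauchyTransform (2 * α) t n (Φ t) 0 =
      (energy (2 * α) t (Φ t) : ℂ) := fun t ht => (hΦ t ht).cauchyTransform_zero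
  -- the critical value of `s` is exactly `β ^ (2n)`
  have hh := hasymp n hnN α hα0 hα.le hsm hcm s hs0 hs.2.le (Φ s) hΦs
  have hhpos : 0 < energy (2 * α) s (Φ s) :=
    (energy_zero_pos (by linarith) (by linarith) hΦs.monic.ne_zero).trans_le
      (energy_zero_le (by linarith) hs0 _)
  have hgap : ∀ P : Polynomial ℂ, P.natDegree ≤ n →
      gapEnergy (2 * α) P ≤ K / R * β⁻¹ ^ (2 * n) * energy (2 * α) 0 P := fun P hP =>
    gapEnergy_le hm hα0 hα.le hsm hcm hn1 hP
  have hbi : 0 ≤ β⁻¹ ^ (2 * n) := by positivity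
  refine ⟨⟨hsol, fun Z hZ => hsol.eqOn (by linarith) (by linarith) hZ⟩, ?_, ?_, ?_⟩
  · simp only [Matrix.of_apply, Matrix.cons_val', Matrix.cons_val_zero, Matrix.cons_val_one,
      Matrix.cons_val_fin_one]
    rw [hY12 s hs0, ← Complex.ofReal_sub, Complex.norm_real, Real.norm_eq_abs, ← pow_succ]
    refine hh.trans ?_
    calc ρ ^ (2 * n + 1) * (C₁ / R) ≤ ρ ^ (2 * n) * (C₁ / R) := by
          gcongr ?_ * _
          exact pow_le_pow_of_le_one hsin.le hρ1 (Nat.le_succ _)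
      _ ≤ _ := by gcongr; linarith
  · have hder := IsMonicOrthogonal.hasDerivWithinAt_energy (S := Set.Ico 0 (β ^ (2 * n))) (Φ := Φ)
      (fun t ht => ht.1) (fun t ht => hΦ t ht.1) (by linarith) (by positivity) hgap hs
    refine ⟨(gapEnergy (2 * α) (Φ s) : ℂ) / (energy (2 * α) s (Φ s) : ℂ), ?_, ?_⟩
    · have h2 := hder.ofReal_comp.clog_real
        (Complex.ofReal_mem_slitPlane.mpr hhpos)
      refine h2.congr_of_mem (fun t ht => ?_) hs
      simp only [Matrix.of_apply, Matrix.cons_val', Matrix.cons_val_zero, Matrix.cons_val_one,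
        Matrix.cons_val_fin_one]
      rw [hY12 t ht.1]
    · have hg0 := gapEnergy_nonneg (by linarith : 2 * α ≤ Real.pi) (Φ s)
      rw [← Complex.ofReal_div, Complex.norm_real, Real.norm_eq_abs,
        abs_of_nonneg (by positivity), div_le_iff₀ hhpos]
      refine (hgap _ hΦs.natDegree_eq.le).trans ?_
      have h3 := energy_zero_le (by linarith : 2 * α ≤ Real.pi) hs0 (Φ s)
      have h4 := energy_zero_nonneg (by linarith : 0 ≤ 2 * α) (Φ s)
      gcongr
      linarith
  · refine ⟨(Φ s).eval (arcEnd (2 * α)), ?_, ?_⟩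
    · simp only [Matrix.of_apply, Matrix.cons_val', Matrix.cons_val_zero,
        Matrix.cons_val_fin_one]
      exact (Φ s).continuous.continuousAt.tendsto.mono_left nhdsWithin_le_nhds
    · have hβ2 : β ^ (2 * n) ≤ β ^ 2 := pow_le_pow_of_le_one hb0.le hb1.le (by omega)
      have hs1 : s ≤ β ^ 2 := hs.2.le.trans hβ2
      have hcb : m ≤ 1 - β ^ 2 := by
        refine hcm.trans ?_
        rw [hc]
        exact div_le_self (by nlinarith) (by nlinarith)
      have hE : energy (2 * α) s (Φ s) ≤ ρ ^ (2 * n) * (1 + C₁) := by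
        have h6 := (abs_le.mp hh).2
        have h7 : C₁ / R ≤ C₁ := div_le_self hC₁ hR1
        have h8 : ρ ^ (2 * n + 1) ≤ ρ ^ (2 * n) := pow_le_pow_of_le_one hsin.le hρ1 (Nat.le_succ _)
        calc energy (2 * α) s (Φ s) ≤ ρ ^ (2 * n + 1) * (1 + C₁ / R) := by linarith
          _ ≤ _ := by gcongr
      have h14 := norm_eval_arcEnd_le hm (by linarith) hα.le hsm hcm hn1 hs0 (by linarith) hΦs hC₁ hE
      refine h14.trans ?_
      rw [← hC₂]
      gcongr
      linarith
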